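/- **Setting.** Let $z_1,\dots,z_n\in\mathbb C$ be pairwise distinct ($n\ge 0$), $z_{n+1}=\infty$, $U(z)=\mathbb P^1\setminus\{z_1,\dots,z_n,\infty\}$, and let $\Omega^0(U(z))$, $\Omega^1(U(z))$ be the spaces of rational functions and rational differential forms regular on $U(z)$. Let $M^1,\dots,M^n,k\in\mathbb C$ with $k\ne-2$, $\kappa=k+2$ and $M^{n+1}=M^1+\dots+M^n-2$. The shifted twisted De Rham complex $\Omega^\bullet(U(z))[1]$ is $0\to\Omega^0(U(z))\xrightarrow{\tilde d}\Omega^1(U(z))\to0$ with $\Omega^j$ placed in degree $j-1$ and $\tilde d=d+\alpha\wedge\cdot$, $\alpha=-\frac1\kappa\sum_{i=1}^n\frac{M^i}{t-z_i}\,dt$. Let $e,f,h$ be the standard basis of $\mathfrak{sl}_2$, let $\widehat{\mathfrak{sl}}_2=\mathfrak{sl}_2[T,T^{-1}]\oplus\mathbb Cc$ with $c$ central and $[aT^i,bT^j]=[a,b]T^{i+j}+i\,\mathrm{tr}(ab)\,\delta_{i+j,0}\,c$, and put $f_1=f,\ e_1=e,\ h_1=h,\ f_2=eT^{-1},\ e_2=fT,\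 h_2=c-h$. Let $V_i=V(M^i,k-M^i)$ be the Verma module generated by $v_i$ with relations $e_1v_i=e_2v_i=0$, $h_1v_i=M^iv_i$, $h_2v_i=(k-M^i)v_i$. It is graded by $(p_1,p_2)\in\mathbb Z_{\ge0}^2$, where $p_j$ counts the factors $f_j$. The contragredient dual $V_i^*$ is the direct sum of the duals of the graded components, with the action determined by $\langle f_j\phi,x\rangle=\langle\phi,e_jx\rangle$, $\langle e_j\phi,x\rangle=\langle\phi,f_jx\rangle$. As a basis of $V_i$ take the monomials $$\tfrac{f}{T^{i_1}}\cdots\tfrac{f}{T^{i_a}}\ \tfrac{h}{T^{j_1}}\cdots\tfrac{h}{T^{j_b}}\ \tfrac{e}{T^{l_1}}\cdots\tfrac{e}{T^{l_c}}\,v_i$$ with $i_1\ge\dots\ge i_a\ge0$, $j_1\ge\dots\ge j_b\ge1$, $l_1\ge\dots\ge l_c\ge1$ in the degrees with $p_1\ge p_2$, and the same monomials with the three groups in the order $e,h,f$ in the degrees with $p_1<p_2$. Here $\frac{a}{T^i}=aT^{-i}$. For a basis vector $x$ let $(x)^*\in V_i^*$ denote the corresponding element of the dual basis. The Lie algebra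 $\mathfrak{sl}_2(U(z))$ of $\mathfrak{sl}_2$-valued rational functions regular on $U(z)$ acts on $\bigotimes_{i=1}^{n+1}V_i^*$: a function acts as the sum over $i$ of its actions on the factors. On the $i$-th factor, $i\le n$, it acts through its Laurent expansion in $T=t-z_i$; on the last factor it acts through its Laurent expansion in $T=1/t$, twisted by the automorphism $\pi\colon c\mapsto c,\ eT^i\mapsto fT^i,\ fT^i\mapsto eT^i,\ hT^i\mapsto-hT^i$. Let $C_\bullet=C_\bullet(\mathfrak{sl}_2(U(z));\bigotimes_{i=1}^{n+1}V_i^*)$ be the standard (Chevalley–Eilenberg) chain complex, with terms $\Lambda^p\mathfrak{sl}_2(U(z))\otimes\bigotimes_iV_i^*$ in degree $-p$, so that its right end is $\cdots\to\mathfrak{sl}_2(U(z))\otimes\bigotimes_iV_i^*\xrightarrow{x\otimes w\mapsto xw}\bigotimes_iV_i^*\to0$. **Theorem.** There is exactly one linear map $\eta^1:\Omega^1(U(z))\to\bigotimes_{i=1}^{n+1}V_i^*$ with, for all $b\ge0$ and $1\le m\le n$, $$\frac{dt}{(t-z_m)^{b+1}}\mapsto-\kappa\,v_1^*\otimes\cdots\otimes\Big(\frac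 f{T^b}v_m\Big)^*\otimes\cdots\otimes v_{n+1}^*,\qquad t^b\,dt\mapsto\kappa\,v_1^*\otimes\cdots\otimes v_n^*\otimes\Big(\frac e{T^{b+1}}v_{n+1}\Big)^*,$$ and exactly one linear map $\eta^0:\Omega^0(U(z))\to\mathfrak{sl}_2(U(z))\otimes\bigotimes_{i=1}^{n+1}V_i^*$ with $$\frac1{(t-z_m)^b}\mapsto\frac f{(t-z_m)^b}\otimes v_1^*\otimes\cdots\otimes v_{n+1}^*-\sum_{l=1}^b\Big[\frac e{(t-z_m)^l}\otimes v_1^*\otimes\cdots\otimes2\!\!\sum_{i+j=b-l,\ i\ge j\ge0}\!\!\Big(\frac f{T^i}\frac f{T^j}v_m\Big)^*\otimes\cdots\otimes v_{n+1}^*+\frac h{(t-z_m)^l}\otimes v_1^*\otimes\cdots\otimes\Big(\frac f{T^{b-l}}v_m\Big)^*\otimes\cdots\otimes v_{n+1}^*\Big]$$ for $b\ge1$, $1\le m\le n$, with $1\mapsto f\otimes v_1^*\otimes\cdots\otimes v_{n+1}^*$ and $t\mapsto ft\otimes v_1^*\otimes\cdots\otimes v_{n+1}^*$, and with $$t^b\mapsto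 ft^b\otimes v_1^*\otimes\cdots\otimes v_{n+1}^*-\sum_{l=0}^{b-2}\Big[et^l\otimes v_1^*\otimes\cdots\otimes v_n^*\otimes2\!\!\sum_{i+j=b-l,\ i\ge j\ge1}\!\!\Big(\frac e{T^i}\frac e{T^j}v_{n+1}\Big)^*+ht^{l+1}\otimes v_1^*\otimes\cdots\otimes v_n^*\otimes\Big(\frac e{T^{b-l-1}}v_{n+1}\Big)^*\Big]$$ for $b\ge2$. The maps $\eta^0$ (in degree $-1$), $\eta^1$ (in degree $0$) and zero in all other degrees form a morphism of complexes $$\eta:\ \Omega^\bullet(U(z))[1]\longrightarrow C_\bullet\Big(\mathfrak{sl}_2(U(z));\bigotimes_{i=1}^{n+1}V_i^*\Big),$$ and $\eta$ is injective in every degree. -/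

import Mathlib

open scoped TensorProduct

attribute [local instance 100] LieRing.ofAssociativeRing

noncomputable section

namespace AffineSl2

/-! ### The Lie algebra `sl₂` and its affinization -/

/-- The Lie algebra of complex traceless `2 × 2` matrices. -/
abbrev Sl2 : Type := LieAlgebra.SpecialLinear.sl (Fin 2) ℂ

/-- The generator `e`. -/
def e : Sl2 := LieAlgebra.SpecialLinear.single 0 1 (by decide) 1

/-- The generator `f`. -/
def f : Sl2 := LieAlgebra.SpecialLinear.single 1 0 (by decide) 1

/-- The generator `h`. -/
def h : Sl2 := LieAlgebra.SpecialLinear.singleSubSingle 0 1 1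

/-- The trace form `⟨a, b⟩ = tr (a b)`. -/
def form : LinearMap.BilinForm ℂ Sl2 :=
  LinearMap.mk₂ ℂ (fun a b => Matrix.trace (a.val * b.val))
    (by intros; simp [add_mul]) (by intros; simp)
    (by intros; simp [mul_add]) (by intros; simp)

theorem form_apply (a b : Sl2) : form a b = Matrix.trace (a.val * b.val) := rfl

theorem form_symm (a b : Sl2) : form a b = form b a := by
  rw [form_apply, form_apply, Matrix.trace_mul_comm]

theorem neg_form_isSymm : (-form).IsSymm :=
  ⟨fun a b => by simp [form_symm a b]⟩

theorem neg_form_invariant : (-form).lieInvariant Sl2 := by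
  intro a b c
  simp only [LinearMap.neg_apply, form_apply, LieAlgebra.SpecialLinear.sl_bracket, sub_mul, mul_sub,
    Matrix.trace_sub]
  rw [Matrix.mul_assoc b.val a.val c.val, Matrix.trace_mul_comm (a.val * b.val) c.val,
    Matrix.trace_mul_comm b.val (c.val * a.val), Matrix.trace_mul_comm b.val (a.val * c.val)]
  simp [Matrix.mul_assoc, Matrix.trace_mul_comm c.val]

/-- The two-cocycle `(a Tⁱ, b Tʲ) ↦ i ⟨a, b⟩ δ_{i+j,0}` on the loop algebra `sl₂[T, T⁻¹]`.
(Mathlib's cocycle attached to a form `Φ` is `(a Tⁱ, b Tʲ) ↦ j Φ(a, b) δ_{i+j,0}`.) -/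
def cocycle := LieAlgebra.LoopAlgebra.twoCocycleOfBilinear ℂ ℤ Sl2 (-form)
  neg_form_invariant neg_form_isSymm

/-- The affine Lie algebra `sl₂[T, T⁻¹] ⊕ ℂ c`. -/
def Affine : Type := LieAlgebra.ofTwoCocycle cocycle

instance : LieRing Affine := inferInstanceAs (LieRing (LieAlgebra.ofTwoCocycle cocycle))

instance : LieAlgebra ℂ Affine := inferInstanceAs (LieAlgebra ℂ (LieAlgebra.ofTwoCocycle cocycle))

/-- As a vector space the affine Lie algebra is the direct sum of the loop algebra and `ℂ`. -/
def ofPair : (LieAlgebra.loopAlgebra ℂ ℤ Sl2 ×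
    TrivialLieModule ℂ (LieAlgebra.loopAlgebra ℂ ℤ Sl2) ℂ) ≃ₗ[ℂ] Affine where
  toEquiv := LieAlgebra.ofProd cocycle
  map_add' _ _ := rfl
  map_smul' _ _ := rfl

/-- The element `a Tⁱ` of the affine Lie algebra, linear in `a`. -/
def T (i : ℤ) : Sl2 →ₗ[ℂ] Affine :=
  ofPair.toLinearMap ∘ₗ LinearMap.inl ℂ _ _ ∘ₗ
    TensorProduct.mk ℂ (AddMonoidAlgebra ℂ ℤ) Sl2 (AddMonoidAlgebra.single i 1)

theorem T_apply (i : ℤ) (a : Sl2) :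
    T i a = ofPair (AddMonoidAlgebra.single i 1 ⊗ₜ[ℂ] a, 0) := rfl

/-- The central element `c`. -/
def c : Affine :=
  ofPair (0, (TrivialLieModule.equiv ℂ (LieAlgebra.loopAlgebra ℂ ℤ Sl2) ℂ).symm 1)

theorem ofPair_lie (x y : LieAlgebra.loopAlgebra ℂ ℤ Sl2 ×
    TrivialLieModule ℂ (LieAlgebra.loopAlgebra ℂ ℤ Sl2) ℂ) : ⁅ofPair x, ofPair y⁆ =
    ofPair (⁅x.1, y.1⁆, (cocycle : LieAlgebra.loopAlgebra ℂ ℤ Sl2 →ₗ[ℂ]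
      LieAlgebra.loopAlgebra ℂ ℤ Sl2 →ₗ[ℂ] _) x.1 y.1) := by
  have := LieAlgebra.bracket_ofTwoCocycle (c := cocycle) (LieAlgebra.ofProd cocycle x)
    (LieAlgebra.ofProd cocycle y)
  refine this.trans ?_
  change ofPair _ = ofPair _
  congr 1
  refine Prod.ext rfl ?_
  change _ + ⁅x.1, y.2⁆ - ⁅y.1, x.2⁆ = _
  rw [trivial_lie_zero, trivial_lie_zero, add_zero, sub_zero]
  rfl

theorem cocycle_T (i j : ℤ) (a b : Sl2) :
    (cocycle : LieAlgebra.loopAlgebra ℂ ℤ Sl2 →ₗ[ℂ] LieAlgebra.loopAlgebra ℂ ℤ Sl2 →ₗ[ℂ] _)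
      (AddMonoidAlgebra.single i 1 ⊗ₜ[ℂ] a) (AddMonoidAlgebra.single j 1 ⊗ₜ[ℂ] b) =
    (TrivialLieModule.equiv ℂ (LieAlgebra.loopAlgebra ℂ ℤ Sl2) ℂ).symm
      (if i + j = 0 then (i : ℂ) * form a b else 0) := by
  change (TrivialLieModule.equiv ℂ (LieAlgebra.loopAlgebra ℂ ℤ Sl2) ℂ).symm
    (LieAlgebra.LoopAlgebra.residuePairing ℂ ℤ Sl2 (-form) _ _) = _
  congr 1
  simp only [LieAlgebra.LoopAlgebra.residuePairing_apply_apply,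
    LieAlgebra.LoopAlgebra.toFinsupp_single_tmul]
  rw [Finsupp.sum_single_index (by simp), Finsupp.single_apply]
  have hij : i = -j ↔ i + j = 0 := by omega
  by_cases hh : i + j = 0
  · have : j = -i := by omega
    subst this
    simp
  · simp [hij, hh]

theorem c_lie (x : Affine) : ⁅c, x⁆ = 0 := by
  obtain ⟨x, rfl⟩ := ofPair.surjective x
  rw [c, ofPair_lie]
  refine (congrArg ofPair (Prod.ext (y := (0, 0)) (zero_lie x.1) ?_)).trans (map_zero ofPair)
  exact LinearMap.congr_fun (map_zero _) x.1

/-- The defining bracket `[a Tⁱ, b Tʲ] = [a, b] Tⁱ⁺ʲ + i ⟨a, b⟩ δ_{i+j,0} c`. -/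
theorem T_lie_T (i j : ℤ) (a b : Sl2) :
    ⁅T i a, T j b⁆ = T (i + j) ⁅a, b⁆ + (if i + j = 0 then (i : ℂ) * form a b else 0) • c := by
  rw [T_apply, T_apply, T_apply, c, ofPair_lie, ← map_smul, ← map_add, cocycle_T]
  congr 1
  refine Prod.ext ?_ ?_
  · rw [LieAlgebra.ExtendScalars.bracket_tmul, AddMonoidAlgebra.single_mul_single, one_mul]
    exact (add_eq_left.mpr (smul_zero _)).symm
  · generalize (if i + j = 0 then (i : ℂ) * form a b else 0) = r
    exact (show r = 0 + r * 1 by ring)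

/-- The affine Lie algebra is spanned by the elements `a Tⁱ` and `c`. -/
theorem affine_ext {E : Type*} [AddCommGroup E] [Module ℂ E] {φ ψ : Affine →ₗ[ℂ] E}
    (hT : ∀ i a, φ (T i a) = ψ (T i a)) (hc : φ c = ψ c) : φ = ψ := by
  have h₁ : φ ∘ₗ ofPair.toLinearMap ∘ₗ LinearMap.inl ℂ _ _ =
      ψ ∘ₗ ofPair.toLinearMap ∘ₗ LinearMap.inl ℂ _ _ := by
    apply TensorProduct.ext'
    intro x a
    induction x using AddMonoidAlgebra.induction_linear with
    | zero => rw [TensorProduct.zero_tmul, map_zero, map_zero]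
    | add x y hx hy => rw [TensorProduct.add_tmul, map_add, map_add, hx, hy]
    | single i r =>
      have : (AddMonoidAlgebra.single i r : AddMonoidAlgebra ℂ ℤ) =
          r • AddMonoidAlgebra.single i 1 := by
        rw [AddMonoidAlgebra.smul_single, smul_eq_mul, mul_one]
      rw [this, ← TensorProduct.smul_tmul', map_smul, map_smul]
      exact congrArg (r • ·) (hT i a)
  apply LinearMap.ext
  intro x
  obtain ⟨⟨x₁, x₂⟩, rfl⟩ := ofPair.surjective x
  have hx : ofPair (x₁, x₂) = ofPair (x₁, 0) +
      (TrivialLieModule.equiv ℂ (LieAlgebra.loopAlgebra ℂ ℤ Sl2) ℂ x₂) • c := by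
    rw [c, ← map_smul, ← map_add]
    congr 1
    refine Prod.ext ?_ ?_
    · exact (add_eq_left.mpr (smul_zero _)).symm
    · exact (show ∀ r : ℂ, r = 0 + r * 1 by intro r; ring) x₂
  rw [hx, map_add, map_add, map_smul, map_smul, hc]
  congr 1
  exact LinearMap.congr_fun h₁ x₁

theorem affine_span :
    Submodule.span ℂ ({x | ∃ i a, T i a = x} ∪ {c} : Set Affine) = ⊤ := by
  set S := Submodule.span ℂ ({x | ∃ i a, T i a = x} ∪ {c} : Set Affine)
  have : S.mkQ = 0 := by
    apply affine_ext
    · intro i a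
      rw [LinearMap.zero_apply, Submodule.mkQ_apply, Submodule.Quotient.mk_eq_zero]
      exact Submodule.subset_span (Or.inl ⟨i, a, rfl⟩)
    · rw [LinearMap.zero_apply, Submodule.mkQ_apply, Submodule.Quotient.mk_eq_zero]
      exact Submodule.subset_span (Or.inr rfl)
  rw [← S.ker_mkQ, this, LinearMap.ker_zero]

theorem affine_induction {p : Affine → Prop} (hT : ∀ i a, p (T i a)) (hc : p c)
    (h0 : p 0) (hadd : ∀ x y, p x → p y → p (x + y)) (hsmul : ∀ (r : ℂ) x, p x → p (r • x))
    (x : Affine) : p x := by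
  have hx : x ∈ Submodule.span ℂ ({x | ∃ i a, T i a = x} ∪ {c} : Set Affine) := by
    rw [affine_span]; trivial
  induction hx using Submodule.span_induction with
  | mem x hx =>
    rcases hx with ⟨i, a, rfl⟩ | rfl
    · exact hT i a
    · exact hc
  | zero => exact h0
  | add x y _ _ hx hy => exact hadd x y hx hy
  | smul r x _ hx => exact hsmul r x hx

theorem e_val : e.val = !![0, 1; 0, 0] := by
  ext i j; fin_cases i <;> fin_cases j <;> simp [e, Matrix.single]

theorem f_val : f.val = !![0, 0; 1, 0] := by
  ext i j; fin_cases i <;> fin_cases j <;> simp [f, Matrix.single]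

theorem h_val : h.val = !![1, 0; 0, -1] := by
  ext i j; fin_cases i <;> fin_cases j <;> simp [h, Matrix.single]

theorem lie_val (a b : Sl2) : ⁅a, b⁆.val = a.val * b.val - b.val * a.val := rfl

theorem trace_val (a : Sl2) : Matrix.trace a.val = 0 := a.2

theorem lie_e_f : ⁅e, f⁆ = h := by
  apply Subtype.ext
  rw [lie_val, e_val, f_val, h_val]
  simp

theorem lie_h_e : ⁅h, e⁆ = (2 : ℂ) • e := by
  apply Subtype.ext
  rw [lie_val, SetLike.val_smul, e_val, h_val]
  simp
  norm_num

theorem lie_h_f : ⁅h, f⁆ = (-2 : ℂ) • f := by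
  apply Subtype.ext
  rw [lie_val, SetLike.val_smul, f_val, h_val]
  ext i j
  fin_cases i <;> fin_cases j <;> norm_num [Matrix.mul_apply]

/-- `e, h, f` span `sl₂`. -/
theorem sl2_eq (a : Sl2) : a = a.val 0 1 • e + a.val 0 0 • h + a.val 1 0 • f := by
  have ht := trace_val a
  rw [Matrix.trace_fin_two] at ht
  apply Subtype.ext
  change a.val = a.val 0 1 • e.val + a.val 0 0 • h.val + a.val 1 0 • f.val
  rw [e_val, f_val, h_val]
  ext i j
  fin_cases i <;> fin_cases j <;> simp
  linear_combination ht

/-- Matrix transposition on `sl₂`: it exchanges `e` and `f` and fixes `h`. -/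
def transpose : Sl2 →ₗ[ℂ] Sl2 where
  toFun a := ⟨a.val.transpose, (Matrix.trace_transpose _).trans (trace_val a)⟩
  map_add' _ _ := rfl
  map_smul' _ _ := rfl

theorem transpose_val (a : Sl2) : (transpose a).val = a.val.transpose := rfl

/-- The automorphism `e ↦ f`, `f ↦ e`, `h ↦ -h` of `sl₂` (simultaneous exchange of the two rows and
of the two columns). The automorphism `π` of the affine Lie algebra is `a Tⁱ ↦ flip(a) Tⁱ`,
`c ↦ c`. -/
def flip : Sl2 →ₗ⁅ℂ⁆ Sl2 where
  toFun a := ⟨a.val.submatrix (Equiv.swap 0 1) (Equiv.swap 0 1), by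
    have := trace_val a
    rw [Matrix.trace_fin_two] at this
    refine (Matrix.trace_fin_two (R := ℂ) _).trans ?_
    simpa [add_comm] using this⟩
  map_add' _ _ := rfl
  map_smul' _ _ := rfl
  map_lie' {a b} := by
    apply Subtype.ext
    change (a.val * b.val - b.val * a.val).submatrix (Equiv.swap 0 1) (Equiv.swap 0 1) =
      a.val.submatrix (Equiv.swap 0 1) (Equiv.swap 0 1) *
        b.val.submatrix (Equiv.swap 0 1) (Equiv.swap 0 1) -
      b.val.submatrix (Equiv.swap 0 1) (Equiv.swap 0 1) *
        a.val.submatrix (Equiv.swap 0 1) (Equiv.swap 0 1)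
    rw [Matrix.submatrix_mul_equiv, Matrix.submatrix_mul_equiv]
    rfl

theorem flip_val (a : Sl2) :
    (flip a).val = a.val.submatrix (Equiv.swap 0 1) (Equiv.swap 0 1) := rfl

theorem transpose_e : transpose e = f := by
  apply Subtype.ext
  rw [transpose_val, e_val, f_val]
  ext i j; fin_cases i <;> fin_cases j <;> rfl

theorem transpose_f : transpose f = e := by
  apply Subtype.ext
  rw [transpose_val, e_val, f_val]
  ext i j; fin_cases i <;> fin_cases j <;> rfl

theorem transpose_h : transpose h = h := by
  apply Subtype.ext
  rw [transpose_val, h_val]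
  ext i j; fin_cases i <;> fin_cases j <;> rfl

theorem flip_e : flip e = f := by
  apply Subtype.ext
  rw [flip_val, e_val, f_val]
  ext i j; fin_cases i <;> fin_cases j <;> simp

theorem flip_f : flip f = e := by
  apply Subtype.ext
  rw [flip_val, e_val, f_val]
  ext i j; fin_cases i <;> fin_cases j <;> simp

theorem flip_h : flip h = -h := by
  apply Subtype.ext
  rw [flip_val, NegMemClass.coe_neg, h_val]
  ext i j; fin_cases i <;> fin_cases j <;> simp

theorem form_flip (a b : Sl2) : form (flip a) (flip b) = form a b := by
  rw [form_apply, form_apply, flip_val, flip_val, Matrix.trace_fin_two, Matrix.trace_fin_two]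
  simp [Matrix.mul_apply]
  ring

theorem transpose_lie (a b : Sl2) : transpose ⁅a, b⁆ = ⁅transpose b, transpose a⁆ := by
  apply Subtype.ext
  rw [transpose_val, lie_val, lie_val, Matrix.transpose_sub, Matrix.transpose_mul,
    Matrix.transpose_mul]
  rfl

theorem form_transpose (a b : Sl2) : form (transpose a) (transpose b) = form b a := by
  rw [form_apply, form_apply, transpose_val, transpose_val, ← Matrix.transpose_mul,
    Matrix.trace_transpose]

/-- The linear anti-involution `a Tⁱ ↦ aᵀ T⁻ⁱ`, `c ↦ c` of the affine Lie algebra. It exchanges the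
Chevalley generators `eᵢ` and `fᵢ`. -/
def anti : Affine →ₗ[ℂ] Affine :=
  ofPair.toLinearMap ∘ₗ
    (TensorProduct.map (LaurentPolynomial.invert (R := ℂ)).toLinearMap transpose).prodMap
      LinearMap.id ∘ₗ ofPair.symm.toLinearMap

theorem anti_ofPair (x : LieAlgebra.loopAlgebra ℂ ℤ Sl2 ×
    TrivialLieModule ℂ (LieAlgebra.loopAlgebra ℂ ℤ Sl2) ℂ) : anti (ofPair x) =
    ofPair (TensorProduct.map (LaurentPolynomial.invert (R := ℂ)).toLinearMap transpose x.1, x.2) := by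
  change ofPair ((TensorProduct.map _ transpose).prodMap LinearMap.id (ofPair.symm (ofPair x))) = _
  rw [LinearEquiv.symm_apply_apply]
  rfl

theorem anti_T (i : ℤ) (a : Sl2) : anti (T i a) = T (-i) (transpose a) := by
  rw [T_apply, anti_ofPair]
  change ofPair (LaurentPolynomial.invert (LaurentPolynomial.T i) ⊗ₜ[ℂ] _, 0) = _
  rw [LaurentPolynomial.invert_T]
  rfl

theorem anti_c : anti c = c := by
  rw [c, anti_ofPair, map_zero]

theorem lie_c (x : Affine) : ⁅x, c⁆ = 0 := by
  rw [← lie_skew, c_lie, neg_zero]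

theorem anti_lie (x y : Affine) : anti ⁅x, y⁆ = ⁅anti y, anti x⁆ := by
  induction x using affine_induction with
  | h0 => simp
  | hadd x x' hx hx' => simp [hx, hx']
  | hsmul r x hx => simp [hx]
  | hc => simp [c_lie, anti_c, lie_c]
  | hT i a =>
    induction y using affine_induction with
    | h0 => simp
    | hadd x x' hx hx' => simp [hx, hx']
    | hsmul r x hx => simp [hx]
    | hc => simp [c_lie, anti_c, lie_c]
    | hT j b =>
      simp only [T_lie_T, map_add, map_smul, anti_T, anti_c, transpose_lie, form_transpose]
      rw [neg_add, add_comm (-i) (-j)]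
      congr 2
      by_cases hij : i + j = 0
      · have : j = -i := by omega
        subst this
        simp
      · rw [if_neg hij, if_neg (by omega)]

/-! ### Verma modules and their grading -/

/-- The Chevalley generators `f₁ = f`, `f₂ = e T⁻¹` (indexed by `0` and `1`). -/
def chevF : Fin 2 → Affine := ![T 0 f, T (-1) e]

/-- The Chevalley generators `e₁ = e`, `e₂ = f T` (indexed by `0` and `1`). -/
def chevE : Fin 2 → Affine := ![T 0 e, T 1 f]

/-- The Chevalley generators `h₁ = h`, `h₂ = c - h` (indexed by `0` and `1`). -/
def chevH : Fin 2 → Affine := ![T 0 h, c - T 0 h]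

/-- The universal enveloping algebra of the affine Lie algebra. -/
abbrev U : Type := UniversalEnvelopingAlgebra ℂ Affine

/-- The left ideal generated by `e₁`, `e₂`, `h₁ - M` and `h₂ - (k - M)`. -/
def vermaIdeal (M k : ℂ) : Submodule U U :=
  Submodule.span U
    {UniversalEnvelopingAlgebra.ι ℂ (chevE 0), UniversalEnvelopingAlgebra.ι ℂ (chevE 1),
      UniversalEnvelopingAlgebra.ι ℂ (chevH 0) - algebraMap ℂ U M,
      UniversalEnvelopingAlgebra.ι ℂ (chevH 1) - algebraMap ℂ U (k - M)}

/-- The Verma module `V(M, k - M)`: generated by a vector `v` subject to the relations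
`e₁ v = e₂ v = 0`, `h₁ v = M v`, `h₂ v = (k - M) v`. -/
def Verma (M k : ℂ) : Type := U ⧸ vermaIdeal M k

instance (M k : ℂ) : AddCommGroup (Verma M k) := 
  Submodule.Quotient.addCommGroup (vermaIdeal M k)

instance (M k : ℂ) : Module U (Verma M k) := 
  Submodule.Quotient.module (vermaIdeal M k)

instance (M k : ℂ) : Module ℂ (Verma M k) := 
  Submodule.Quotient.module' (vermaIdeal M k)

instance (M k : ℂ) : IsScalarTower ℂ U (Verma M k) :=
  inferInstanceAs (IsScalarTower ℂ U (U ⧸ vermaIdeal M k))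

/-- The projection of the enveloping algebra onto the Verma module, `u ↦ u v`. -/
def vermaMk (M k : ℂ) : U →ₗ[U] Verma M k := (vermaIdeal M k).mkQ

theorem vermaMk_eq_zero (M k : ℂ) {u : U} (hu : u ∈ vermaIdeal M k) : vermaMk M k u = 0 :=
  (Submodule.Quotient.mk_eq_zero _).mpr hu

/-- The action of the affine Lie algebra on the Verma module. -/
def vermaRep (M k : ℂ) : Affine →ₗ⁅ℂ⁆ Module.End ℂ (Verma M k) :=
  ((Algebra.lsmul ℂ ℂ (Verma M k) : U →ₐ[ℂ] Module.End ℂ (Verma M k)) :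
    U →ₗ⁅ℂ⁆ Module.End ℂ (Verma M k)).comp (UniversalEnvelopingAlgebra.ι ℂ)

/-- The generating vector `v`. -/
def vac (M k : ℂ) : Verma M k := vermaMk M k 1

section Verma

variable (M k : ℂ)

theorem vermaRep_apply (x : Affine) (y : Verma M k) :
    vermaRep M k x y = (UniversalEnvelopingAlgebra.ι ℂ x : U) • y := rfl

theorem rep_lie {W : Type*} [AddCommGroup W] [Module ℂ W] (ρ : Affine →ₗ⁅ℂ⁆ Module.End ℂ W)
    (x y : Affine) (w : W) : ρ ⁅x, y⁆ w = ρ x (ρ y w) - ρ y (ρ x w) := by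
  rw [LieHom.map_lie]; rfl

theorem smul_vac (u : U) : u • vac M k = vermaMk M k u := by
  rw [vac, ← map_smul, smul_eq_mul, mul_one]

theorem chevE_vac (i : Fin 2) : vermaRep M k (chevE i) (vac M k) = 0 := by
  rw [vermaRep_apply, smul_vac]
  apply vermaMk_eq_zero
  apply Submodule.subset_span
  fin_cases i <;> simp

theorem h_vac : vermaRep M k (T 0 h) (vac M k) = M • vac M k := by
  rw [← sub_eq_zero, ← algebraMap_smul U M (vac M k), vermaRep_apply, ← sub_smul, smul_vac]
  apply vermaMk_eq_zero
  apply Submodule.subset_span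
  simp [chevH]

theorem h2_vac : vermaRep M k (c - T 0 h) (vac M k) = (k - M) • vac M k := by
  rw [← sub_eq_zero, ← algebraMap_smul U (k - M) (vac M k), vermaRep_apply, ← sub_smul, smul_vac]
  apply vermaMk_eq_zero
  apply Submodule.subset_span
  simp [chevH]

theorem c_vac : vermaRep M k c (vac M k) = k • vac M k := by
  have := h2_vac M k
  rw [map_sub, LinearMap.sub_apply, h_vac, sub_smul] at this
  simpa using this

/-- A subspace that contains `v` and is stable under the affine Lie algebra is everything. -/
theorem verma_induction {p : Verma M k → Prop} (hv : p (vac M k)) (h0 : p 0)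
    (hadd : ∀ x y, p x → p y → p (x + y)) (hsmul : ∀ (r : ℂ) x, p x → p (r • x))
    (hT : ∀ i a x, p x → p (vermaRep M k (T i a) x)) (hc : ∀ x, p x → p (vermaRep M k c x))
    (x : Verma M k) : p x := by
  have key : ∀ (y : Affine) x, p x → p (vermaRep M k y x) := by
    intro y
    induction y using affine_induction with
    | hT i a => exact hT i a
    | hc => exact hc
    | h0 => intro x _; rw [map_zero]; exact h0
    | hadd y z hy hz => intro x hx; rw [map_add]; exact hadd _ _ (hy x hx) (hz x hx)
    | hsmul r y hy => intro x hx; rw [map_smul]; exact hsmul _ _ (hy x hx)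
  have key' : ∀ (u : U) x, p x → p (u • x) := by
    intro u
    obtain ⟨t, rfl⟩ : ∃ t, UniversalEnvelopingAlgebra.mkAlgHom ℂ Affine t = u :=
      RingCon.mk'_surjective (UniversalEnvelopingAlgebra.ringCon ℂ Affine) u
    induction t using TensorAlgebra.induction with
    | algebraMap r =>
      intro x hx
      rw [AlgHom.commutes, algebraMap_smul]
      exact hsmul _ _ hx
    | ι y => intro x hx; exact key y x hx
    | mul a b ha hb => intro x hx; rw [map_mul, mul_smul]; exact ha _ (hb _ hx)
    | add a b ha hb => intro x hx; rw [map_add, add_smul]; exact hadd _ _ (ha _ hx) (hb _ hx)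
  obtain ⟨u, rfl⟩ := (vermaIdeal M k).mkQ_surjective x
  have := key' u _ hv
  rwa [smul_vac] at this

theorem vermaRep_c (x : Verma M k) : vermaRep M k c x = k • x := by
  induction x using verma_induction with
  | hv => exact c_vac M k
  | h0 => simp
  | hadd x y hx hy => rw [map_add, hx, hy, smul_add]
  | hsmul r x hx => rw [map_smul, hx, smul_comm]
  | hT i a x hx =>
    have := rep_lie (vermaRep M k) c (T i a) x
    rw [c_lie, map_zero, LinearMap.zero_apply, hx, map_smul, eq_comm, sub_eq_zero] at this
    exact this
  | hc x hx => rw [hx, map_smul, hx]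

/-- The vector `f_{i₁} ⋯ f_{iₚ} v`. -/
def word (l : List (Fin 2)) : Verma M k :=
  l.foldr (fun i x => vermaRep M k (chevF i) x) (vac M k)

/-- The homogeneous component `V_γ`, `γ = (p₁, p₂)`: the span of the vectors `f_{i₁} ⋯ f_{iₚ} v`
where `pᵢ` is the number of `i`'s among the indices. (It is zero unless `p₁, p₂ ≥ 0`.) -/
def component (γ : ℤ × ℤ) : Submodule ℂ (Verma M k) :=
  Submodule.span ℂ {x | ∃ l : List (Fin 2), ((l.count 0 : ℤ), (l.count 1 : ℤ)) = γ ∧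
    word M k l = x}

/-- `x` maps `V_γ` to `V_{γ + δ}` for all `γ`. -/
def Shifts (x : Affine) (δ : ℤ × ℤ) : Prop :=
  ∀ γ, ∀ y ∈ component M k γ, vermaRep M k x y ∈ component M k (γ + δ)

variable {M k}

theorem word_mem (l : List (Fin 2)) :
    word M k l ∈ component M k ((l.count 0 : ℤ), (l.count 1 : ℤ)) :=
  Submodule.subset_span ⟨l, rfl, rfl⟩

theorem Shifts.of_word {x : Affine} {δ : ℤ × ℤ}
    (hx : ∀ l, vermaRep M k x (word M k l) ∈
      component M k (((l.count 0 : ℤ), (l.count 1 : ℤ)) + δ)) : Shifts M k x δ := by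
  intro γ y hy
  refine (Submodule.span_le (p := (component M k (γ + δ)).comap (vermaRep M k x))).mpr ?_ hy
  rintro _ ⟨l, rfl, rfl⟩
  exact hx l

theorem Shifts.lie {x y : Affine} {δ ε : ℤ × ℤ} (hx : Shifts M k x δ) (hy : Shifts M k y ε) :
    Shifts M k ⁅x, y⁆ (δ + ε) := by
  intro γ w hw
  rw [rep_lie]
  refine Submodule.sub_mem _ ?_ ?_
  · have := hx _ _ (hy _ _ hw)
    rwa [add_assoc, add_comm ε] at this
  · have := hy _ _ (hx _ _ hw)
    rwa [add_assoc] at this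

theorem Shifts.smul {x : Affine} {δ : ℤ × ℤ} (r : ℂ) (hx : Shifts M k x δ) :
    Shifts M k (r • x) δ := by
  intro γ w hw
  rw [map_smul]
  exact Submodule.smul_mem _ _ (hx _ _ hw)

theorem Shifts.add {x y : Affine} {δ : ℤ × ℤ} (hx : Shifts M k x δ) (hy : Shifts M k y δ) :
    Shifts M k (x + y) δ := by
  intro γ w hw
  rw [map_add]
  exact Submodule.add_mem _ (hx _ _ hw) (hy _ _ hw)

theorem shifts_c : Shifts M k c 0 := by
  intro γ w hw
  rw [vermaRep_c, add_zero]
  exact Submodule.smul_mem _ _ hw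

theorem Shifts.of_eq {a : Sl2} {i i' p q p' q' : ℤ} (hx : Shifts M k (T i a) (p, q))
    (hi : i = i') (hp : p = p') (hq : q = q') : Shifts M k (T i' a) (p', q') := by
  subst hi hp hq
  exact hx

/-- The simple root `αᵢ` as an element of the grading group. -/
def root (i : Fin 2) : ℤ × ℤ := if i = 0 then (1, 0) else (0, 1)

theorem count_cons (i : Fin 2) (l : List (Fin 2)) :
    (((i :: l).count 0 : ℤ), ((i :: l).count 1 : ℤ)) =
      ((l.count 0 : ℤ), (l.count 1 : ℤ)) + root i := by
  fin_cases i <;> simp [root]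

theorem shifts_chevF (i : Fin 2) : Shifts M k (chevF i) (root i) := by
  apply Shifts.of_word
  intro l
  rw [← count_cons]
  exact word_mem (i :: l)

theorem lie_h_chevF (i : Fin 2) :
    ⁅T 0 h, chevF i⁆ = (if i = 0 then -2 else 2 : ℂ) • chevF i := by
  fin_cases i
  · simp [chevF, T_lie_T, lie_h_f]
  · simp [chevF, T_lie_T, lie_h_e]

theorem h_word (l : List (Fin 2)) : ∃ r : ℂ, vermaRep M k (T 0 h) (word M k l) = r • word M k l := by
  induction l with
  | nil => exact ⟨M, h_vac M k⟩
  | cons i l ih =>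
    obtain ⟨r, hr⟩ := ih
    have := rep_lie (vermaRep M k) (T 0 h) (chevF i) (word M k l)
    rw [hr, lie_h_chevF, map_smul, map_smul, LinearMap.smul_apply, eq_sub_iff_add_eq,
      ← add_smul] at this
    exact ⟨_, this.symm⟩

theorem shifts_h : Shifts M k (T 0 h) 0 := by
  apply Shifts.of_word
  intro l
  obtain ⟨r, hr⟩ := h_word (M := M) (k := k) l
  rw [hr, add_zero]
  exact Submodule.smul_mem _ _ (word_mem l)

theorem lie_chevE_chevF (i j : Fin 2) :
    ⁅chevE i, chevF j⁆ = if i = j then chevH i else 0 := by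
  have hfe : form f e = 1 := by
    rw [form_apply, f_val, e_val, Matrix.trace_fin_two]; simp
  have hlfe : ⁅f, e⁆ = -h := by rw [← lie_skew, lie_e_f]
  fin_cases i <;> fin_cases j
  · simp [chevE, chevF, chevH, T_lie_T, lie_e_f]
  · simp [chevE, chevF, T_lie_T]
  · simp [chevE, chevF, T_lie_T]
  · simp [chevE, chevF, chevH, T_lie_T, hlfe, hfe]
    abel

theorem shifts_chevE (i : Fin 2) : Shifts M k (chevE i) (-root i) := by
  apply Shifts.of_word
  intro l
  induction l with
  | nil =>
    change vermaRep M k (chevE i) (vac M k) ∈ _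
    rw [chevE_vac]
    exact Submodule.zero_mem _
  | cons j l ih =>
    have := rep_lie (vermaRep M k) (chevE i) (chevF j) (word M k l)
    rw [eq_sub_iff_add_eq] at this
    change vermaRep M k (chevE i) (vermaRep M k (chevF j) (word M k l)) ∈ _
    rw [← this, count_cons]
    refine Submodule.add_mem _ ?_ ?_
    · rw [lie_chevE_chevF]
      split_ifs with hij
      · subst hij
        rw [add_neg_cancel_right]
        have hH : Shifts M k (chevH i) 0 := by
          fin_cases i
          · exact shifts_h
          · have := (shifts_c (M := M) (k := k)).add (shifts_h.smul (-1))
            rwa [neg_one_smul, ← sub_eq_add_neg] at this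
        have := hH _ _ (word_mem (M := M) (k := k) l)
        rwa [add_zero] at this
      · rw [map_zero]
        exact Submodule.zero_mem _
    · have := shifts_chevF j _ _ ih
      rwa [add_right_comm] at this

theorem shifts_neg (j : ℕ) : Shifts M k (T (-(j : ℤ)) f) (j + 1, j) ∧
    Shifts M k (T (-((j : ℤ) + 1)) h) (j + 1, j + 1) ∧
    Shifts M k (T (-((j : ℤ) + 1)) e) (j, j + 1) := by
  have hf0 : Shifts M k (T 0 f) (1, 0) := shifts_chevF 0
  have he0 : Shifts M k (T (-1) e) (0, 1) := shifts_chevF 1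
  have hh : ∀ j : ℕ, Shifts M k (T (-(j : ℤ)) f) (j + 1, j) →
      Shifts M k (T (-((j : ℤ) + 1)) h) (j + 1, j + 1) := by
    intro j hj
    have := he0.lie hj
    rw [T_lie_T, if_neg (by omega), zero_smul, add_zero, lie_e_f, Prod.mk_add_mk] at this
    refine this.of_eq ?_ ?_ ?_ <;> ring
  induction j with
  | zero => exact ⟨by simpa using hf0, by simpa using hh 0 (by simpa using hf0), by simpa using he0⟩
  | succ j ih =>
    obtain ⟨i1, i2, i3⟩ := ih
    have hh1 : Shifts M k (T (-1) h) (1, 1) := by simpa using hh 0 (by simpa using hf0)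
    have a1 : Shifts M k (T (-((j + 1 : ℕ) : ℤ)) f) ((j + 1 : ℕ) + 1, (j + 1 : ℕ)) := by
      have := (hh1.lie i1).smul (-1 / 2)
      rw [T_lie_T, if_neg (by omega), zero_smul, add_zero, lie_h_f, map_smul, smul_smul] at this
      norm_num at this
      refine this.of_eq ?_ ?_ ?_ <;> push_cast <;> ring
    refine ⟨a1, hh _ a1, ?_⟩
    have := (hh1.lie i3).smul (1 / 2)
    rw [T_lie_T, if_neg (by omega), zero_smul, add_zero, lie_h_e, map_smul, smul_smul] at this
    norm_num at this
    refine this.of_eq ?_ ?_ ?_ <;> push_cast <;> ring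

theorem shifts_pos (j : ℕ) : Shifts M k (T (j : ℤ) e) (-j - 1, -j) ∧
    Shifts M k (T ((j : ℤ) + 1) h) (-j - 1, -j - 1) ∧
    Shifts M k (T ((j : ℤ) + 1) f) (-j, -j - 1) := by
  have he0 : Shifts M k (T 0 e) (-1, 0) := by simpa [chevE, root] using shifts_chevE (M := M) (k := k) 0
  have hf0 : Shifts M k (T 1 f) (0, -1) := by simpa [chevE, root] using shifts_chevE (M := M) (k := k) 1
  have hh : ∀ j : ℕ, Shifts M k (T (j : ℤ) e) (-j - 1, -j) →
      Shifts M k (T ((j : ℤ) + 1) h) (-j - 1, -j - 1) := by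
    intro j hj
    have := hj.lie hf0
    rw [T_lie_T, if_neg (by omega), zero_smul, add_zero, lie_e_f, Prod.mk_add_mk] at this
    refine this.of_eq ?_ ?_ ?_ <;> ring
  induction j with
  | zero => exact ⟨by simpa using he0, by simpa using hh 0 (by simpa using he0), by simpa using hf0⟩
  | succ j ih =>
    obtain ⟨i1, i2, i3⟩ := ih
    have hh1 : Shifts M k (T 1 h) (-1, -1) := by simpa using hh 0 (by simpa using he0)
    have a1 : Shifts M k (T ((j + 1 : ℕ) : ℤ) e) (-(j + 1 : ℕ) - 1, -(j + 1 : ℕ)) := by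
      have := (hh1.lie i1).smul (1 / 2)
      rw [T_lie_T, if_neg (by omega), zero_smul, add_zero, lie_h_e, map_smul, smul_smul] at this
      norm_num at this
      refine this.of_eq ?_ ?_ ?_ <;> push_cast <;> ring
    refine ⟨a1, hh _ a1, ?_⟩
    have := (hh1.lie i3).smul (-1 / 2)
    rw [T_lie_T, if_neg (by omega), zero_smul, add_zero, lie_h_f, map_smul, smul_smul] at this
    norm_num at this
    refine this.of_eq ?_ ?_ ?_ <;> push_cast <;> ring

theorem shifts_e (i : ℤ) : Shifts M k (T i e) (-i - 1, -i) := by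
  rcases lt_or_ge i 0 with hi | hi
  · obtain ⟨j, hj⟩ : ∃ j : ℕ, i = -((j : ℤ) + 1) := ⟨(-i - 1).toNat, by omega⟩
    subst hj
    convert (shifts_neg j).2.2 using 2 <;> ring
  · lift i to ℕ using hi
    exact (shifts_pos i).1

theorem shifts_f (i : ℤ) : Shifts M k (T i f) (-i + 1, -i) := by
  rcases le_or_gt i 0 with hi | hi
  · obtain ⟨j, hj⟩ : ∃ j : ℕ, i = -(j : ℤ) := ⟨(-i).toNat, by omega⟩
    subst hj
    convert (shifts_neg j).1 using 2 <;> ring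
  · obtain ⟨j, hj⟩ : ∃ j : ℕ, i = (j : ℤ) + 1 := ⟨(i - 1).toNat, by omega⟩
    subst hj
    convert (shifts_pos j).2.2 using 2 <;> ring

theorem shifts_T_h (i : ℤ) : Shifts M k (T i h) (-i, -i) := by
  rcases lt_trichotomy i 0 with hi | hi | hi
  · obtain ⟨j, hj⟩ : ∃ j : ℕ, i = -((j : ℤ) + 1) := ⟨(-i - 1).toNat, by omega⟩
    subst hj
    convert (shifts_neg j).2.1 using 2 <;> ring
  · subst hi
    exact shifts_h
  · obtain ⟨j, hj⟩ : ∃ j : ℕ, i = (j : ℤ) + 1 := ⟨(i - 1).toNat, by omega⟩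
    subst hj
    convert (shifts_pos j).2.1 using 2 <;> ring

/-- The Verma module is the sum of its homogeneous components. -/
theorem iSup_component : ⨆ γ, component M k γ = ⊤ := by
  rw [eq_top_iff]
  have key : ∀ (y : Affine) (δ : ℤ × ℤ), Shifts M k y δ →
      ∀ x ∈ ⨆ γ, component M k γ, vermaRep M k y x ∈ ⨆ γ, component M k γ := by
    intro y δ hy x hx
    refine (iSup_le (a := Submodule.comap (vermaRep M k y) (⨆ γ, component M k γ)) ?_) hx
    intro γ w hw
    exact Submodule.mem_iSup_of_mem _ (hy _ _ hw)
  rintro x -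
  induction x using verma_induction with
  | hv => exact Submodule.mem_iSup_of_mem _ (word_mem (M := M) (k := k) [])
  | h0 => exact Submodule.zero_mem _
  | hadd x y hx hy => exact Submodule.add_mem _ hx hy
  | hsmul r x hx => exact Submodule.smul_mem _ _ hx
  | hT i a x hx =>
    rw [sl2_eq a, map_add, map_add, map_add, map_add, map_smul, map_smul, map_smul, map_smul,
      map_smul, map_smul]
    exact Submodule.add_mem _ (Submodule.add_mem _
      (Submodule.smul_mem _ _ (key _ _ (shifts_e i) x hx))
      (Submodule.smul_mem _ _ (key _ _ (shifts_T_h i) x hx)))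
      (Submodule.smul_mem _ _ (key _ _ (shifts_f i) x hx))
  | hc x hx => exact key _ _ shifts_c x hx

end Verma

/-! ### Contragredient Verma modules -/

/-- The restricted dual `⊕_γ V_γ^*` of the Verma module: the linear functionals that vanish on all
but finitely many homogeneous components. -/
def contra (M k : ℂ) : Submodule ℂ (Module.Dual ℂ (Verma M k)) where
  carrier := {φ | {γ | ¬ component M k γ ≤ LinearMap.ker φ}.Finite}
  zero_mem' := by simp
  add_mem' {φ ψ} hφ hψ := by
    refine (hφ.union hψ).subset ?_
    intro γ hγ
    by_contra hc
    simp only [Set.mem_union, Set.mem_ofPred_eq, not_or, not_not] at hc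
    refine hγ fun x hx => ?_
    rw [LinearMap.mem_ker, LinearMap.add_apply, LinearMap.mem_ker.mp (hc.1 hx),
      LinearMap.mem_ker.mp (hc.2 hx), add_zero]
  smul_mem' r φ hφ := by
    refine hφ.subset ?_
    intro γ hγ hc
    refine hγ fun x hx => ?_
    rw [LinearMap.mem_ker, LinearMap.smul_apply, LinearMap.mem_ker.mp (hc hx), smul_zero]

section Contra

variable {M k : ℂ}

/-- The contragredient dual `V(M, k - M)^*` as a vector space. -/
abbrev Contra (M k : ℂ) : Type := contra M k

theorem contra_of_shifts {x : Affine} {δ : ℤ × ℤ} (hx : Shifts M k x δ)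
    {φ : Module.Dual ℂ (Verma M k)} (hφ : φ ∈ contra M k) :
    (vermaRep M k x).dualMap φ ∈ contra M k := by
  have hinj : Function.Injective (fun γ : ℤ × ℤ => γ + δ) := add_left_injective δ
  refine (Set.Finite.preimage hinj.injOn hφ).subset ?_
  intro γ hγ hc
  exact hγ fun y hy => hc (hx _ _ hy)

theorem contra_stable (x : Affine) {φ : Module.Dual ℂ (Verma M k)} (hφ : φ ∈ contra M k) :
    (vermaRep M k x).dualMap φ ∈ contra M k := by
  have hadd : ∀ x y : Affine, (vermaRep M k (x + y)).dualMap φ =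
      (vermaRep M k x).dualMap φ + (vermaRep M k y).dualMap φ := by
    intro x y; ext w
    simp
  have hsmul : ∀ (r : ℂ) (x : Affine), (vermaRep M k (r • x)).dualMap φ =
      r • (vermaRep M k x).dualMap φ := by
    intro r x; ext w
    simp
  induction x using affine_induction with
  | hT i a =>
    have hTa : T i a = a.val 0 1 • T i e + a.val 0 0 • T i h + a.val 1 0 • T i f := by
      conv_lhs => rw [sl2_eq a]
      simp only [map_add, map_smul]
    rw [hTa, hadd, hadd, hsmul, hsmul, hsmul]
    exact Submodule.add_mem _ (Submodule.add_mem _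
      (Submodule.smul_mem _ _ (contra_of_shifts (shifts_e i) hφ))
      (Submodule.smul_mem _ _ (contra_of_shifts (shifts_T_h i) hφ)))
      (Submodule.smul_mem _ _ (contra_of_shifts (shifts_f i) hφ))
  | hc => exact contra_of_shifts shifts_c hφ
  | h0 =>
    have : (vermaRep M k 0).dualMap φ = 0 := by ext w; simp
    rw [this]
    exact Submodule.zero_mem _
  | hadd x y hx hy => rw [hadd]; exact Submodule.add_mem _ hx hy
  | hsmul r x hx => rw [hsmul]; exact Submodule.smul_mem _ _ hx

variable (M k) in
/-- The action of the affine Lie algebra on the contragredient dual: `⟨x φ, y⟩ = ⟨φ, anti(x) y⟩`,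
so that `⟨fᵢ φ, y⟩ = ⟨φ, eᵢ y⟩` and `⟨eᵢ φ, y⟩ = ⟨φ, fᵢ y⟩`. -/
def contraRep : Affine →ₗ⁅ℂ⁆ Module.End ℂ (Contra M k) where
  toFun x := (vermaRep M k (anti x)).dualMap.restrict fun _ hφ => contra_stable (anti x) hφ
  map_add' x y := by
    ext φ w
    change φ.val (vermaRep M k (anti (x + y)) w) =
      φ.val (vermaRep M k (anti x) w) + φ.val (vermaRep M k (anti y) w)
    rw [map_add, map_add, LinearMap.add_apply, map_add]
  map_smul' r x := by
    ext φ w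
    change φ.val (vermaRep M k (anti (r • x)) w) = r • φ.val (vermaRep M k (anti x) w)
    rw [map_smul, map_smul, LinearMap.smul_apply, map_smul]
  map_lie' {x y} := by
    ext φ w
    change φ.val (vermaRep M k (anti ⁅x, y⁆) w) =
      φ.val (vermaRep M k (anti y) (vermaRep M k (anti x) w)) -
      φ.val (vermaRep M k (anti x) (vermaRep M k (anti y) w))
    rw [anti_lie, rep_lie, map_sub]

theorem contraRep_apply (x : Affine) (φ : Contra M k) (w : Verma M k) :
    (contraRep M k x φ).val w = φ.val (vermaRep M k (anti x) w) := rfl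

theorem contraRep_chevF (i : Fin 2) (φ : Contra M k) (w : Verma M k) :
    (contraRep M k (chevF i) φ).val w = φ.val (vermaRep M k (chevE i) w) := by
  rw [contraRep_apply]
  fin_cases i
  · simp [chevE, chevF, anti_T, transpose_f]
  · simp [chevE, chevF, anti_T, transpose_e]

theorem contraRep_chevE (i : Fin 2) (φ : Contra M k) (w : Verma M k) :
    (contraRep M k (chevE i) φ).val w = φ.val (vermaRep M k (chevF i) w) := by
  rw [contraRep_apply]
  fin_cases i
  · simp [chevE, chevF, anti_T, transpose_e]
  · simp [chevE, chevF, anti_T, transpose_f]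

theorem contraRep_c (φ : Contra M k) : contraRep M k c φ = k • φ := by
  ext w
  rw [contraRep_apply, anti_c, vermaRep_c, map_smul]
  rfl

/-- The finiteness property (Fin) of a representation: every vector is killed by all `a Tʲ` with `j`
large enough. -/
def FinProp {W : Type*} [AddCommGroup W] [Module ℂ W] (ρ : Affine →ₗ⁅ℂ⁆ Module.End ℂ W) : Prop :=
  ∀ w : W, ∃ N : ℤ, ∀ j, N ≤ j → ∀ a : Sl2, ρ (T j a) w = 0

theorem contraRep_fin : FinProp (contraRep M k) := by
  intro φ
  obtain ⟨B, hB⟩ := (φ.2.image Prod.snd).bddAbove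
  refine ⟨max (B + 1) 0, fun j hj a => ?_⟩
  have key : ∀ (b : Sl2) (p : ℤ), Shifts M k (T (-j) b) (p, j) →
      ∀ w, φ.val (vermaRep M k (T (-j) b) w) = 0 := by
    intro b p hb w
    suffices hle : ⨆ γ, component M k γ ≤ LinearMap.ker (φ.val ∘ₗ vermaRep M k (T (-j) b)) by
      rw [iSup_component] at hle
      exact hle (x := w) trivial
    refine iSup_le fun γ y hy => ?_
    rcases lt_or_ge γ.2 0 with hγ | hγ
    · have : component M k γ = ⊥ := by
        rw [component, Submodule.span_eq_bot]
        rintro x ⟨l, hl, -⟩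
        rw [← hl] at hγ
        exact absurd hγ (by simp)
      rw [this, Submodule.mem_bot] at hy
      rw [hy]
      exact Submodule.zero_mem _
    · by_contra hne
      have hmem : γ + (p, j) ∈ {γ | ¬ component M k γ ≤ LinearMap.ker φ.val} := by
        intro hle
        exact hne (hle (hb _ _ hy))
      have := hB ⟨_, hmem, rfl⟩
      rw [Prod.snd_add] at this
      have h1 : B + 1 ≤ j := le_trans (le_max_left _ _) hj
      change γ.2 + j ≤ B at this
      omega
  ext w
  rw [contraRep_apply, anti_T, sl2_eq (transpose a)]
  simp only [map_add, map_smul, LinearMap.add_apply, LinearMap.smul_apply]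
  have h1 := key e (j - 1) (by simpa using shifts_e (M := M) (k := k) (-j)) w
  have h2 := key h j (by simpa using shifts_T_h (M := M) (k := k) (-j)) w
  have h3 := key f (j + 1) (by simpa using shifts_f (M := M) (k := k) (-j)) w
  rw [h1, h2, h3]
  simp

end Contra

/-! ### Poincaré–Birkhoff–Witt monomials and dual vectors -/

/-- The product of the commuting operators `a / T^{i₁}, …, a / T^{iₛ}` on the Verma module, where
`i₁ ≥ … ≥ iₛ` are the elements of the multiset `I`. -/
def creation (M k : ℂ) (a : Sl2) (I : Multiset ℕ) : Module.End ℂ (Verma M k) :=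
  ((I.sort (· ≥ ·)).map fun i : ℕ => vermaRep M k (T (-(i : ℤ)) a)).prod

/-- The index of a monomial: the exponents `i₁ ≥ … ≥ iₐ ≥ 0` of `f`, `j₁ ≥ … ≥ j_b ≥ 1` of `h` and
`l₁ ≥ … ≥ l_c ≥ 1` of `e`. -/
structure MonoIndex where
  /-- exponents of `f` -/
  I : Multiset ℕ
  /-- exponents of `h` -/
  J : Multiset ℕ
  /-- exponents of `e` -/
  L : Multiset ℕ
  J_pos : ∀ j ∈ J, 1 ≤ j
  L_pos : ∀ l ∈ L, 1 ≤ l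

/-- The distinguished basis vectors of the Verma module. A monomial with `a` factors `f/T^i` and `c`
factors `e/T^l` has degree `(p₁, p₂)` with `p₁ - p₂ = a - c`. If `p₁ ≥ p₂` the order of the factors
is `f`, `h`, `e`; if `p₁ < p₂` it is `e`, `h`, `f`. -/
def monomial (M k : ℂ) (m : MonoIndex) : Verma M k :=
  if m.L.card ≤ m.I.card then
    creation M k f m.I (creation M k h m.J (creation M k e m.L (vac M k)))
  else
    creation M k e m.L (creation M k h m.J (creation M k f m.I (vac M k)))

open Classical in
/-- The vector `(x)^*` of the dual basis of `V^*`, where `x` is the basis vector with index `m`: the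
unique functional with value `1` at `x` and `0` at all other basis vectors. -/
def dualVec (M k : ℂ) (m : MonoIndex) : Contra M k :=
  if hm : ∃! φ : Contra M k, ∀ m', φ.val (monomial M k m') = if m' = m then 1 else 0 then
    hm.choose
  else 0

/-- The index of the monomial `v`. -/
def idxV : MonoIndex := ⟨0, 0, 0, by simp, by simp⟩

/-- The index of the monomial `(f / Tⁱ) v`. -/
def idxF (i : ℕ) : MonoIndex := ⟨{i}, 0, 0, by simp, by simp⟩

/-- The index of the monomial `(f / Tⁱ) (f / Tʲ) v`. -/
def idxFF (i j : ℕ) : MonoIndex := ⟨{i, j}, 0, 0, by simp, by simp⟩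

/-- The index of the monomial `(e / T^{i+1}) v`. -/
def idxE (i : ℕ) : MonoIndex := ⟨0, 0, {i + 1}, by simp, by simp⟩

/-- The index of the monomial `(e / T^{i+1}) (e / T^{j+1}) v`. -/
def idxEE (i j : ℕ) : MonoIndex := ⟨0, 0, {i + 1, j + 1}, by simp, by simp⟩

/-! ### Action of Laurent series -/

section Laurent

open Finset

theorem exists_lower (u : LaurentSeries ℂ) : ∃ L : ℤ, ∀ j < L, u.coeff j = 0 :=
  ⟨u.order, fun _ hj => HahnSeries.coeff_eq_zero_of_lt_order hj⟩

theorem coeff_mul_eq {u v : LaurentSeries ℂ} {L N m : ℤ} (hu : ∀ j < L, u.coeff j = 0)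
    (hv : ∀ j < L, v.coeff j = 0) (hm : m - L < N) :
    (u * v).coeff m = ∑ p ∈ (Ico L N ×ˢ Ico L N) with p.1 + p.2 = m,
      u.coeff p.1 * v.coeff p.2 := by
  rw [HahnSeries.coeff_mul]
  apply Finset.sum_subset
  · rintro ⟨i, j⟩ hij
    rw [Finset.mem_antidiagonal] at hij
    obtain ⟨hi, hj, hs⟩ := hij
    have h1 : L ≤ i := by
      by_contra hlt
      exact hi (hu i (by omega))
    have h2 : L ≤ j := by
      by_contra hlt
      exact hj (hv j (by omega))
    simp only at hs
    simp only [mem_filter, mem_product, mem_Ico]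
    omega
  · rintro ⟨i, j⟩ hij hn
    simp only [mem_filter] at hij
    by_contra hne
    apply hn
    rw [Finset.mem_antidiagonal]
    exact ⟨left_ne_zero_of_mul hne, right_ne_zero_of_mul hne, hij.2⟩

/-- The Euler derivation `T d/dT` on Laurent series. -/
def euler (u : LaurentSeries ℂ) : LaurentSeries ℂ where
  coeff j := (j : ℂ) * u.coeff j
  isPWO_support' := u.isPWO_support'.mono fun _ hj => right_ne_zero_of_mul hj

theorem euler_coeff (u : LaurentSeries ℂ) (j : ℤ) : (euler u).coeff j = j * u.coeff j := rfl

theorem euler_mul (u v : LaurentSeries ℂ) : euler (u * v) = euler u * v + u * euler v := by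
  obtain ⟨L₁, h₁⟩ := exists_lower u
  obtain ⟨L₂, h₂⟩ := exists_lower v
  have hu : ∀ j < min L₁ L₂, u.coeff j = 0 := fun j hj => h₁ j (by omega)
  have hv : ∀ j < min L₁ L₂, v.coeff j = 0 := fun j hj => h₂ j (by omega)
  have hu' : ∀ j < min L₁ L₂, (euler u).coeff j = 0 := fun j hj => by rw [euler_coeff, hu j hj, mul_zero]
  have hv' : ∀ j < min L₁ L₂, (euler v).coeff j = 0 := fun j hj => by rw [euler_coeff, hv j hj, mul_zero]
  ext m
  have hm : m - min L₁ L₂ < m - min L₁ L₂ + 1 := by omega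
  rw [HahnSeries.coeff_add, euler_coeff, coeff_mul_eq hu hv hm, coeff_mul_eq hu' hv hm,
    coeff_mul_eq hu hv' hm, ← Finset.sum_add_distrib, Finset.mul_sum]
  refine Finset.sum_congr rfl fun p hp => ?_
  rw [mem_filter] at hp
  rw [euler_coeff, euler_coeff, ← hp.2]
  push_cast
  ring

theorem euler_add (u v : LaurentSeries ℂ) : euler (u + v) = euler u + euler v := by
  ext m
  simp only [euler_coeff, HahnSeries.coeff_add]
  ring

theorem euler_smul (r : ℂ) (u : LaurentSeries ℂ) : euler (r • u) = r • euler u := by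
  ext m
  simp only [euler_coeff, HahnSeries.coeff_smul, smul_eq_mul]
  ring

/-- The residue at `T = 0` of `(du/dT) v dT`. -/
def resPair (u v : LaurentSeries ℂ) : ℂ := (euler u * v).coeff 0

variable {W : Type*} [AddCommGroup W] [Module ℂ W] {ρ : Affine →ₗ⁅ℂ⁆ Module.End ℂ W}

theorem loop_support (u : LaurentSeries ℂ) (a : Sl2) (w : W) {L N : ℤ}
    (hL : ∀ j < L, u.coeff j = 0) (hN : ∀ j, N ≤ j → ρ (T j a) w = 0) :
    (Function.support fun j : ℤ => u.coeff j • ρ (T j a) w) ⊆ (Ico L N : Finset ℤ) := by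
  intro j hj
  rw [Finset.mem_coe, mem_Ico]
  by_contra hn
  rcases lt_or_ge j L with h1 | h1
  · exact hj (by simp [hL j h1])
  · exact hj (by simp [hN j (by omega)])

theorem loop_finite (hρ : FinProp ρ) (u : LaurentSeries ℂ) (a : Sl2) (w : W) :
    (Function.support fun j : ℤ => u.coeff j • ρ (T j a) w).Finite := by
  obtain ⟨L, hL⟩ := exists_lower u
  obtain ⟨N, hN⟩ := hρ w
  exact (Finset.finite_toSet _).subset (loop_support u a w hL fun j hj => hN j hj a)

/-- The action of the `sl₂`-valued Laurent series `u(T) a = ∑ⱼ uⱼ a Tʲ` on a representation with the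
finiteness property: `w ↦ ∑ⱼ uⱼ (a Tʲ) w`, a finite sum for every `w`. -/
def loopEnd (hρ : FinProp ρ) (u : LaurentSeries ℂ) (a : Sl2) : Module.End ℂ W where
  toFun w := ∑ᶠ j : ℤ, u.coeff j • ρ (T j a) w
  map_add' w w' := by
    rw [← finsum_add_distrib (loop_finite hρ u a w) (loop_finite hρ u a w')]
    simp only [map_add, smul_add]
  map_smul' r w := by
    rw [RingHom.id_apply, smul_finsum' _ (loop_finite hρ u a w)]
    simp only [map_smul, smul_comm r]

theorem loopEnd_apply (hρ : FinProp ρ) (u : LaurentSeries ℂ) (a : Sl2) (w : W) :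
    loopEnd hρ u a w = ∑ᶠ j : ℤ, u.coeff j • ρ (T j a) w := rfl

/-- The action of Laurent series as a bilinear map. -/
def loopAct (hρ : FinProp ρ) : LaurentSeries ℂ →ₗ[ℂ] Sl2 →ₗ[ℂ] Module.End ℂ W :=
  LinearMap.mk₂ ℂ (loopEnd hρ)
    (fun u v a => by
      ext w
      rw [LinearMap.add_apply, loopEnd_apply, loopEnd_apply, loopEnd_apply,
        ← finsum_add_distrib (loop_finite hρ u a w) (loop_finite hρ v a w)]
      simp only [HahnSeries.coeff_add, add_smul])
    (fun r u a => by
      ext w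
      rw [LinearMap.smul_apply, loopEnd_apply, loopEnd_apply,
        smul_finsum' _ (loop_finite hρ u a w)]
      simp only [HahnSeries.coeff_smul, smul_eq_mul, mul_smul])
    (fun u a b => by
      ext w
      rw [LinearMap.add_apply, loopEnd_apply, loopEnd_apply, loopEnd_apply,
        ← finsum_add_distrib (loop_finite hρ u a w) (loop_finite hρ u b w)]
      simp only [map_add, LinearMap.add_apply, smul_add])
    (fun r u a => by
      ext w
      rw [LinearMap.smul_apply, loopEnd_apply, loopEnd_apply,
        smul_finsum' _ (loop_finite hρ u a w)]
      simp only [map_smul, LinearMap.smul_apply, smul_comm r])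

theorem loopAct_apply (hρ : FinProp ρ) (u : LaurentSeries ℂ) (a : Sl2) (w : W) :
    loopAct hρ u a w = ∑ᶠ j : ℤ, u.coeff j • ρ (T j a) w := rfl

theorem loopAct_eq_sum (hρ : FinProp ρ) {u : LaurentSeries ℂ} {a : Sl2} {w : W} {L N : ℤ}
    (hL : ∀ j < L, u.coeff j = 0) (hN : ∀ j, N ≤ j → ρ (T j a) w = 0) :
    loopAct hρ u a w = ∑ j ∈ Ico L N, u.coeff j • ρ (T j a) w :=
  finsum_eq_sum_of_support_subset _ (loop_support u a w hL hN)

theorem loopAct_lie (hρ : FinProp ρ) (u v : LaurentSeries ℂ) (a b : Sl2) (w : W) :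
    loopAct hρ u a (loopAct hρ v b w) - loopAct hρ v b (loopAct hρ u a w) =
      loopAct hρ (u * v) ⁅a, b⁆ w + (resPair u v * form a b) • ρ c w := by
  obtain ⟨L₁, h₁⟩ := exists_lower u
  obtain ⟨L₂, h₂⟩ := exists_lower v
  obtain ⟨N, hN⟩ := hρ w
  set L := min L₁ L₂ with hLdef
  have hu : ∀ j < L, u.coeff j = 0 := fun j hj => h₁ j (by omega)
  have hv : ∀ j < L, v.coeff j = 0 := fun j hj => h₂ j (by omega)
  have heu : ∀ j < L, (euler u).coeff j = 0 := fun j hj => by rw [euler_coeff, hu j hj, mul_zero]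
  obtain ⟨Na, hNa⟩ := hρ (loopAct hρ u a w)
  obtain ⟨Nb, hNb⟩ := hρ (loopAct hρ v b w)
  obtain ⟨K, hKN, hKL, hKL', hK0, hKa, hKb⟩ : ∃ K : ℤ, N ≤ K ∧ N - L ≤ K ∧ -L < K ∧ 0 ≤ K ∧ Na ≤ K ∧ Nb ≤ K :=
    ⟨max N (max (N - L) (max (-L + 1) (max 0 (max Na Nb)))), by omega, by omega, by omega, by omega,
      by omega, by omega⟩
  rw [loopAct_eq_sum hρ hu (N := K) fun j hj => hNb j (by omega) a,
    loopAct_eq_sum hρ hv (N := K) fun j hj => hNa j (by omega) b,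
    loopAct_eq_sum hρ hv (N := K) fun j hj => hN j (by omega) b,
    loopAct_eq_sum hρ hu (N := K) fun j hj => hN j (by omega) a]
  simp only [map_sum, map_smul, Finset.smul_sum]
  rw [Finset.sum_comm (s := Ico L K) (t := Ico L K)
    (f := fun j i => v.coeff j • u.coeff i • ρ (T j b) (ρ (T i a) w)), ← Finset.sum_sub_distrib]
  simp only [← Finset.sum_sub_distrib]
  have hterm : ∀ i j : ℤ, u.coeff i • v.coeff j • ρ (T i a) (ρ (T j b) w) -
      v.coeff j • u.coeff i • ρ (T j b) (ρ (T i a) w) =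
      (u.coeff i * v.coeff j) • ρ (T (i + j) ⁅a, b⁆) w +
        (if i + j = 0 then (euler u).coeff i * v.coeff j else 0) • form a b • ρ c w := by
    intro i j
    have := rep_lie ρ (T i a) (T j b) w
    rw [T_lie_T, map_add, map_smul, LinearMap.add_apply, LinearMap.smul_apply] at this
    rw [smul_comm (v.coeff j), ← smul_sub, ← smul_sub, ← this, smul_add, smul_add, smul_smul,
      smul_smul, smul_smul, smul_smul, euler_coeff]
    congr 2
    split_ifs <;> ring
  simp only [hterm]
  rw [← Finset.sum_product' (s := Ico L K) (t := Ico L K)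
    (f := fun i j => (u.coeff i * v.coeff j) • ρ (T (i + j) ⁅a, b⁆) w +
        (if i + j = 0 then (euler u).coeff i * v.coeff j else 0) • form a b • ρ c w),
    Finset.sum_add_distrib]
  congr 1
  · have huv : ∀ j < 2 * L, (u * v).coeff j = 0 := by
      intro j hj
      rw [coeff_mul_eq hu hv (N := j - L + 1) (by omega)]
      apply Finset.sum_eq_zero
      rintro ⟨i, i'⟩ hi
      simp only [mem_filter, mem_product, mem_Ico] at hi
      omega
    rw [loopAct_eq_sum hρ huv (N := 2 * K) fun j hj => hN j (by omega) _]
    rw [← Finset.sum_fiberwise_of_maps_to (s := Ico L K ×ˢ Ico L K) (t := Ico (2 * L) (2 * K))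
      (g := fun p : ℤ × ℤ => p.1 + p.2)]
    · refine Finset.sum_congr rfl fun m _ => ?_
      rcases lt_or_ge m N with hm | hm
      · rw [coeff_mul_eq hu hv (N := K) (by omega), Finset.sum_smul]
        refine Finset.sum_congr rfl fun p hp => ?_
        rw [mem_filter] at hp
        rw [hp.2]
      · rw [hN m hm, smul_zero]
        refine Finset.sum_eq_zero fun p hp => ?_
        rw [mem_filter] at hp
        rw [hp.2, hN m hm, smul_zero]
    · rintro ⟨i, j⟩ hij
      simp only [mem_product, mem_Ico] at hij ⊢
      omega
  · rw [← Finset.sum_smul, ← Finset.sum_filter, resPair, coeff_mul_eq heu hv (N := K) (by omega),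
      smul_smul]

end Laurent

/-! ### Rational functions regular on the punctured line and their Laurent expansions -/

section Regular

open Polynomial

/-- The algebra of rational functions on the line that are regular away from the pairwise distinct
points `z₁, …, zₙ` (and infinity): the denominator has no other root. -/
def regular {n : ℕ} (z : Fin n ↪ ℂ) : Subalgebra ℂ (RatFunc ℂ) where
  carrier := {g | ∀ w : ℂ, w ∉ Set.range z → g.denom.eval w ≠ 0}
  mul_mem' {a b} ha hb w hw h0 := by
    have h1 : (a.denom * b.denom).eval w = 0 :=
      Polynomial.eval_eq_zero_of_dvd_of_eval_eq_zero (RatFunc.denom_mul_dvd a b) h0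
    rw [Polynomial.eval_mul] at h1
    exact mul_ne_zero (ha w hw) (hb w hw) h1
  add_mem' {a b} ha hb w hw h0 := by
    have h1 : (a.denom * b.denom).eval w = 0 :=
      Polynomial.eval_eq_zero_of_dvd_of_eval_eq_zero (RatFunc.denom_add_dvd a b) h0
    rw [Polynomial.eval_mul] at h1
    exact mul_ne_zero (ha w hw) (hb w hw) h1
  algebraMap_mem' r w _ := by
    have : (algebraMap ℂ (RatFunc ℂ) r).denom = 1 := RatFunc.denom_C r
    rw [this]
    simp

/-- The ring of rational functions regular on the punctured line `U(z)`. -/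
abbrev Reg {n : ℕ} (z : Fin n ↪ ℂ) : Type := regular z

variable {n : ℕ} (z : Fin n ↪ ℂ)

/-- The coordinate function `t`. -/
def coord : Reg z := ⟨RatFunc.X, fun w _ => by rw [RatFunc.denom_X]; simp⟩

/-- The function `1 / (t - z_m)`. -/
def pole (m : Fin n) : Reg z := ⟨(RatFunc.X - RatFunc.C (z m))⁻¹, fun w hw h0 => by
  have h1 : (RatFunc.X - RatFunc.C (z m) : RatFunc ℂ)⁻¹ =
      algebraMap ℂ[X] (RatFunc ℂ) 1 / algebraMap ℂ[X] (RatFunc ℂ) (X - C (z m)) := by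
    rw [map_sub, RatFunc.algebraMap_X, RatFunc.algebraMap_C, map_one, one_div]
  rw [h1] at h0
  have := Polynomial.eval_eq_zero_of_dvd_of_eval_eq_zero (RatFunc.denom_div_dvd _ _) h0
  rw [Polynomial.eval_sub, Polynomial.eval_X, Polynomial.eval_C, sub_eq_zero] at this
  exact hw ⟨m, this.symm⟩⟩

theorem X_sub_C_ne_zero (a : ℂ) : (RatFunc.X - RatFunc.C a : RatFunc ℂ) ≠ 0 := by
  rw [← RatFunc.algebraMap_X, ← RatFunc.algebraMap_C, ← map_sub]
  exact RatFunc.algebraMap_ne_zero (Polynomial.X_sub_C_ne_zero a)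

theorem coord_mul_pole (m : Fin n) : coord z * pole z m = 1 + z m • pole z m := by
  apply Subtype.ext
  change RatFunc.X * (RatFunc.X - RatFunc.C (z m))⁻¹ =
    1 + z m • (RatFunc.X - RatFunc.C (z m) : RatFunc ℂ)⁻¹
  have := X_sub_C_ne_zero (z m)
  rw [RatFunc.smul_eq_C_mul]
  field_simp
  ring

theorem pole_mul_pole {m m' : Fin n} (hm : m ≠ m') :
    pole z m * pole z m' = (z m - z m')⁻¹ • (pole z m - pole z m') := by
  have hz : z m - z m' ≠ 0 := sub_ne_zero.mpr fun hh => hm (z.injective hh)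
  rw [eq_inv_smul_iff₀ hz]
  apply Subtype.ext
  change (z m - z m') • ((RatFunc.X - RatFunc.C (z m) : RatFunc ℂ)⁻¹ *
    (RatFunc.X - RatFunc.C (z m') : RatFunc ℂ)⁻¹) =
    (RatFunc.X - RatFunc.C (z m) : RatFunc ℂ)⁻¹ - (RatFunc.X - RatFunc.C (z m') : RatFunc ℂ)⁻¹
  have h1 := X_sub_C_ne_zero (z m)
  have h2 := X_sub_C_ne_zero (z m')
  rw [RatFunc.smul_eq_C_mul, map_sub]
  field_simp
  ring

/-- The elementary functions `t^b` and `(t - z_m)^{-b-1}`, `b ≥ 0`. -/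
def elementary : Set (Reg z) :=
  {g | (∃ b : ℕ, coord z ^ b = g) ∨ ∃ (m : Fin n) (b : ℕ), pole z m ^ (b + 1) = g}

theorem coord_mul_mem (g : Reg z) (hg : g ∈ Submodule.span ℂ (elementary z)) :
    coord z * g ∈ Submodule.span ℂ (elementary z) := by
  refine (Submodule.span_le (p := (Submodule.span ℂ (elementary z)).comap
    (LinearMap.mulLeft ℂ (coord z)))).mpr ?_ hg
  rintro _ (⟨b, rfl⟩ | ⟨m, b, rfl⟩)
  · exact Submodule.subset_span (Or.inl ⟨b + 1, pow_succ' _ _⟩)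
  · change coord z * pole z m ^ (b + 1) ∈ Submodule.span ℂ (elementary z)
    rw [pow_succ', ← mul_assoc, coord_mul_pole, add_mul, one_mul, smul_mul_assoc, ← pow_succ']
    refine Submodule.add_mem _ ?_
      (Submodule.smul_mem _ _ (Submodule.subset_span (Or.inr ⟨m, b, rfl⟩)))
    rcases b with _ | b
    · exact Submodule.subset_span (Or.inl ⟨0, by simp⟩)
    · exact Submodule.subset_span (Or.inr ⟨m, b, rfl⟩)

theorem pole_mul_mem (m : Fin n) (g : Reg z) (hg : g ∈ Submodule.span ℂ (elementary z)) :
    pole z m * g ∈ Submodule.span ℂ (elementary z) := by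
  refine (Submodule.span_le (p := (Submodule.span ℂ (elementary z)).comap
    (LinearMap.mulLeft ℂ (pole z m)))).mpr ?_ hg
  rintro _ (⟨b, rfl⟩ | ⟨m', b, rfl⟩)
  · change pole z m * coord z ^ b ∈ Submodule.span ℂ (elementary z)
    induction b with
    | zero => exact Submodule.subset_span (Or.inr ⟨m, 0, by simp⟩)
    | succ b ih =>
      rw [pow_succ', ← mul_assoc, mul_comm (pole z m), coord_mul_pole, add_mul, one_mul,
        smul_mul_assoc]
      exact Submodule.add_mem _ (Submodule.subset_span (Or.inl ⟨b, rfl⟩))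
        (Submodule.smul_mem _ _ ih)
  · change pole z m * pole z m' ^ (b + 1) ∈ Submodule.span ℂ (elementary z)
    by_cases hm : m = m'
    · subst hm
      exact Submodule.subset_span (Or.inr ⟨m, b + 1, pow_succ' _ _⟩)
    · induction b with
      | zero =>
        rw [zero_add, pow_one, pole_mul_pole z hm]
        exact Submodule.smul_mem _ _ (Submodule.sub_mem _
          (Submodule.subset_span (Or.inr ⟨m, 0, by simp⟩))
          (Submodule.subset_span (Or.inr ⟨m', 0, by simp⟩)))
      | succ b ih =>
        rw [pow_succ' _ (b + 1), ← mul_assoc, pole_mul_pole z hm, smul_mul_assoc, sub_mul,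
          ← pow_succ']
        exact Submodule.smul_mem _ _ (Submodule.sub_mem _ ih
          (Submodule.subset_span (Or.inr ⟨m', b + 1, rfl⟩)))

/-- Partial fractions: the elementary functions span the regular functions. -/
theorem span_elementary : Submodule.span ℂ (elementary z) = ⊤ := by
  rw [eq_top_iff]
  rintro ⟨g, hg⟩ -
  have hpoly : ∀ (p : ℂ[X]) (g : Reg z), g ∈ Submodule.span ℂ (elementary z) →
      aeval (coord z) p * g ∈ Submodule.span ℂ (elementary z) := by
    intro p
    induction p using Polynomial.induction_on' with
    | add p q hp hq =>
      intro g hg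
      rw [map_add, add_mul]
      exact Submodule.add_mem _ (hp g hg) (hq g hg)
    | monomial b r =>
      intro g hg
      rw [aeval_monomial, Algebra.algebraMap_eq_smul_one, smul_mul_assoc, one_mul, smul_mul_assoc]
      refine Submodule.smul_mem _ _ ?_
      induction b with
      | zero => simpa using hg
      | succ b ih =>
        rw [pow_succ', mul_assoc]
        exact coord_mul_mem z _ ih
  have hone : (1 : Reg z) ∈ Submodule.span ℂ (elementary z) :=
    Submodule.subset_span (Or.inl ⟨0, pow_zero _⟩)
  have hval : ∀ p : ℂ[X], (aeval (coord z) p : Reg z).val = algebraMap ℂ[X] (RatFunc ℂ) p := by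
    intro p
    have h1 : (regular z).val (aeval (coord z) p) = aeval ((regular z).val (coord z)) p :=
      (Polynomial.aeval_algHom_apply _ _ _).symm
    refine h1.trans ?_
    change aeval (RatFunc.X : RatFunc ℂ) p = _
    rw [← RatFunc.algebraMap_X, Polynomial.aeval_algebraMap_apply, Polynomial.aeval_X_left_apply]
  have hinv : ∀ s : Multiset ℂ, (∀ w ∈ s, w ∈ Set.range z) →
      ∃ g ∈ Submodule.span ℂ (elementary z),
        g.val * algebraMap ℂ[X] (RatFunc ℂ) (s.map fun a => X - C a).prod = 1 := by
    intro s
    induction s using Multiset.induction with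
    | empty => intro _; exact ⟨1, hone, by simp⟩
    | cons a s ih =>
      intro hs
      obtain ⟨g, hg, hg1⟩ := ih fun w hw => hs w (Multiset.mem_cons_of_mem hw)
      obtain ⟨m, rfl⟩ := hs a (Multiset.mem_cons_self _ _)
      refine ⟨pole z m * g, pole_mul_mem z m g hg, ?_⟩
      rw [Multiset.map_cons, Multiset.prod_cons, map_mul]
      have h2 : (pole z m).val * algebraMap ℂ[X] (RatFunc ℂ) (X - C (z m)) = 1 := by
        rw [map_sub, RatFunc.algebraMap_X, RatFunc.algebraMap_C]
        exact inv_mul_cancel₀ (X_sub_C_ne_zero (z m))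
      calc (pole z m).val * g.val * _ = ((pole z m).val * algebraMap ℂ[X] (RatFunc ℂ) (X - C (z m))) *
            (g.val * algebraMap ℂ[X] (RatFunc ℂ) (s.map fun a => X - C a).prod) := by ring
        _ = 1 := by rw [h2, hg1, one_mul]
  obtain ⟨q, hq, hq1⟩ := hinv g.denom.roots (by
    intro w hw
    by_contra hn
    exact hg w hn (Polynomial.isRoot_of_mem_roots hw))
  have hden : g.denom = (g.denom.roots.map fun a => X - C a).prod :=
    (IsAlgClosed.splits g.denom).eq_prod_roots_of_monic (RatFunc.monic_denom g)
  rw [← hden] at hq1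
  have hfinal : (⟨g, hg⟩ : Reg z) = aeval (coord z) g.num * q := by
    apply Subtype.ext
    change g = (aeval (coord z) g.num : Reg z).val * q.val
    have hne : algebraMap ℂ[X] (RatFunc ℂ) g.denom ≠ 0 :=
      RatFunc.algebraMap_ne_zero g.denom_ne_zero
    rw [hval, eq_inv_of_mul_eq_one_left hq1, ← div_eq_mul_inv, RatFunc.num_div_denom]
  rw [hfinal]
  exact hpoly _ _ hq

/-- The Laurent series of the coordinate `t` in the local coordinate at the `p`-th point:
`t = z_p + T` for `p ≤ n` and `t = 1 / T` at infinity (the last index). -/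
def localCoord (p : Fin (n + 1)) : LaurentSeries ℂ :=
  Fin.lastCases (motive := fun _ => LaurentSeries ℂ) (HahnSeries.single (-1) 1)
    (fun i => HahnSeries.single 1 1 + HahnSeries.C (z i)) p

theorem localCoord_last : localCoord z (Fin.last n) = HahnSeries.single (-1) 1 := by
  simp [localCoord]

theorem localCoord_castSucc (i : Fin n) :
    localCoord z i.castSucc = HahnSeries.single 1 1 + HahnSeries.C (z i) := by
  simp [localCoord]

theorem localCoord_ne_C (p : Fin (n + 1)) (r : ℂ) : localCoord z p - HahnSeries.C r ≠ 0 := by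
  intro hr
  rw [sub_eq_zero] at hr
  induction p using Fin.lastCases with
  | last =>
    rw [localCoord_last] at hr
    have := congrArg (fun u => HahnSeries.coeff u (-1)) hr
    simp [HahnSeries.C_apply] at this
  | cast i =>
    rw [localCoord_castSucc] at hr
    have := congrArg (fun u => HahnSeries.coeff u 1) hr
    simp [HahnSeries.C_apply] at this

theorem eval_localCoord_injective (p : Fin (n + 1)) :
    Function.Injective (eval₂RingHom (HahnSeries.C : ℂ →+* LaurentSeries ℂ) (localCoord z p)) := by
  rw [injective_iff_map_eq_zero]
  intro q hq
  by_contra hne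
  rw [(IsAlgClosed.splits q).eq_prod_roots, map_mul, map_multiset_prod, Multiset.map_map] at hq
  refine mul_ne_zero ?_ ?_ hq
  · simpa using hne
  · refine Multiset.prod_ne_zero fun hmem => ?_
    obtain ⟨r, -, hr⟩ := Multiset.mem_map.mp hmem
    refine localCoord_ne_C z p r ?_
    simpa using hr

theorem nonZeroDivisors_le_comap_localCoord (p : Fin (n + 1)) : nonZeroDivisors ℂ[X] ≤
    (nonZeroDivisors (LaurentSeries ℂ)).comap
      (eval₂RingHom (HahnSeries.C : ℂ →+* LaurentSeries ℂ) (localCoord z p)) :=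
  nonZeroDivisors_le_comap_nonZeroDivisors_of_injective _ (eval_localCoord_injective z p)

/-- The substitution of `localCoord z p` for `t` in a rational function. -/
def expandRat (p : Fin (n + 1)) : RatFunc ℂ →+* LaurentSeries ℂ :=
  RatFunc.liftRingHom (eval₂RingHom (HahnSeries.C : ℂ →+* LaurentSeries ℂ) (localCoord z p))
    (nonZeroDivisors_le_comap_localCoord z p)

/-- The Laurent expansion at the `p`-th point of a function regular on the punctured line: the
substitution of `localCoord z p` for `t`. -/
def expand (p : Fin (n + 1)) : Reg z →+* LaurentSeries ℂ :=
  (expandRat z p).comp (regular z).val.toRingHom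

theorem expand_coord (p : Fin (n + 1)) : expand z p (coord z) = localCoord z p := by
  change expandRat z p RatFunc.X = _
  rw [expandRat, RatFunc.liftRingHom_apply, RatFunc.num_X, RatFunc.denom_X]
  simp

theorem expand_smul (p : Fin (n + 1)) (r : ℂ) (g : Reg z) :
    expand z p (r • g) = r • expand z p g := by
  rw [Algebra.smul_def, map_mul, ← HahnSeries.C_mul_eq_smul]
  congr 1
  change expandRat z p (RatFunc.C r) = _
  rw [expandRat, RatFunc.liftRingHom_apply, RatFunc.num_C, RatFunc.denom_C]
  simp

theorem localCoord_sub_mul_expand_pole (p : Fin (n + 1)) (m : Fin n) :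
    (localCoord z p - HahnSeries.C (z m)) * expand z p (pole z m) = 1 := by
  have := congrArg (expand z p) (coord_mul_pole z m)
  rw [map_mul, map_add, map_one, expand_smul, expand_coord] at this
  rw [sub_mul, this, HahnSeries.C_mul_eq_smul, add_sub_cancel_right]

theorem expand_pole_self (m : Fin n) :
    expand z m.castSucc (pole z m) = HahnSeries.single (-1) 1 := by
  have := localCoord_sub_mul_expand_pole z m.castSucc m
  rw [localCoord_castSucc, add_sub_cancel_right] at this
  rw [eq_inv_of_mul_eq_one_right this, HahnSeries.inv_single, inv_one]

theorem expand_pole_of_ne {i m : Fin n} (hi : i ≠ m) : ∃ q : PowerSeries ℂ,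
    expand z i.castSucc (pole z m) = HahnSeries.ofPowerSeries ℤ ℂ q := by
  have := localCoord_sub_mul_expand_pole z i.castSucc m
  rw [localCoord_castSucc] at this
  have hne : PowerSeries.constantCoeff (PowerSeries.X + PowerSeries.C (z i - z m)) ≠ 0 := by
    simpa [sub_eq_zero] using fun hh => hi (z.injective hh)
  refine ⟨(PowerSeries.X + PowerSeries.C (z i - z m))⁻¹, ?_⟩
  have h1 : HahnSeries.single 1 1 + HahnSeries.C (z i) - HahnSeries.C (z m) =
      HahnSeries.ofPowerSeries ℤ ℂ (PowerSeries.X + PowerSeries.C (z i - z m)) := by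
    rw [map_add, HahnSeries.ofPowerSeries_X, HahnSeries.ofPowerSeries_C, map_sub, add_sub_assoc]
  have h2 : HahnSeries.ofPowerSeries ℤ ℂ (PowerSeries.X + PowerSeries.C (z i - z m)) *
      HahnSeries.ofPowerSeries ℤ ℂ (PowerSeries.X + PowerSeries.C (z i - z m))⁻¹ = 1 := by
    rw [← map_mul, PowerSeries.mul_inv_cancel _ hne, map_one]
  rw [h1] at this
  rw [eq_inv_of_mul_eq_one_right this, eq_inv_of_mul_eq_one_right h2]

theorem expand_pole_last (m : Fin n) : ∃ q : PowerSeries ℂ, PowerSeries.constantCoeff q = 1 ∧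
    expand z (Fin.last n) (pole z m) = HahnSeries.single 1 1 * HahnSeries.ofPowerSeries ℤ ℂ q := by
  have := localCoord_sub_mul_expand_pole z (Fin.last n) m
  rw [localCoord_last] at this
  have hone : PowerSeries.constantCoeff (1 - PowerSeries.C (z m) * PowerSeries.X) = 1 := by simp
  have hne : PowerSeries.constantCoeff (1 - PowerSeries.C (z m) * PowerSeries.X) ≠ 0 := by
    rw [hone]; exact one_ne_zero
  refine ⟨(1 - PowerSeries.C (z m) * PowerSeries.X)⁻¹, ?_, ?_⟩
  · rw [PowerSeries.constantCoeff_inv, hone, inv_one]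
  have h2 : HahnSeries.ofPowerSeries ℤ ℂ (1 - PowerSeries.C (z m) * PowerSeries.X) *
      HahnSeries.ofPowerSeries ℤ ℂ (1 - PowerSeries.C (z m) * PowerSeries.X)⁻¹ = 1 := by
    rw [← map_mul, PowerSeries.mul_inv_cancel _ hne, map_one]
  have h3 : (HahnSeries.single (-1) 1 - HahnSeries.C (z m)) * HahnSeries.single 1 1 =
      HahnSeries.ofPowerSeries ℤ ℂ (1 - PowerSeries.C (z m) * PowerSeries.X) := by
    rw [map_sub, map_mul (HahnSeries.ofPowerSeries ℤ ℂ), HahnSeries.ofPowerSeries_X,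
      HahnSeries.ofPowerSeries_C, sub_mul, HahnSeries.single_mul_single]
    simp
  have h4 : (HahnSeries.single (-1) 1 - HahnSeries.C (z m)) * (HahnSeries.single 1 1 *
      HahnSeries.ofPowerSeries ℤ ℂ (1 - PowerSeries.C (z m) * PowerSeries.X)⁻¹) = 1 := by
    rw [← mul_assoc, h3, h2]
  rw [eq_inv_of_mul_eq_one_right this, eq_inv_of_mul_eq_one_right h4]

theorem coeff_ofPowerSeries_neg (q : PowerSeries ℂ) {j : ℤ} (hj : j < 0) :
    (HahnSeries.ofPowerSeries ℤ ℂ q).coeff j = 0 := by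
  rw [PowerSeries.coeff_coe, if_pos hj]

theorem coeff_ofPowerSeries_zero (q : PowerSeries ℂ) :
    (HahnSeries.ofPowerSeries ℤ ℂ q).coeff 0 = PowerSeries.constantCoeff q := by
  rw [PowerSeries.coeff_coe, if_neg (lt_irrefl _)]
  simp

/-- The sum of the residues of `g dt` at all points of the projective line is zero. -/
theorem residue_theorem (g : Reg z) :
    ∑ i : Fin n, (expand z i.castSucc g).coeff (-1) = (expand z (Fin.last n) g).coeff 1 := by
  have hg : g ∈ Submodule.span ℂ (elementary z) := by rw [span_elementary]; trivial
  induction hg using Submodule.span_induction with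
  | zero => simp
  | add x y _ _ hx hy => simp only [map_add, HahnSeries.coeff_add, Finset.sum_add_distrib, hx, hy]
  | smul r x _ hx => simp only [expand_smul, HahnSeries.coeff_smul, ← Finset.smul_sum, hx]
  | mem x hx =>
    rcases hx with ⟨b, rfl⟩ | ⟨m, b, rfl⟩
    · rw [map_pow, expand_coord, localCoord_last, HahnSeries.single_pow,
        HahnSeries.coeff_single_of_ne (by simp; omega)]
      refine Finset.sum_eq_zero fun i _ => ?_
      have : localCoord z i.castSucc =
          HahnSeries.ofPowerSeries ℤ ℂ (PowerSeries.X + PowerSeries.C (z i)) := by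
        rw [map_add, HahnSeries.ofPowerSeries_X, HahnSeries.ofPowerSeries_C, localCoord_castSucc]
      rw [map_pow, expand_coord, this, ← map_pow]
      exact coeff_ofPowerSeries_neg _ (by norm_num)
    · rw [Finset.sum_eq_single m]
      · obtain ⟨q, hq, hq'⟩ := expand_pole_last z m
        rw [map_pow, map_pow, expand_pole_self, hq', mul_pow, HahnSeries.single_pow,
          HahnSeries.single_pow, one_pow, HahnSeries.coeff_single_mul, one_mul, ← map_pow]
        rcases b with _ | b
        · simp [coeff_ofPowerSeries_zero, hq]
        · rw [coeff_ofPowerSeries_neg _ (by simp; omega),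
            HahnSeries.coeff_single_of_ne (by simp; omega)]
      · intro i _ hi
        obtain ⟨q, hq⟩ := expand_pole_of_ne z hi
        rw [map_pow, hq, ← map_pow]
        exact coeff_ofPowerSeries_neg _ (by norm_num)
      · intro hm
        exact absurd (Finset.mem_univ m) hm

/-- The sum over all points of the residues of `f' g dt`. -/
def resTotal (a b : Reg z) : ℂ := ∑ p : Fin (n + 1), resPair (expand z p a) (expand z p b)

theorem resTotal_add (a b g : Reg z) : resTotal z (a + b) g = resTotal z a g + resTotal z b g := by
  simp only [resTotal, ← Finset.sum_add_distrib]
  refine Finset.sum_congr rfl fun p _ => ?_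
  rw [map_add, resPair, euler_add, add_mul, HahnSeries.coeff_add]
  rfl

theorem resTotal_add_right (a g g' : Reg z) :
    resTotal z a (g + g') = resTotal z a g + resTotal z a g' := by
  simp only [resTotal, ← Finset.sum_add_distrib]
  refine Finset.sum_congr rfl fun p _ => ?_
  rw [map_add, resPair, mul_add, HahnSeries.coeff_add]
  rfl

theorem resTotal_smul_right (r : ℂ) (a g : Reg z) : resTotal z a (r • g) = r * resTotal z a g := by
  simp only [resTotal, Finset.mul_sum]
  refine Finset.sum_congr rfl fun p _ => ?_
  rw [expand_smul, resPair, ← HahnSeries.C_mul_eq_smul, mul_left_comm,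
    HahnSeries.C_mul_eq_smul, HahnSeries.coeff_smul]
  rfl

theorem resTotal_mul (a b g : Reg z) :
    resTotal z (a * b) g = resTotal z a (b * g) + resTotal z b (a * g) := by
  simp only [resTotal, ← Finset.sum_add_distrib]
  refine Finset.sum_congr rfl fun p _ => ?_
  rw [map_mul, resPair, euler_mul, resPair, resPair, ← HahnSeries.coeff_add, map_mul, map_mul]
  congr 1
  ring

theorem resTotal_smul (r : ℂ) (a g : Reg z) : resTotal z (r • a) g = r * resTotal z a g := by
  simp only [resTotal, Finset.mul_sum]
  refine Finset.sum_congr rfl fun p _ => ?_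
  rw [expand_smul, resPair, euler_smul, ← HahnSeries.C_mul_eq_smul, mul_assoc,
    HahnSeries.C_mul_eq_smul, HahnSeries.coeff_smul]
  rfl

theorem resTotal_one (g : Reg z) : resTotal z 1 g = 0 := by
  have := resTotal_mul z 1 1 g
  rw [one_mul, one_mul] at this
  linear_combination -this

theorem resTotal_coord (g : Reg z) : resTotal z (coord z) g = 0 := by
  rw [resTotal, Fin.sum_univ_castSucc]
  have h1 : ∀ i : Fin n, resPair (expand z i.castSucc (coord z)) (expand z i.castSucc g) =
      (expand z i.castSucc g).coeff (-1) := by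
    intro i
    have : euler (localCoord z i.castSucc) = HahnSeries.single 1 1 := by
      ext j
      rw [euler_coeff, localCoord_castSucc, HahnSeries.coeff_add, HahnSeries.C_apply,
        HahnSeries.coeff_single, HahnSeries.coeff_single]
      by_cases h0 : j = 0
      · subst h0; simp
      · by_cases h1 : j = 1
        · subst h1; simp
        · simp [h0, h1]
    rw [resPair, expand_coord, this, HahnSeries.coeff_single_mul, one_mul, zero_sub]
  have h2 : resPair (expand z (Fin.last n) (coord z)) (expand z (Fin.last n) g) =
      -(expand z (Fin.last n) g).coeff 1 := by
    have : euler (localCoord z (Fin.last n)) = HahnSeries.single (-1) (-1) := by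
      ext j
      rw [euler_coeff, localCoord_last, HahnSeries.coeff_single, HahnSeries.coeff_single]
      by_cases h1 : j = -1
      · subst h1; simp
      · simp [h1]
    rw [resPair, expand_coord, this, HahnSeries.coeff_single_mul]
    simp
  simp only [h1, h2, residue_theorem]
  ring

theorem resTotal_coord_pow (b : ℕ) : ∀ g : Reg z, resTotal z (coord z ^ b) g = 0 := by
  induction b with
  | zero => intro g; rw [pow_zero, resTotal_one]
  | succ b ih => intro g; rw [pow_succ, resTotal_mul, ih, resTotal_coord, add_zero]

theorem resTotal_pole (m : Fin n) (g : Reg z) : resTotal z (pole z m) g = 0 := by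
  have h1 : ∀ g : Reg z, resTotal z (coord z * pole z m) g = z m * resTotal z (pole z m) g := by
    intro g
    rw [coord_mul_pole, resTotal_add, resTotal_one, resTotal_smul, zero_add]
  have h3 : ∀ g : Reg z, resTotal z (pole z m) (coord z * g) = z m * resTotal z (pole z m) g := by
    intro g
    rw [← h1, resTotal_mul, resTotal_coord, zero_add]
  have h4 := h3 (pole z m * g)
  have h5 : coord z * (pole z m * g) = g + z m • (pole z m * g) := by
    rw [← mul_assoc, coord_mul_pole, add_mul, one_mul, smul_mul_assoc]
  rw [h5, resTotal_add_right, resTotal_smul_right] at h4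
  linear_combination h4

theorem resTotal_pole_pow (m : Fin n) (b : ℕ) : ∀ g : Reg z, resTotal z (pole z m ^ b) g = 0 := by
  induction b with
  | zero => intro g; rw [pow_zero, resTotal_one]
  | succ b ih => intro g; rw [pow_succ, resTotal_mul, ih, resTotal_pole, add_zero]

/-- The sum of the residues of `f' g dt` is zero. -/
theorem resTotal_eq_zero (a g : Reg z) : resTotal z a g = 0 := by
  have ha : a ∈ Submodule.span ℂ (elementary z) := by rw [span_elementary]; trivial
  induction ha using Submodule.span_induction with
  | zero => simpa using resTotal_smul z 0 0 g
  | add x y _ _ hx hy => rw [resTotal_add, hx, hy, add_zero]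
  | smul r x _ hx => rw [resTotal_smul, hx, mul_zero]
  | mem x hx =>
    rcases hx with ⟨b, rfl⟩ | ⟨m, b, rfl⟩
    · exact resTotal_coord_pow z b g
    · exact resTotal_pole_pow z m (b + 1) g

end Regular
/-! ### The module `V₁^* ⊗ … ⊗ Vₙ^* ⊗ V_{n+1}^*` -/

section OnFactor

variable {ι : Type} [DecidableEq ι] {V : ι → Type} [∀ p, AddCommGroup (V p)]
  [∀ p, Module ℂ (V p)]

/-- The operator on a tensor product that acts by `A` on the factor with index `p`. -/
def onFactor (p : ι) : Module.End ℂ (V p) →ₗ[ℂ] Module.End ℂ (⨂[ℂ] q, V q) :=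
  (PiTensorProduct.mapMultilinear ℂ V V).toLinearMap (fun _ => LinearMap.id) p

theorem onFactor_apply (p : ι) (A : Module.End ℂ (V p)) : onFactor p A =
    PiTensorProduct.map (Function.update (fun q => (LinearMap.id : V q →ₗ[ℂ] V q)) p A) := rfl

theorem onFactor_tprod (p : ι) (A : Module.End ℂ (V p)) (x : ∀ q, V q) :
    onFactor p A (PiTensorProduct.tprod ℂ x) =
      PiTensorProduct.tprod ℂ (Function.update x p (A (x p))) := by
  rw [onFactor_apply, PiTensorProduct.map_tprod]
  congr 1
  ext q
  by_cases hq : q = p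
  · subst hq; simp
  · simp [hq]

theorem onFactor_id (p : ι) : onFactor p (LinearMap.id : V p →ₗ[ℂ] V p) = LinearMap.id := by
  rw [onFactor_apply, Function.update_eq_self, PiTensorProduct.map_id]

theorem onFactor_mul (p : ι) (A B : Module.End ℂ (V p)) :
    onFactor p (A * B) = onFactor p A * onFactor p B := by
  rw [onFactor_apply, onFactor_apply, onFactor_apply, ← PiTensorProduct.map_mul]
  congr 1
  ext q : 1
  by_cases hq : q = p
  · subst hq; simp
  · simp only [Function.update_of_ne hq]
    rfl

theorem onFactor_comm {p q : ι} (hpq : p ≠ q) (A : Module.End ℂ (V p)) (B : Module.End ℂ (V q)) :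
    onFactor p A * onFactor q B = onFactor q B * onFactor p A := by
  rw [onFactor_apply, onFactor_apply, ← PiTensorProduct.map_mul, ← PiTensorProduct.map_mul]
  congr 1
  ext r : 1
  by_cases hp : r = p
  · subst hp; simp [hpq]; rfl
  · by_cases hq : r = q
    · subst hq; simp [hp]; rfl
    · simp [hp, hq]

end OnFactor

section Coefficients

variable {n : ℕ} (z : Fin n ↪ ℂ) (M : Fin n → ℂ) (k : ℂ)

/-- The weights `M¹, …, Mⁿ` and `Mⁿ⁺¹ = M¹ + … + Mⁿ - 2`. -/
def weight : Fin (n + 1) → ℂ :=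
  Fin.lastCases (motive := fun _ => ℂ) ((∑ i, M i) - 2) M

/-- The contragredient Verma module `V(M^p, k - M^p)^*` attached to the `p`-th point. -/
def Factor (p : Fin (n + 1)) : Type := Contra (weight M p) k

instance (p : Fin (n + 1)) : AddCommGroup (Factor M k p) :=
  inferInstanceAs (AddCommGroup (Contra (weight M p) k))

instance (p : Fin (n + 1)) : Module ℂ (Factor M k p) :=
  inferInstanceAs (Module ℂ (Contra (weight M p) k))

/-- The tensor product of the contragredient Verma modules `V(M^p, k - M^p)^*`, `p = 1, …, n + 1`. -/
abbrev Coeff : Type := ⨂[ℂ] p : Fin (n + 1), Factor M k p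

/-- The action of `sl₂` is twisted by the automorphism `e ↔ f`, `h ↦ -h` at infinity. -/
def twist (p : Fin (n + 1)) : Sl2 →ₗ⁅ℂ⁆ Sl2 := if p = Fin.last n then flip else LieHom.id

theorem form_twist (p : Fin (n + 1)) (a b : Sl2) : form (twist p a) (twist p b) = form a b := by
  rw [twist]
  split_ifs
  · exact form_flip a b
  · rfl

/-- The action of `g ⊗ a` on the `p`-th tensor factor, through the Laurent expansion of `g`. -/
def localAct (p : Fin (n + 1)) (g : Reg z) (a : Sl2) : Module.End ℂ (Factor M k p) :=
  (loopAct contraRep_fin (expand z p g) (twist p a) : Module.End ℂ (Contra (weight M p) k))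

theorem localAct_lie (p : Fin (n + 1)) (g g' : Reg z) (a b : Sl2) :
    localAct z M k p g a * localAct z M k p g' b - localAct z M k p g' b * localAct z M k p g a =
      localAct z M k p (g * g') ⁅a, b⁆ +
        (k * form a b * resPair (expand z p g) (expand z p g')) • LinearMap.id := by
  have key : ∀ w : Contra (weight M p) k, _ = _ := fun w =>
    loopAct_lie (contraRep_fin (M := weight M p) (k := k)) (expand z p g) (expand z p g')
      (twist p a) (twist p b) w
  simp only [contraRep_c, form_twist, ← map_mul, ← LieHom.map_lie, smul_smul] at key
  apply LinearMap.ext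
  intro w
  refine (key w).trans ?_
  rw [show k * form a b * resPair (expand z p g) (expand z p g') =
    resPair (expand z p g) (expand z p g') * form a b * k by ring]
  rfl

theorem localAct_add_left (p : Fin (n + 1)) (g g' : Reg z) (a : Sl2) :
    localAct z M k p (g + g') a = localAct z M k p g a + localAct z M k p g' a := by
  refine Eq.trans ?_ (LinearMap.congr_fun
    ((loopAct contraRep_fin).map_add (expand z p g) (expand z p g')) (twist p a))
  rw [localAct, map_add]

theorem localAct_smul_left (p : Fin (n + 1)) (r : ℂ) (g : Reg z) (a : Sl2) :
    localAct z M k p (r • g) a = r • localAct z M k p g a := by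
  refine Eq.trans ?_ (LinearMap.congr_fun
    ((loopAct contraRep_fin).map_smul r (expand z p g)) (twist p a))
  rw [localAct, expand_smul]

theorem localAct_add_right (p : Fin (n + 1)) (g : Reg z) (a b : Sl2) :
    localAct z M k p g (a + b) = localAct z M k p g a + localAct z M k p g b := by
  refine Eq.trans ?_ ((loopAct contraRep_fin (expand z p g)).map_add (twist p a) (twist p b))
  rw [localAct, map_add]

theorem localAct_smul_right (p : Fin (n + 1)) (r : ℂ) (g : Reg z) (a : Sl2) :
    localAct z M k p g (r • a) = r • localAct z M k p g a := by
  refine Eq.trans ?_ ((loopAct contraRep_fin (expand z p g)).map_smul r (twist p a))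
  rw [localAct, map_smul]

/-- The action of `g ⊗ a` on the tensor product: the sum over all points of the actions on the
tensor factors. -/
def actFun (g : Reg z) (a : Sl2) : Module.End ℂ (Coeff M k) :=
  ∑ p : Fin (n + 1), onFactor p (localAct z M k p g a)

theorem actFun_lie (g g' : Reg z) (a b : Sl2) :
    actFun z M k (g * g') ⁅a, b⁆ =
      actFun z M k g a * actFun z M k g' b - actFun z M k g' b * actFun z M k g a := by
  have h1 : actFun z M k g a * actFun z M k g' b - actFun z M k g' b * actFun z M k g a =
      ∑ p, ∑ q, (onFactor p (localAct z M k p g a) * onFactor q (localAct z M k q g' b) -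
        onFactor q (localAct z M k q g' b) * onFactor p (localAct z M k p g a)) := by
    simp only [actFun, Finset.sum_mul_sum, Finset.sum_sub_distrib]
    exact congrArg₂ (fun x y => x - y) rfl Finset.sum_comm
  have h2 : ∀ p : Fin (n + 1), ∑ q, (onFactor p (localAct z M k p g a) * onFactor q (localAct z M k q g' b) -
        onFactor q (localAct z M k q g' b) * onFactor p (localAct z M k p g a)) =
      onFactor p (localAct z M k p (g * g') ⁅a, b⁆) +
        (k * form a b * resPair (expand z p g) (expand z p g')) • LinearMap.id := by
    intro p
    rw [Finset.sum_eq_single p]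
    · rw [← onFactor_mul, ← onFactor_mul, ← map_sub, localAct_lie, map_add, map_smul, onFactor_id]
    · intro q _ hq
      rw [onFactor_comm (Ne.symm hq), sub_self]
    · intro hp
      exact absurd (Finset.mem_univ p) hp
  have h3 : ∑ p : Fin (n + 1), resPair (expand z p g) (expand z p g') = 0 := resTotal_eq_zero z g g'
  rw [h1]
  simp only [h2]
  rw [Finset.sum_add_distrib, ← Finset.sum_smul, ← Finset.mul_sum, h3, mul_zero, zero_smul, add_zero]
  rfl

/-- The Lie algebra `sl₂(U(z))` of `sl₂`-valued rational functions regular on the punctured line. -/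
def SlU {n : ℕ} (z : Fin n ↪ ℂ) : Type := Reg z ⊗[ℂ] Sl2

instance : LieRing (SlU z) := inferInstanceAs (LieRing (Reg z ⊗[ℂ] Sl2))

instance : LieAlgebra ℂ (SlU z) := inferInstanceAs (LieAlgebra ℂ (Reg z ⊗[ℂ] Sl2))

variable {z} in
/-- The element `a g` of `sl₂(U(z))`. -/
def elt (a : Sl2) (g : Reg z) : SlU z := (g ⊗ₜ[ℂ] a : Reg z ⊗[ℂ] Sl2)

theorem elt_lie (a b : Sl2) (g g' : Reg z) : ⁅elt a g, elt b g'⁆ = elt ⁅a, b⁆ (g * g') :=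
  LieAlgebra.ExtendScalars.bracket_tmul ..

theorem slU_induction {p : SlU z → Prop} (h0 : p 0) (hadd : ∀ x y, p x → p y → p (x + y))
    (helt : ∀ a g, p (elt a g)) (x : SlU z) : p x :=
  TensorProduct.induction_on (motive := p) x h0 (fun g a => helt a g) hadd

/-- The action of `sl₂(U(z))` on the tensor product as a linear map. -/
def actLin : SlU z →ₗ[ℂ] Module.End ℂ (Coeff M k) :=
  TensorProduct.lift (LinearMap.mk₂ ℂ (actFun z M k)
    (fun g g' a => by
      simp only [actFun, localAct_add_left, map_add, Finset.sum_add_distrib])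
    (fun r g a => by
      simp only [actFun, localAct_smul_left, map_smul, Finset.smul_sum])
    (fun g a b => by
      simp only [actFun, localAct_add_right, map_add, Finset.sum_add_distrib])
    (fun r g a => by
      simp only [actFun, localAct_smul_right, map_smul, Finset.smul_sum]))

theorem actLin_elt (g : Reg z) (a : Sl2) : actLin z M k (elt a g) = actFun z M k g a := rfl

/-- The action of `sl₂(U(z))` on the tensor product of the contragredient Verma modules. -/
def act : SlU z →ₗ⁅ℂ⁆ Module.End ℂ (Coeff M k) where
  toLinearMap := actLin z M k
  map_lie' {x y} := by
    change actLin z M k ⁅x, y⁆ =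
      actLin z M k x * actLin z M k y - actLin z M k y * actLin z M k x
    induction x using slU_induction with
    | h0 => rw [zero_lie, map_zero, zero_mul, mul_zero, sub_zero]
    | hadd x x' hx hx' => rw [add_lie, map_add, hx, hx', map_add, add_mul, mul_add]; abel
    | helt a g =>
      induction y using slU_induction with
      | h0 => rw [lie_zero, map_zero, zero_mul, mul_zero, sub_zero]
      | hadd y y' hy hy' => rw [lie_add, map_add, hy, hy', map_add, add_mul, mul_add]; abel
      | helt b g' => rw [elt_lie, actLin_elt, actLin_elt, actLin_elt, actFun_lie]

end Coefficients
/-! ### The Chevalley–Eilenberg chain complex of a Lie algebra with coefficients in a module -/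

section ChevalleyEilenberg

open ExteriorAlgebra

variable {g W : Type} [LieRing g] [LieAlgebra ℂ g] [AddCommGroup W] [Module ℂ W]

/-- The adjoint action of `x` on the exterior algebra `Λ g`: the derivation with
`θ_x(y ∧ c) = [x, y] ∧ c + y ∧ θ_x(c)`. -/
def adExt (x : g) : ExteriorAlgebra ℂ g →ₗ[ℂ] ExteriorAlgebra ℂ g :=
  CliffordAlgebra.foldr' (0 : QuadraticForm ℂ g)
    (LinearMap.mk₂ ℂ (fun (y : g) (q : ExteriorAlgebra ℂ g × ExteriorAlgebra ℂ g) =>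
        ι ℂ ⁅x, y⁆ * q.1 + ι ℂ y * q.2)
      (fun y y' q => by rw [lie_add, map_add, map_add, add_mul, add_mul]; abel)
      (fun r y q => by rw [lie_smul, map_smul, map_smul, smul_mul_assoc, smul_mul_assoc, smul_add])
      (fun y q q' => by rw [Prod.fst_add, Prod.snd_add, mul_add, mul_add]; abel)
      (fun r y q => by
        rw [Prod.smul_fst, Prod.smul_snd, mul_smul_comm, mul_smul_comm, smul_add]))
    (fun y a b => by
      change ι ℂ ⁅x, y⁆ * (ι ℂ y * a) + ι ℂ y * (ι ℂ ⁅x, y⁆ * a + ι ℂ y * b) = (0 : ℂ) • b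
      rw [mul_add, ← mul_assoc, ← mul_assoc, ← mul_assoc, ι_sq_zero, zero_mul, add_zero, ← add_mul,
        ι_add_mul_swap, zero_mul, zero_smul])
    0

theorem adExt_one (x : g) : adExt x 1 = 0 := by
  rw [← map_one (algebraMap ℂ (ExteriorAlgebra ℂ g))]
  exact (CliffordAlgebra.foldr'_algebraMap _ _ _ _ _).trans (smul_zero _)

theorem adExt_ι_mul (x y : g) (a : ExteriorAlgebra ℂ g) :
    adExt x (ι ℂ y * a) = ι ℂ ⁅x, y⁆ * a + ι ℂ y * adExt x a :=
  CliffordAlgebra.foldr'_ι_mul _ _ _ _ _ _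

/-- A linear map on `Λ g ⊗ W` is determined by its behaviour on `1 ⊗ w` and under exterior
multiplication. -/
theorem extTensor_induction {P : ExteriorAlgebra ℂ g ⊗[ℂ] W → Prop}
    (hone : ∀ w, P (1 ⊗ₜ w)) (hzero : P 0) (hadd : ∀ u v, P u → P v → P (u + v))
    (hmul : ∀ x u, P u → P (LinearMap.rTensor W (LinearMap.mulLeft ℂ (ι ℂ x)) u))
    (u : ExteriorAlgebra ℂ g ⊗[ℂ] W) : P u := by
  induction u using TensorProduct.induction_on with
  | zero => exact hzero
  | add u v hu hv => exact hadd u v hu hv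
  | tmul a w =>
    induction a using CliffordAlgebra.left_induction with
    | algebraMap r =>
      rw [Algebra.algebraMap_eq_smul_one, TensorProduct.smul_tmul]
      exact hone _
    | add a b ha hb => rw [TensorProduct.add_tmul]; exact hadd _ _ ha hb
    | ι_mul a m ha => exact hmul m _ ha

/-- Exterior multiplication by `x` on `Λ g ⊗ W`. -/
def wedge (x : g) : ExteriorAlgebra ℂ g ⊗[ℂ] W →ₗ[ℂ] ExteriorAlgebra ℂ g ⊗[ℂ] W :=
  LinearMap.rTensor W (LinearMap.mulLeft ℂ (ι ℂ x))

theorem wedge_tmul (x : g) (a : ExteriorAlgebra ℂ g) (w : W) :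
    wedge x (a ⊗ₜ[ℂ] w) = (ι ℂ x * a) ⊗ₜ[ℂ] w := rfl

variable (ρ : g →ₗ⁅ℂ⁆ Module.End ℂ W)

/-- The Lie action of `x` on `Λ g ⊗ W`: `x (c ⊗ w) = θ_x(c) ⊗ w + c ⊗ x w`. -/
def lieExt (x : g) : ExteriorAlgebra ℂ g ⊗[ℂ] W →ₗ[ℂ] ExteriorAlgebra ℂ g ⊗[ℂ] W :=
  LinearMap.rTensor W (adExt x) + LinearMap.lTensor (ExteriorAlgebra ℂ g) (ρ x)

theorem lieExt_tmul (x : g) (a : ExteriorAlgebra ℂ g) (w : W) :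
    lieExt ρ x (a ⊗ₜ[ℂ] w) = adExt x a ⊗ₜ[ℂ] w + a ⊗ₜ[ℂ] ρ x w := rfl

theorem lieExt_one (x : g) (w : W) :
    lieExt ρ x ((1 : ExteriorAlgebra ℂ g) ⊗ₜ[ℂ] w) = 1 ⊗ₜ[ℂ] ρ x w := by
  rw [lieExt_tmul, adExt_one, TensorProduct.zero_tmul, zero_add]

theorem lieExt_wedge (x y : g) (u : ExteriorAlgebra ℂ g ⊗[ℂ] W) :
    lieExt ρ x (wedge y u) = wedge ⁅x, y⁆ u + wedge y (lieExt ρ x u) := by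
  induction u using TensorProduct.induction_on with
  | zero => simp only [map_zero, add_zero]
  | add u v hu hv => simp only [map_add, hu, hv]; abel
  | tmul a w =>
    simp only [wedge_tmul, lieExt_tmul, adExt_ι_mul, map_add, TensorProduct.add_tmul]
    abel

theorem wedge_add (x y : g) (u : ExteriorAlgebra ℂ g ⊗[ℂ] W) :
    wedge (x + y) u = wedge x u + wedge y u := by
  induction u using TensorProduct.induction_on with
  | zero => simp only [map_zero, add_zero]
  | add u v hu hv => simp only [map_add, hu, hv]; abel
  | tmul a w => simp only [wedge_tmul, map_add, add_mul, TensorProduct.add_tmul]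

theorem wedge_smul (r : ℂ) (x : g) (u : ExteriorAlgebra ℂ g ⊗[ℂ] W) :
    wedge (r • x) u = r • wedge x u := by
  induction u using TensorProduct.induction_on with
  | zero => simp only [map_zero, smul_zero]
  | add u v hu hv => simp only [map_add, hu, hv, smul_add]
  | tmul a w => rw [wedge_tmul, wedge_tmul, map_smul, smul_mul_assoc, TensorProduct.smul_tmul']

theorem wedge_wedge (x : g) (u : ExteriorAlgebra ℂ g ⊗[ℂ] W) : wedge x (wedge x u) = 0 := by
  induction u using TensorProduct.induction_on with
  | zero => simp only [map_zero]
  | add u v hu hv => simp only [map_add, hu, hv, add_zero]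
  | tmul a w =>
    rw [wedge_tmul, wedge_tmul, ← mul_assoc, ι_sq_zero, zero_mul, TensorProduct.zero_tmul]

theorem wedge_neg (x : g) (u : ExteriorAlgebra ℂ g ⊗[ℂ] W) : wedge (-x) u = -wedge x u := by
  have := wedge_smul (-1) x u
  rwa [neg_one_smul, neg_one_smul] at this

theorem wedge_sub (x y : g) (u : ExteriorAlgebra ℂ g ⊗[ℂ] W) :
    wedge (x - y) u = wedge x u - wedge y u := by
  rw [sub_eq_add_neg, wedge_add, wedge_neg, sub_eq_add_neg]

theorem lieExt_add (x y : g) (u : ExteriorAlgebra ℂ g ⊗[ℂ] W) :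
    lieExt ρ (x + y) u = lieExt ρ x u + lieExt ρ y u := by
  induction u using extTensor_induction with
  | hone w =>
    rw [lieExt_one, lieExt_one, lieExt_one, map_add, LinearMap.add_apply, TensorProduct.tmul_add]
  | hzero => simp only [map_zero, add_zero]
  | hadd u v hu hv => simp only [map_add, hu, hv]; abel
  | hmul m u hu =>
    change lieExt ρ (x + y) (wedge m u) = lieExt ρ x (wedge m u) + lieExt ρ y (wedge m u)
    simp only [lieExt_wedge, hu, add_lie, wedge_add, map_add]
    abel

theorem lieExt_smul (r : ℂ) (x : g) (u : ExteriorAlgebra ℂ g ⊗[ℂ] W) :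
    lieExt ρ (r • x) u = r • lieExt ρ x u := by
  induction u using extTensor_induction with
  | hone w =>
    rw [lieExt_one, lieExt_one, map_smul, LinearMap.smul_apply, TensorProduct.tmul_smul]
  | hzero => simp only [map_zero, smul_zero]
  | hadd u v hu hv => simp only [map_add, hu, hv, smul_add]
  | hmul m u hu =>
    change lieExt ρ (r • x) (wedge m u) = r • lieExt ρ x (wedge m u)
    simp only [lieExt_wedge, hu, smul_lie, wedge_smul, map_smul, smul_add]

theorem lieExt_lie (x y : g) (u : ExteriorAlgebra ℂ g ⊗[ℂ] W) :
    lieExt ρ ⁅x, y⁆ u = lieExt ρ x (lieExt ρ y u) - lieExt ρ y (lieExt ρ x u) := by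
  induction u using extTensor_induction with
  | hone w =>
    simp only [lieExt_one]
    rw [← TensorProduct.tmul_sub, LieHom.map_lie]
    rfl
  | hzero => simp only [map_zero, sub_zero]
  | hadd u v hu hv => simp only [map_add, hu, hv]; abel
  | hmul m u hu =>
    change lieExt ρ ⁅x, y⁆ (wedge m u) =
      lieExt ρ x (lieExt ρ y (wedge m u)) - lieExt ρ y (lieExt ρ x (wedge m u))
    simp only [lieExt_wedge, hu, map_add, map_sub, lie_lie, wedge_sub]
    abel

/-- The map `c ↦ (w ↦ ∂(c ⊗ w))` underlying the Chevalley–Eilenberg differential, by recursion on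
the exterior algebra. -/
def ceDiffAux : ExteriorAlgebra ℂ g →ₗ[ℂ] W →ₗ[ℂ] ExteriorAlgebra ℂ g ⊗[ℂ] W :=
  CliffordAlgebra.foldr' (0 : QuadraticForm ℂ g)
    (N := W →ₗ[ℂ] ExteriorAlgebra ℂ g ⊗[ℂ] W)
    (LinearMap.mk₂ ℂ
      (fun (x : g) (q : ExteriorAlgebra ℂ g × (W →ₗ[ℂ] ExteriorAlgebra ℂ g ⊗[ℂ] W)) =>
        lieExt ρ x ∘ₗ TensorProduct.mk ℂ _ W q.1 - wedge x ∘ₗ q.2)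
      (fun x x' q => by
        ext w
        simp only [LinearMap.sub_apply, LinearMap.add_apply, LinearMap.comp_apply, lieExt_add,
          wedge_add]
        abel)
      (fun r x q => by
        ext w
        simp only [LinearMap.sub_apply, LinearMap.smul_apply, LinearMap.comp_apply, lieExt_smul,
          wedge_smul, smul_sub])
      (fun x q q' => by
        ext w
        simp only [LinearMap.sub_apply, LinearMap.add_apply, LinearMap.comp_apply, Prod.fst_add,
          Prod.snd_add, map_add]
        abel)
      (fun r x q => by
        ext w
        simp only [LinearMap.sub_apply, LinearMap.smul_apply, LinearMap.comp_apply, Prod.smul_fst,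
          Prod.smul_snd, map_smul, smul_sub]))
    (fun x a b => by
      ext w
      change lieExt ρ x (wedge x (a ⊗ₜ[ℂ] w)) - wedge x (lieExt ρ x (a ⊗ₜ[ℂ] w) - wedge x (b w)) =
        (0 : ℂ) • b w
      rw [lieExt_wedge, map_sub, wedge_wedge, lie_self, zero_smul, sub_zero, add_sub_cancel_right]
      have := wedge_smul 0 x (a ⊗ₜ[ℂ] w)
      rwa [zero_smul, zero_smul] at this)
    0

theorem ceDiffAux_one : ceDiffAux ρ (1 : ExteriorAlgebra ℂ g) = 0 := by
  rw [← map_one (algebraMap ℂ (ExteriorAlgebra ℂ g))]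
  exact (CliffordAlgebra.foldr'_algebraMap _ _ _ _ _).trans (smul_zero _)

theorem ceDiffAux_ι_mul (x : g) (a : ExteriorAlgebra ℂ g) : ceDiffAux ρ (ι ℂ x * a) =
    lieExt ρ x ∘ₗ TensorProduct.mk ℂ _ W a - wedge x ∘ₗ ceDiffAux ρ a :=
  CliffordAlgebra.foldr'_ι_mul _ _ _ _ _ _

/-- The Chevalley–Eilenberg differential on `Λ g ⊗ W`, determined by `∂(1 ⊗ w) = 0` and
`∂(x ∧ u) = x u - x ∧ ∂ u`. Hence `∂(x ⊗ w) = x w` and, in general,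
`∂(x₁ ∧ … ∧ x_p ⊗ w) = ∑ᵢ (-1)ⁱ⁺¹ x₁ ∧ … x̂ᵢ … ∧ x_p ⊗ xᵢ w
  + ∑_{i < j} (-1)ⁱ⁺ʲ⁺¹ [xᵢ, xⱼ] ∧ x₁ ∧ … x̂ᵢ … x̂ⱼ … ∧ x_p ⊗ w`. -/
def ceDiff : ExteriorAlgebra ℂ g ⊗[ℂ] W →ₗ[ℂ] ExteriorAlgebra ℂ g ⊗[ℂ] W :=
  TensorProduct.lift (ceDiffAux ρ)

theorem ceDiff_one (w : W) : ceDiff ρ ((1 : ExteriorAlgebra ℂ g) ⊗ₜ[ℂ] w) = 0 :=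
  LinearMap.congr_fun (ceDiffAux_one ρ) w

theorem ceDiff_wedge (x : g) (u : ExteriorAlgebra ℂ g ⊗[ℂ] W) :
    ceDiff ρ (wedge x u) = lieExt ρ x u - wedge x (ceDiff ρ u) := by
  induction u using TensorProduct.induction_on with
  | zero => simp only [map_zero, sub_zero]
  | add u v hu hv => simp only [map_add, hu, hv]; abel
  | tmul a w => exact LinearMap.congr_fun (ceDiffAux_ι_mul ρ x a) w

theorem ceDiff_lieExt (x : g) (u : ExteriorAlgebra ℂ g ⊗[ℂ] W) :
    ceDiff ρ (lieExt ρ x u) = lieExt ρ x (ceDiff ρ u) := by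
  induction u using extTensor_induction with
  | hone w => rw [lieExt_one, ceDiff_one, ceDiff_one, map_zero]
  | hzero => simp only [map_zero]
  | hadd u v hu hv => simp only [map_add, hu, hv]
  | hmul y u hu =>
    change ceDiff ρ (lieExt ρ x (wedge y u)) = lieExt ρ x (ceDiff ρ (wedge y u))
    simp only [lieExt_wedge, ceDiff_wedge, map_add, map_sub, hu, lieExt_lie]
    abel

theorem ceDiff_ceDiff (u : ExteriorAlgebra ℂ g ⊗[ℂ] W) : ceDiff ρ (ceDiff ρ u) = 0 := by
  induction u using extTensor_induction with
  | hone w => rw [ceDiff_one, map_zero]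
  | hzero => simp only [map_zero]
  | hadd u v hu hv => simp only [map_add, hu, hv, add_zero]
  | hmul y u hu =>
    change ceDiff ρ (ceDiff ρ (wedge y u)) = 0
    rw [ceDiff_wedge, map_sub, ceDiff_wedge, ceDiff_lieExt, hu, map_zero, sub_zero, sub_self]

variable (g W) in
/-- The inclusion of `Λᵖ g ⊗ W` into `Λ g ⊗ W`. -/
def ceIncl (p : ℕ) : (⋀[ℂ]^p g) ⊗[ℂ] W →ₗ[ℂ] ExteriorAlgebra ℂ g ⊗[ℂ] W :=
  LinearMap.rTensor W (⋀[ℂ]^p g).subtype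

variable (g W) in
/-- The projection of `Λ g ⊗ W` to `Λᵖ g ⊗ W`. -/
def ceProj (p : ℕ) : ExteriorAlgebra ℂ g ⊗[ℂ] W →ₗ[ℂ] (⋀[ℂ]^p g) ⊗[ℂ] W :=
  LinearMap.rTensor W (DirectSum.component ℂ ℕ (fun i => ⋀[ℂ]^i g) p ∘ₗ
    (DirectSum.decomposeLinearEquiv fun i => ⋀[ℂ]^i g).toLinearMap)

theorem ceProj_ceIncl (p : ℕ) (u : (⋀[ℂ]^p g) ⊗[ℂ] W) : ceProj g W p (ceIncl g W p u) = u := by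
  induction u using TensorProduct.induction_on with
  | zero => simp only [map_zero]
  | add u v hu hv => simp only [map_add, hu, hv]
  | tmul a w =>
    change (DirectSum.decompose (fun i => ⋀[ℂ]^i g) (a : ExteriorAlgebra ℂ g) p) ⊗ₜ[ℂ] w = _
    rw [DirectSum.decompose_coe, DirectSum.of_eq_same]

theorem tmul_mem_range_ceIncl {p : ℕ} {a : ExteriorAlgebra ℂ g} (ha : a ∈ ⋀[ℂ]^p g) (w : W) :
    a ⊗ₜ[ℂ] w ∈ LinearMap.range (ceIncl g W p) :=
  ⟨(⟨a, ha⟩ : ⋀[ℂ]^p g) ⊗ₜ[ℂ] w, rfl⟩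

theorem ι_mul_mem {p : ℕ} {a : ExteriorAlgebra ℂ g} (ha : a ∈ ⋀[ℂ]^p g) (x : g) :
    ι ℂ x * a ∈ ⋀[ℂ]^(p + 1) g := by
  rw [exteriorPower, pow_succ']
  exact Submodule.mul_mem_mul (LinearMap.mem_range_self _ _) ha

theorem adExt_mem (x : g) (p : ℕ) : ∀ a ∈ ⋀[ℂ]^p g, adExt x a ∈ ⋀[ℂ]^p g := by
  induction p with
  | zero =>
    intro a ha
    rw [exteriorPower, pow_zero] at ha
    obtain ⟨r, rfl⟩ := Submodule.mem_one.mp ha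
    rw [Algebra.algebraMap_eq_smul_one, map_smul, adExt_one, smul_zero]
    exact Submodule.zero_mem _
  | succ p ih =>
    intro a ha
    rw [exteriorPower, pow_succ'] at ha
    induction ha using Submodule.mul_induction_on' with
    | mem_mul_mem y hy b hb =>
      obtain ⟨y, rfl⟩ := hy
      rw [adExt_ι_mul]
      exact Submodule.add_mem _ (ι_mul_mem hb _) (ι_mul_mem (ih b hb) _)
    | add y _ y' _ hy hy' => rw [map_add]; exact Submodule.add_mem _ hy hy'

theorem lieExt_mem (x : g) {p : ℕ} {u : ExteriorAlgebra ℂ g ⊗[ℂ] W}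
    (hu : u ∈ LinearMap.range (ceIncl g W p)) :
    lieExt ρ x u ∈ LinearMap.range (ceIncl g W p) := by
  obtain ⟨u, rfl⟩ := hu
  induction u using TensorProduct.induction_on with
  | zero => simp only [map_zero, Submodule.zero_mem]
  | add u v hu hv => simp only [map_add]; exact Submodule.add_mem _ hu hv
  | tmul a w =>
    exact Submodule.add_mem _ (tmul_mem_range_ceIncl (adExt_mem x p a a.2) w)
      (tmul_mem_range_ceIncl a.2 (ρ x w))

theorem wedge_mem (x : g) {p : ℕ} {u : ExteriorAlgebra ℂ g ⊗[ℂ] W}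
    (hu : u ∈ LinearMap.range (ceIncl g W p)) :
    wedge x u ∈ LinearMap.range (ceIncl g W (p + 1)) := by
  obtain ⟨u, rfl⟩ := hu
  induction u using TensorProduct.induction_on with
  | zero => simp only [map_zero, Submodule.zero_mem]
  | add u v hu hv => simp only [map_add]; exact Submodule.add_mem _ hu hv
  | tmul a w => exact tmul_mem_range_ceIncl (ι_mul_mem a.2 x) w

theorem ceDiff_tmul_mem (w : W) (p : ℕ) :
    ∀ a ∈ ⋀[ℂ]^(p + 1) g, ceDiff ρ (a ⊗ₜ[ℂ] w) ∈ LinearMap.range (ceIncl g W p) := by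
  have step : ∀ (p : ℕ), (∀ b ∈ ⋀[ℂ]^p g, ∀ x : g,
      wedge x (ceDiff ρ (b ⊗ₜ[ℂ] w)) ∈ LinearMap.range (ceIncl g W p)) →
      ∀ a ∈ ⋀[ℂ]^(p + 1) g, ceDiff ρ (a ⊗ₜ[ℂ] w) ∈ LinearMap.range (ceIncl g W p) := by
    intro p hp a ha
    rw [exteriorPower, pow_succ'] at ha
    induction ha using Submodule.mul_induction_on' with
    | mem_mul_mem y hy b hb =>
      obtain ⟨y, rfl⟩ := hy
      rw [← wedge_tmul, ceDiff_wedge]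
      exact Submodule.sub_mem _ (lieExt_mem ρ y (tmul_mem_range_ceIncl hb w)) (hp b hb y)
    | add y _ y' _ hy hy' =>
      rw [TensorProduct.add_tmul, map_add]
      exact Submodule.add_mem _ hy hy'
  induction p with
  | zero =>
    refine step 0 fun b hb x => ?_
    rw [exteriorPower, pow_zero] at hb
    obtain ⟨r, rfl⟩ := Submodule.mem_one.mp hb
    rw [Algebra.algebraMap_eq_smul_one, TensorProduct.smul_tmul, ceDiff_one, map_zero]
    exact Submodule.zero_mem _
  | succ p ih => exact step (p + 1) fun b hb x => wedge_mem x (ih b hb)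

theorem ceDiff_mem (p : ℕ) (u : (⋀[ℂ]^(p + 1) g) ⊗[ℂ] W) :
    ceDiff ρ (ceIncl g W (p + 1) u) ∈ LinearMap.range (ceIncl g W p) := by
  induction u using TensorProduct.induction_on with
  | zero => simp only [map_zero, Submodule.zero_mem]
  | add u v hu hv => simp only [map_add]; exact Submodule.add_mem _ hu hv
  | tmul a w => exact ceDiff_tmul_mem ρ w p a a.2

/-- The Chevalley–Eilenberg differential `Λᵖ⁺¹ g ⊗ W → Λᵖ g ⊗ W`. -/
def ceD (p : ℕ) : (⋀[ℂ]^(p + 1) g) ⊗[ℂ] W →ₗ[ℂ] (⋀[ℂ]^p g) ⊗[ℂ] W :=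
  ceProj g W p ∘ₗ ceDiff ρ ∘ₗ ceIncl g W (p + 1)

theorem ceIncl_ceD (p : ℕ) (u : (⋀[ℂ]^(p + 1) g) ⊗[ℂ] W) :
    ceIncl g W p (ceD ρ p u) = ceDiff ρ (ceIncl g W (p + 1) u) := by
  obtain ⟨v, hv⟩ := ceDiff_mem ρ p u
  change ceIncl g W p (ceProj g W p (ceDiff ρ (ceIncl g W (p + 1) u))) = _
  rw [← hv, ceProj_ceIncl]

theorem ceD_ceD (p : ℕ) (u : (⋀[ℂ]^(p + 1 + 1) g) ⊗[ℂ] W) : ceD ρ p (ceD ρ (p + 1) u) = 0 := by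
  change ceProj g W p (ceDiff ρ (ceIncl g W (p + 1) (ceD ρ (p + 1) u))) = 0
  rw [ceIncl_ceD, ceDiff_ceDiff, map_zero]

/-- The chain complex `C_•(g; W)`: `Λᵖ g ⊗ W` in homological degree `p`. -/
def ceComplex : ChainComplex (ModuleCat.{0} ℂ) ℕ :=
  ChainComplex.of (fun p => ModuleCat.of ℂ ((⋀[ℂ]^p g) ⊗[ℂ] W)) (fun p => ModuleCat.ofHom (ceD ρ p))
    (fun p => ModuleCat.hom_ext (LinearMap.ext fun u => ceD_ceD ρ p u))

variable (g W) in
/-- The identification `W = Λ⁰ g ⊗ W`. -/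
def ceZero : W ≃ₗ[ℂ] (⋀[ℂ]^0 g) ⊗[ℂ] W :=
  (TensorProduct.lid ℂ W).symm ≪≫ₗ
    TensorProduct.congr (exteriorPower.zeroEquiv ℂ g).symm (LinearEquiv.refl ℂ W)

variable (g W) in
/-- The identification `g ⊗ W = Λ¹ g ⊗ W`. -/
def ceOne : g ⊗[ℂ] W ≃ₗ[ℂ] (⋀[ℂ]^1 g) ⊗[ℂ] W :=
  TensorProduct.congr (exteriorPower.oneEquiv ℂ g).symm (LinearEquiv.refl ℂ W)

theorem ceIncl_ceZero (w : W) : ceIncl g W 0 (ceZero g W w) = 1 ⊗ₜ[ℂ] w := by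
  change (((exteriorPower.zeroEquiv ℂ g).symm 1 : ⋀[ℂ]^0 g) : ExteriorAlgebra ℂ g) ⊗ₜ[ℂ] w = _
  rw [exteriorPower.zeroEquiv_symm_apply, one_smul, exteriorPower.ιMulti_apply_coe,
    ExteriorAlgebra.ιMulti_zero_apply]

theorem ceIncl_ceOne (x : g) (w : W) :
    ceIncl g W 1 (ceOne g W (x ⊗ₜ[ℂ] w)) = ι ℂ x ⊗ₜ[ℂ] w := by
  change (((exteriorPower.oneEquiv ℂ g).symm x : ⋀[ℂ]^1 g) : ExteriorAlgebra ℂ g) ⊗ₜ[ℂ] w = _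
  rw [exteriorPower.oneEquiv_symm_apply, exteriorPower.ιMulti_apply_coe,
    ExteriorAlgebra.ιMulti_succ_apply, ExteriorAlgebra.ιMulti_zero_apply, mul_one]

/-- The right end of the complex is the multiplication map `g ⊗ W → W`. -/
theorem ceD_ceOne (x : g) (w : W) :
    ceD ρ 0 (ceOne g W (x ⊗ₜ[ℂ] w)) = ceZero g W (ρ x w) := by
  have h1 : ceIncl g W 0 (ceD ρ 0 (ceOne g W (x ⊗ₜ[ℂ] w))) =
      ceIncl g W 0 (ceZero g W (ρ x w)) := by
    rw [ceIncl_ceD, ceIncl_ceOne, ceIncl_ceZero, ← mul_one (ι ℂ x), ← wedge_tmul, ceDiff_wedge,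
      ceDiff_one, map_zero, sub_zero, lieExt_one]
  have h2 := congrArg (ceProj g W 0) h1
  rwa [ceProj_ceIncl, ceProj_ceIncl] at h2

end ChevalleyEilenberg
/-! ### The twisted De Rham complex -/

section DeRham

variable {n : ℕ} (z : Fin n ↪ ℂ) (M : Fin n → ℂ) (k : ℂ)

/-- The differential forms regular on the punctured line: the Kähler differentials of its coordinate
ring. -/
def Forms {n : ℕ} (z : Fin n ↪ ℂ) : Type := Ω[Reg z⁄ℂ]

instance : AddCommGroup (Forms z) := inferInstanceAs (AddCommGroup Ω[Reg z⁄ℂ])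

instance : Module (Reg z) (Forms z) := inferInstanceAs (Module (Reg z) Ω[Reg z⁄ℂ])

instance : Module ℂ (Forms z) := inferInstanceAs (Module ℂ Ω[Reg z⁄ℂ])

instance : IsScalarTower ℂ (Reg z) (Forms z) :=
  inferInstanceAs (IsScalarTower ℂ (Reg z) Ω[Reg z⁄ℂ])

/-- The De Rham differential. -/
def dRham : Derivation ℂ (Reg z) (Forms z) := KaehlerDifferential.D ℂ (Reg z)

/-- The form `α = - κ⁻¹ ∑ᵢ Mⁱ dt / (t - zᵢ)`, where `κ = k + 2`. -/
def alpha : Forms z :=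
  -(k + 2)⁻¹ • ∑ i : Fin n, M i • (pole z i • dRham z (coord z))

/-- The twisted De Rham differential `g ↦ dg + g α`. -/
def twistedD : Reg z →ₗ[ℂ] Forms z :=
  (dRham z : Reg z →ₗ[ℂ] Forms z) + (LinearMap.toSpanSingleton (Reg z) (Forms z)
    (alpha z M k)).restrictScalars ℂ

theorem twistedD_apply (g : Reg z) : twistedD z M k g = dRham z g + g • alpha z M k := rfl

/-- The terms of the shifted twisted De Rham complex: the forms in homological degree `0` and the
functions in homological degree `1`. -/
def deRhamX : ℕ → ModuleCat.{0} ℂ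
  | 0 => ModuleCat.of ℂ (Forms z)
  | 1 => ModuleCat.of ℂ (Reg z)
  | _ + 2 => ModuleCat.of ℂ PUnit

/-- The differentials of the shifted twisted De Rham complex. -/
def deRhamD : ∀ p : ℕ, deRhamX z (p + 1) ⟶ deRhamX z p
  | 0 => ModuleCat.ofHom (twistedD z M k)
  | _ + 1 => 0

/-- The shifted twisted De Rham complex `Ω^•(U(z))[1]`. -/
def deRham : ChainComplex (ModuleCat.{0} ℂ) ℕ :=
  ChainComplex.of (deRhamX z) (deRhamD z M k) fun _ => CategoryTheory.Limits.zero_comp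

/-- The complex `C_•(sl₂(U(z)); V₁^* ⊗ … ⊗ V_{n+1}^*)`. -/
def chains : ChainComplex (ModuleCat.{0} ℂ) ℕ := ceComplex (act z M k)

end DeRham

/-! ### The morphism -/

section Eta

open Finset

variable {n : ℕ} (z : Fin n ↪ ℂ) (M : Fin n → ℂ) (k : ℂ)

/-- The vector `v₁^* ⊗ … ⊗ v_{n+1}^*`. -/
def vacTensor : Coeff M k :=
  PiTensorProduct.tprod ℂ fun p => (dualVec (weight M p) k idxV : Contra (weight M p) k)

/-- The vector `v₁^* ⊗ … ⊗ (x_p)^* ⊗ … ⊗ v_{n+1}^*`, where `x_p` is the basis vector with index `m`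
of the `p`-th Verma module. -/
def tensorAt (p : Fin (n + 1)) (m : MonoIndex) : Coeff M k :=
  PiTensorProduct.tprod ℂ (Function.update
    (fun q => (dualVec (weight M q) k idxV : Contra (weight M q) k)) p
    (dualVec (weight M p) k m : Contra (weight M p) k))

/-- The pairs `(i, j)` with `i + j = s` and `i ≥ j ≥ 0`. -/
def pairs (s : ℕ) : Finset (ℕ × ℕ) := {q ∈ antidiagonal s | q.2 ≤ q.1}

/-- The formulas for `η¹`, with `κ = k + 2`: for all `b ≥ 0`,
`dt / (t - z_m)^{b+1} ↦ - κ v₁^* ⊗ … ⊗ ((f / T^b) v_m)^* ⊗ … ⊗ v_{n+1}^*` and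
`t^b dt ↦ κ v₁^* ⊗ … ⊗ v_n^* ⊗ ((e / T^{b+1}) v_{n+1})^*`. -/
def IsEtaOne (η₁ : Forms z →ₗ[ℂ] Coeff M k) : Prop :=
  (∀ (m : Fin n) (b : ℕ), η₁ (pole z m ^ (b + 1) • dRham z (coord z)) =
    -(k + 2) • tensorAt M k m.castSucc (idxF b)) ∧
  (∀ b : ℕ, η₁ (coord z ^ b • dRham z (coord z)) =
    (k + 2) • tensorAt M k (Fin.last n) (idxE b))

/-- The formulas for `η⁰`. They are written with `b + 1` in place of `b ≥ 1` and `l + 1` in place of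
`l ≥ 1` at the finite points, and with `b + 2` in place of `b ≥ 2` and `i + 1`, `j + 1` in place of
`i, j ≥ 1` at infinity. -/
def IsEtaZero (η₀ : Reg z →ₗ[ℂ] SlU z ⊗[ℂ] Coeff M k) : Prop :=
  (∀ (m : Fin n) (b : ℕ), η₀ (pole z m ^ (b + 1)) =
    elt f (pole z m ^ (b + 1)) ⊗ₜ[ℂ] vacTensor M k -
      ∑ l ∈ range (b + 1),
        (elt e (pole z m ^ (l + 1)) ⊗ₜ[ℂ]
            ((2 : ℂ) • ∑ q ∈ pairs (b - l), tensorAt M k m.castSucc (idxFF q.1 q.2)) +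
          elt h (pole z m ^ (l + 1)) ⊗ₜ[ℂ] tensorAt M k m.castSucc (idxF (b - l)))) ∧
  η₀ 1 = elt f 1 ⊗ₜ[ℂ] vacTensor M k ∧
  η₀ (coord z) = elt f (coord z) ⊗ₜ[ℂ] vacTensor M k ∧
  (∀ b : ℕ, η₀ (coord z ^ (b + 2)) =
    elt f (coord z ^ (b + 2)) ⊗ₜ[ℂ] vacTensor M k -
      ∑ l ∈ range (b + 1),
        (elt e (coord z ^ l) ⊗ₜ[ℂ]
            ((2 : ℂ) • ∑ q ∈ pairs (b - l), tensorAt M k (Fin.last n) (idxEE q.1 q.2)) +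
          elt h (coord z ^ (l + 1)) ⊗ₜ[ℂ] tensorAt M k (Fin.last n) (idxE (b - l))))

end Eta

end AffineSl2

end

/-!
Every map in the theorem is pinned down by its values on the basis of elementary functions `t^b`,
`(t - z_m)^{-b-1}` of the ring of regular functions (`regBasis`), or on the forms obtained from it by
multiplication with `dt` (`formsEquiv`); this gives existence and uniqueness of `η⁰` and `η¹`. Their
injectivity follows by reading off coefficients: `η⁰` has a left inverse that takes the component of
`f ⊗ v₁^* ⊗ … ⊗ v_{n+1}^*` (`injective_of_isEtaZero`), and the values of `η¹` are separated by
evaluation at tensors of vectors of the Verma modules (`injective_of_isEtaOne`). What remains is that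
the square formed by `η⁰` and `η¹` commutes (`actTensor_etaZero`).

An elementary function with a pole at `z_m` is holomorphic at the other points, and there the vector
`v_i^*` sees only its value because `a Tʲ v_i^* = 0` for `j > 0`; these contributions match the partial
fraction expansion of `(t - z_m)^{-b} α`. The contribution of the point `z_m` itself is the identity
`contraRep_sugawara` in a single contragredient Verma module,
`(f/T^b) v^* - ∑_{l=1}^b ((e/T^l) 2 ∑ (f/Tⁱ f/Tʲ v)^* + (h/T^l) (f/T^{b-l} v)^*) =
(M + b (k + 2)) (f/T^b v)^*`, whose scalar collects the contributions of `d (t - z_m)^{-b}` and of the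
polar part of `α` at `z_m`. Its transpose (`dualForm_sugawara`) is an identity between functionals on
`V`: it results from applying the functional `(f/T^b v)^*` to the Sugawara operator, which acts on the
component of degree `(p₁, p₂)` of `V` by the scalar `M/2 + M²/4 + (k + 2) p₂` (`sug_word`). At infinity the same
identity is used after transport by the diagram automorphism of the affine Lie algebra, which exchanges
the two nodes and maps `V(M, k - M)` to `V(k - M, M)` (`diagram`, `contraRep_sugawara_swap`); this
explains the twist by `π` and the shift `M^{n+1} = ∑ M^i - 2`.

The formulas involve the dual basis of the basis of Poincaré–Birkhoff–Witt monomials, but only its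
elements dual to products of factors `f/Tⁱ` alone or `e/T^l` alone. The Poincaré–Birkhoff–Witt theorem
is not needed for them: they are the coefficients of a symbol map from `V` to the polynomial ring in
the variables `f/Tⁱ` (`exists_symbol`), which is constructed from the universal property of `V` by
inducing a module from the nonnegative part of the affine Lie algebra.
-/

noncomputable section

namespace AffineSl2

/-! ### Linear maps out of the affine Lie algebra -/

section AffineLift

variable {E : Type*} [AddCommGroup E] [Module ℂ E]

/-- The linear map on the affine Lie algebra with prescribed values on the elements `a Tⁱ` and `c`. -/
def affineLift (φ : ℤ → Sl2 →ₗ[ℂ] E) (y : E) : Affine →ₗ[ℂ] E :=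
  ((TensorProduct.lift
      ((Finsupp.lsum ℂ fun i : ℤ => LinearMap.toSpanSingleton ℂ (Sl2 →ₗ[ℂ] E) (φ i)) ∘ₗ
        (AddMonoidAlgebra.coeffLinearEquiv ℂ).toLinearMap)).coprod
    (LinearMap.toSpanSingleton ℂ E y ∘ₗ
      (TrivialLieModule.equiv ℂ (LieAlgebra.loopAlgebra ℂ ℤ Sl2) ℂ).toLinearMap)) ∘ₗ
    ofPair.symm.toLinearMap

theorem affineLift_ofPair (φ : ℤ → Sl2 →ₗ[ℂ] E) (y : E)
    (x : LieAlgebra.loopAlgebra ℂ ℤ Sl2)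
    (r : TrivialLieModule ℂ (LieAlgebra.loopAlgebra ℂ ℤ Sl2) ℂ) :
    affineLift φ y (ofPair (x, r)) = (TensorProduct.lift
      ((Finsupp.lsum ℂ fun i : ℤ => LinearMap.toSpanSingleton ℂ (Sl2 →ₗ[ℂ] E) (φ i)) ∘ₗ
        (AddMonoidAlgebra.coeffLinearEquiv ℂ).toLinearMap)) x +
      (TrivialLieModule.equiv ℂ (LieAlgebra.loopAlgebra ℂ ℤ Sl2) ℂ r) • y := by
  change (LinearMap.coprod _ _) (ofPair.symm (ofPair (x, r))) = _
  rw [LinearEquiv.symm_apply_apply]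
  rfl

@[simp] theorem affineLift_T (φ : ℤ → Sl2 →ₗ[ℂ] E) (y : E) (i : ℤ) (a : Sl2) :
    affineLift φ y (T i a) = φ i a := by
  rw [T_apply, affineLift_ofPair, map_zero, zero_smul, add_zero]
  refine (TensorProduct.lift.tmul _ _).trans ?_
  change (Finsupp.lsum ℂ fun i : ℤ => LinearMap.toSpanSingleton ℂ (Sl2 →ₗ[ℂ] E) (φ i))
    (Finsupp.single i 1) a = _
  simp

@[simp] theorem affineLift_c (φ : ℤ → Sl2 →ₗ[ℂ] E) (y : E) : affineLift φ y c = y := by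
  rw [c, affineLift_ofPair, map_zero, zero_add, LinearEquiv.apply_symm_apply, one_smul]

end AffineLift

/-! ### Induced modules realized on an enveloping algebra -/

section Induced

variable {L : Type} [LieRing L] [LieAlgebra ℂ L]

/-- Every element of `U(N)` is obtained from `1` by sums, scalar multiples and left multiplications by
elements of `N`. -/
theorem enveloping_induction {N : Type*} [LieRing N] [LieAlgebra ℂ N]
    {P : UniversalEnvelopingAlgebra ℂ N → Prop} (hone : P 1) (hadd : ∀ u v, P u → P v → P (u + v))
    (hsmul : ∀ (r : ℂ) u, P u → P (r • u))
    (hmul : ∀ y u, P u → P (UniversalEnvelopingAlgebra.ι ℂ y * u))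
    (u : UniversalEnvelopingAlgebra ℂ N) : P u := by
  suffices key : ∀ t : TensorAlgebra ℂ N, ∀ u : UniversalEnvelopingAlgebra ℂ N,
      P u → P (UniversalEnvelopingAlgebra.mkAlgHom ℂ N t * u) by
    obtain ⟨t, rfl⟩ : ∃ t, UniversalEnvelopingAlgebra.mkAlgHom ℂ N t = u :=
      RingCon.mk'_surjective (UniversalEnvelopingAlgebra.ringCon ℂ N) u
    have := key t 1 hone
    rwa [mul_one] at this
  intro t
  induction t using TensorAlgebra.induction with
  | algebraMap r =>
    intro u hu
    rw [AlgHom.commutes, ← Algebra.smul_def]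
    exact hsmul _ _ hu
  | ι y => intro u hu; exact hmul y u hu
  | mul a b ha hb => intro u hu; rw [map_mul, mul_assoc]; exact ha _ (hb _ hu)
  | add a b ha hb => intro u hu; rw [map_add, add_mul]; exact hadd _ _ (ha _ hu) (hb _ hu)

variable (N : LieSubalgebra ℂ L)

/-- The action of a subalgebra `N` on the space of linear maps `L → U(N)` that combines left
multiplication on `U(N)` with the adjoint action on `L`. -/
def homAction : N →ₗ⁅ℂ⁆ Module.End ℂ (L →ₗ[ℂ] UniversalEnvelopingAlgebra ℂ N) where
  toFun y :=
    { toFun := fun F => LinearMap.mulLeft ℂ (UniversalEnvelopingAlgebra.ι ℂ y) ∘ₗ F -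
        F ∘ₗ (LieAlgebra.ad ℂ L (y : L))
      map_add' := fun F G => by ext x; simp [mul_add]; abel
      map_smul' := fun r F => by ext x; simp [smul_sub] }
  map_add' y y' := by ext F x; simp [add_mul]; abel
  map_smul' r y := by ext F x; simp [smul_sub]
  map_lie' {y y'} := by
    ext F x
    simp [LieRing.of_associative_ring_bracket, mul_sub, sub_mul, mul_assoc]
    abel

theorem homAction_apply (y : N) (F : L →ₗ[ℂ] UniversalEnvelopingAlgebra ℂ N) (x : L) :
    homAction N y F x = UniversalEnvelopingAlgebra.ι ℂ y * F x - F ⁅(y : L), x⁆ := rfl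

variable {N}

/-- Let `L = N ⊕ B` be a decomposition of a Lie algebra into two subalgebras, `p` the projection to
`N` along `B` and `χ` a character of `B`, extended by zero to `N`. The `L`-module induced from `χ` is
realized on `U(N)`: there is an action of `L` in which `N` acts by left multiplication and
`x · 1 = χ(x)` for `x ∈ B`. It is determined by the rule `x · (y u) = y (x · u) + [x, y] · u` for
`y ∈ N`, which is consistent because it describes the orbit map `u ↦ u D` of the element
`D : x ↦ x · 1` for an action of `U(N)` on the linear maps `L → U(N)`. -/
theorem exists_induced (p : L →ₗ[ℂ] N) (χ : L →ₗ[ℂ] ℂ) (hp : ∀ y : N, p y = y)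
    (hχ : ∀ y : N, χ y = 0)
    (hB : ∀ x x', p x = 0 → p x' = 0 → p ⁅x, x'⁆ = 0 ∧ χ ⁅x, x'⁆ = 0) :
    ∃ ρ : L →ₗ⁅ℂ⁆ Module.End ℂ (UniversalEnvelopingAlgebra ℂ N),
      (∀ x, p x = 0 → ρ x 1 = χ x • 1) ∧
      (∀ (y : N) u, ρ y u = UniversalEnvelopingAlgebra.ι ℂ y * u) := by
  let D₁ : L →ₗ[ℂ] UniversalEnvelopingAlgebra ℂ N :=
    ((UniversalEnvelopingAlgebra.ι ℂ : N →ₗ⁅ℂ⁆ _) : N →ₗ[ℂ] UniversalEnvelopingAlgebra ℂ N) ∘ₗ p +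
      LinearMap.toSpanSingleton ℂ _ 1 ∘ₗ χ
  let ρ : L →ₗ[ℂ] Module.End ℂ (UniversalEnvelopingAlgebra ℂ N) :=
    ((LinearMap.flip (UniversalEnvelopingAlgebra.lift ℂ (homAction N)).toLinearMap) D₁).flip
  have hone : ∀ x, ρ x 1 = UniversalEnvelopingAlgebra.ι ℂ (p x) + χ x • 1 := by
    intro x
    change (UniversalEnvelopingAlgebra.lift ℂ (homAction N) 1) D₁ x = _
    rw [map_one]
    rfl
  have hmul : ∀ x (y : N) u, ρ x (UniversalEnvelopingAlgebra.ι ℂ y * u) =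
      UniversalEnvelopingAlgebra.ι ℂ y * ρ x u + ρ ⁅x, (y : L)⁆ u := by
    intro x y u
    change (UniversalEnvelopingAlgebra.lift ℂ (homAction N)
      (UniversalEnvelopingAlgebra.ι ℂ y * u)) D₁ x = _
    rw [map_mul, UniversalEnvelopingAlgebra.lift_ι_apply, Module.End.mul_apply, homAction_apply,
      ← lie_skew, map_neg, sub_neg_eq_add]
    rfl
  have hN : ∀ (y : N) u, ρ y u = UniversalEnvelopingAlgebra.ι ℂ y * u := by
    intro y u
    induction u using enveloping_induction generalizing y with
    | hone => rw [hone, hp, hχ, zero_smul, add_zero, mul_one]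
    | hadd u v hu hv => rw [map_add, hu, hv, mul_add]
    | hsmul r u hu => rw [map_smul, hu, mul_smul_comm]
    | hmul y' u hu =>
      rw [hmul, hu, ← LieSubalgebra.coe_bracket, hu, LieHom.map_lie,
        LieRing.of_associative_ring_bracket]
      noncomm_ring
  have hlie : ∀ u x x', ρ ⁅x, x'⁆ u = ρ x (ρ x' u) - ρ x' (ρ x u) := by
    intro u
    induction u using enveloping_induction with
    | hone =>
      have hBB : ∀ x x', p x = 0 → p x' = 0 → ρ ⁅x, x'⁆ 1 = ρ x (ρ x' 1) - ρ x' (ρ x 1) := by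
        intro x x' hx hx'
        obtain ⟨h1, h2⟩ := hB x x' hx hx'
        simp only [hone, h1, h2, hx, hx', map_zero, zero_add, zero_smul, map_smul]
        rw [smul_comm, sub_self]
      have hNN : ∀ (y : N) x', ρ ⁅(y : L), x'⁆ 1 = ρ y (ρ x' 1) - ρ x' (ρ y 1) := by
        intro y x'
        rw [hN, hN, hmul, ← lie_skew, map_neg, LinearMap.neg_apply]
        abel
      intro x x'
      have hx : p (x - p x) = 0 := by rw [map_sub, hp, sub_self]
      have hx' : p (x' - p x') = 0 := by rw [map_sub, hp, sub_self]
      -- The identity is bilinear, so it suffices to treat the components in `N` and in `ker p`.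
      have e1 := hBB _ _ hx hx'
      have e2 := hNN (p x) (x' - p x')
      have e3 := hNN (p x') x
      rw [← lie_skew] at e3
      simp only [sub_lie, lie_sub, map_sub, map_neg, LinearMap.sub_apply, LinearMap.neg_apply]
        at e1 e2 e3
      linear_combination (norm := module) e1 + e2 - e3
    | hadd u v hu hv => intro x x'; simp only [map_add, hu, hv]; abel
    | hsmul r u hu => intro x x'; simp only [map_smul, hu, smul_sub]
    | hmul y u hu =>
      intro x x'
      have e1 := hu x ⁅x', (y : L)⁆
      have e2 := hu x' ⁅x, (y : L)⁆
      simp only [hmul, map_add, hu x x', lie_lie x x', map_sub, LinearMap.sub_apply, mul_sub, e1, e2]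
      abel
  refine ⟨{ ρ with map_lie' := fun {x x'} => LinearMap.ext fun u => hlie u x x' }, ?_, hN⟩
  intro x hx
  have := hone x
  rw [hx, map_zero, zero_add] at this
  exact this

end Induced

/-! ### The universal property of Verma modules -/

section Universal

variable {W : Type} [AddCommGroup W] [Module ℂ W]

/-- A highest weight vector `w` of weight `(M, k - M)` in a representation of the affine Lie algebra is
the image of `v` under an intertwining map from the Verma module. -/
theorem exists_vermaLift {M k : ℂ} (ρ : Affine →ₗ⁅ℂ⁆ Module.End ℂ W) (w : W)
    (he : ∀ i, ρ (chevE i) w = 0) (hh : ρ (T 0 h) w = M • w) (hc : ρ c w = k • w) :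
    ∃ F : Verma M k →ₗ[ℂ] W, F (vac M k) = w ∧
      ∀ x y, F (vermaRep M k x y) = ρ x (F y) := by
  let φ : U →ₐ[ℂ] Module.End ℂ W := UniversalEnvelopingAlgebra.lift ℂ ρ
  let G : U →ₗ[ℂ] W := (LinearMap.applyₗ w) ∘ₗ φ.toLinearMap
  have hG : ∀ u, G u = φ u w := fun _ => rfl
  have hι : ∀ x, φ (UniversalEnvelopingAlgebra.ι ℂ x) = ρ x := fun x =>
    UniversalEnvelopingAlgebra.lift_ι_apply ℂ ρ x
  have hker : ∀ u ∈ vermaIdeal M k, G u = 0 := by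
    intro u hu
    induction hu using Submodule.span_induction with
    | zero => exact map_zero _
    | add u v _ _ hu hv => rw [map_add, hu, hv, add_zero]
    | smul r u _ hu => rw [hG, smul_eq_mul, map_mul, Module.End.mul_apply, ← hG, hu, map_zero]
    | mem u hu =>
      rcases hu with rfl | rfl | rfl | rfl
      · rw [hG, hι, he]
      · rw [hG, hι, he]
      · rw [hG, map_sub, hι, AlgHom.commutes, LinearMap.sub_apply]
        change ρ (T 0 h) w - M • w = 0
        rw [hh, sub_self]
      · rw [hG, map_sub, hι, AlgHom.commutes, LinearMap.sub_apply]
        change ρ (c - T 0 h) w - (k - M) • w = 0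
        rw [map_sub, LinearMap.sub_apply, hh, hc, sub_smul, sub_self]
  let F : Verma M k →ₗ[ℂ] W :=
    Submodule.liftQ ((vermaIdeal M k).restrictScalars ℂ) G hker
  have hF : ∀ u, F (vermaMk M k u) = G u := fun _ => rfl
  refine ⟨F, ?_, ?_⟩
  · rw [vac, hF, hG, map_one]; rfl
  · intro x y
    obtain ⟨u, rfl⟩ := (vermaIdeal M k).mkQ_surjective y
    change F (vermaRep M k x (vermaMk M k u)) = ρ x (F (vermaMk M k u))
    rw [vermaRep_apply, ← map_smul, hF, hF, hG, hG, smul_eq_mul, map_mul, hι]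
    rfl

end Universal

/-! ### The symbol of a vector of a Verma module -/

section Projections

/-- The lower triangular part `a ↦ a₂₁ f` of a traceless matrix. -/
def lowerPart : Sl2 →ₗ[ℂ] Sl2 where
  toFun a := a.val 1 0 • f
  map_add' a b := add_smul (a.val 1 0) (b.val 1 0) f
  map_smul' r a := mul_smul r (a.val 1 0) f

theorem lowerPart_apply (a : Sl2) : lowerPart a = a.val 1 0 • f := rfl

/-- The coefficient of `h` of a traceless matrix. -/
def diagCoeff : Sl2 →ₗ[ℂ] ℂ where
  toFun a := a.val 0 0
  map_add' _ _ := rfl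
  map_smul' _ _ := rfl

theorem diagCoeff_apply (a : Sl2) : diagCoeff a = a.val 0 0 := rfl

theorem f_val_one_zero : f.val 1 0 = 1 := by simp [f_val]

theorem e_val_one_zero : e.val 1 0 = 0 := by simp [e_val]

theorem h_val_one_zero : h.val 1 0 = 0 := by simp [h_val]

theorem lowerPart_lowerPart (a : Sl2) : lowerPart (lowerPart a) = lowerPart a := by
  rw [lowerPart_apply a, map_smul, lowerPart_apply, f_val_one_zero, one_smul]

/-- The upper triangular matrices form a subalgebra whose commutators have zero diagonal. -/
theorem upper_lie {a b : Sl2} (ha : lowerPart a = 0) (hb : lowerPart b = 0) :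
    lowerPart ⁅a, b⁆ = 0 ∧ diagCoeff ⁅a, b⁆ = 0 := by
  have hf : f ≠ 0 := fun h0 => by
    have := f_val_one_zero
    rw [h0] at this
    exact zero_ne_one this
  have key : ∀ a : Sl2, lowerPart a = 0 → a.val 1 0 = 0 := fun a ha =>
    (smul_eq_zero.mp ha).resolve_right hf
  have ha' := key a ha
  have hb' := key b hb
  constructor
  · rw [lowerPart_apply, lie_val, Matrix.sub_apply, Matrix.mul_apply, Matrix.mul_apply]
    simp [Fin.sum_univ_two, ha', hb']
  · rw [diagCoeff_apply, lie_val, Matrix.sub_apply, Matrix.mul_apply, Matrix.mul_apply]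
    simp [Fin.sum_univ_two, ha', hb', mul_comm]

theorem form_f_f : form f f = 0 := by
  rw [form_apply, f_val, Matrix.trace_fin_two]; simp

theorem T_f_lie_T_f (i j : ℤ) : ⁅T i f, T j f⁆ = 0 := by
  rw [T_lie_T, form_f_f, lie_self, map_zero, mul_zero, ite_self, zero_smul, add_zero]

/-- The range of an idempotent, when it is closed under the bracket. -/
def idempotentRange {L : Type} [LieRing L] [LieAlgebra ℂ L] (p : L →ₗ[ℂ] L)
    (hlie : ∀ x y, p ⁅p x, p y⁆ = ⁅p x, p y⁆) : LieSubalgebra ℂ L where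
  carrier := {x | p x = x}
  add_mem' {x y} hx hy := by
    simp only [Set.mem_ofPred_eq] at hx hy ⊢
    rw [map_add, hx, hy]
  zero_mem' := map_zero p
  smul_mem' r x hx := by
    simp only [Set.mem_ofPred_eq] at hx ⊢
    rw [map_smul, hx]
  lie_mem' {x y} hx hy := by
    have := hlie x y
    change p ⁅x, y⁆ = ⁅x, y⁆
    rwa [show p x = x from hx, show p y = y from hy] at this

/-- The projection of the affine Lie algebra to the span of the `a Tⁱ`, `i < 0`, and `f`, along the
subalgebra of the `a Tⁱ`, `i > 0`, and `e`, `h`, `c`. -/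
def negPart : Affine →ₗ[ℂ] Affine :=
  affineLift (fun i => if i < 0 then T i else if i = 0 then T 0 ∘ₗ lowerPart else 0) 0

theorem negPart_T_neg {i : ℤ} (hi : i < 0) (a : Sl2) : negPart (T i a) = T i a := by
  rw [negPart, affineLift_T, if_pos hi]

theorem negPart_T_zero (a : Sl2) : negPart (T 0 a) = T 0 (lowerPart a) := by
  rw [negPart, affineLift_T]; simp

theorem negPart_T_pos {i : ℤ} (hi : 0 < i) (a : Sl2) : negPart (T i a) = 0 := by
  rw [negPart, affineLift_T, if_neg (by omega), if_neg (by omega)]; rfl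

theorem negPart_c : negPart c = 0 := affineLift_c _ _

theorem negPart_negPart (x : Affine) : negPart (negPart x) = negPart x := by
  refine LinearMap.congr_fun (f := negPart ∘ₗ negPart) (g := negPart) (affine_ext ?_ ?_) x
  · intro i a
    rw [LinearMap.comp_apply]
    rcases lt_trichotomy i 0 with hi | rfl | hi
    · rw [negPart_T_neg hi, negPart_T_neg hi]
    · rw [negPart_T_zero, negPart_T_zero, lowerPart_lowerPart]
    · rw [negPart_T_pos hi, map_zero]
  · rw [LinearMap.comp_apply, negPart_c, map_zero]

/-- An identity between bilinear expressions `A ⁅B x, B y⁆` holds if it holds on spanning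
elements. -/
theorem lie_identity_of_span {E : Type*} [AddCommGroup E] [Module ℂ E] (A A' : Affine →ₗ[ℂ] E)
    (B : Affine →ₗ[ℂ] Affine) (hTT : ∀ i a j b, A ⁅B (T i a), B (T j b)⁆ = A' ⁅B (T i a), B (T j b)⁆)
    (hc : ∀ x : Affine, ⁅B c, x⁆ = 0) (x y : Affine) : A ⁅B x, B y⁆ = A' ⁅B x, B y⁆ := by
  have hc' : ∀ x : Affine, ⁅x, B c⁆ = 0 := fun x => by rw [← lie_skew, hc, neg_zero]
  induction x using affine_induction with
  | h0 => simp
  | hadd x x' hx hx' => simp only [map_add, add_lie, hx, hx']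
  | hsmul r x hx => simp only [map_smul, smul_lie, hx]
  | hc => rw [hc, map_zero, map_zero]
  | hT i a =>
    induction y using affine_induction with
    | h0 => simp
    | hadd y y' hy hy' => simp only [map_add, lie_add, hy, hy']
    | hsmul r y hy => simp only [map_smul, lie_smul, hy]
    | hc => rw [hc', map_zero, map_zero]
    | hT j b => exact hTT i a j b

theorem negPart_lie (x y : Affine) :
    negPart ⁅negPart x, negPart y⁆ = ⁅negPart x, negPart y⁆ := by
  refine lie_identity_of_span negPart LinearMap.id negPart ?_ (fun x => ?_) x y
  · intro i a j b
    have key : ∀ i j : ℤ, i ≤ 0 → j ≤ 0 → i + j < 0 → ∀ a b,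
        negPart ⁅T i a, T j b⁆ = ⁅T i a, T j b⁆ := by
      intro i j hi hj hij a b
      rw [T_lie_T, if_neg (by omega), zero_smul, add_zero, negPart_T_neg hij]
    rw [LinearMap.id_apply]
    rcases lt_trichotomy i 0 with hi | rfl | hi
    · rcases lt_trichotomy j 0 with hj | rfl | hj
      · rw [negPart_T_neg hi, negPart_T_neg hj, key _ _ hi.le hj.le (by omega)]
      · rw [negPart_T_neg hi, negPart_T_zero, key _ _ hi.le le_rfl (by omega)]
      · rw [negPart_T_pos hj, lie_zero, map_zero]
    · rcases lt_trichotomy j 0 with hj | rfl | hj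
      · rw [negPart_T_zero, negPart_T_neg hj, key _ _ le_rfl hj.le (by omega)]
      · rw [negPart_T_zero, negPart_T_zero, lowerPart_apply, lowerPart_apply, map_smul, map_smul,
          smul_lie, lie_smul, T_f_lie_T_f]
        simp
      · rw [negPart_T_pos hj, lie_zero, map_zero]
    · rw [negPart_T_pos hi, zero_lie, map_zero]
  · rw [negPart_c, zero_lie]

/-- The projection of the affine Lie algebra to the span of the `f Tⁱ` along the subalgebra spanned by
the `e Tⁱ`, `h Tⁱ` and `c`. -/
def fPart : Affine →ₗ[ℂ] Affine :=
  affineLift (fun i => T i ∘ₗ lowerPart) 0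

theorem fPart_T (i : ℤ) (a : Sl2) : fPart (T i a) = T i (lowerPart a) := by
  rw [fPart, affineLift_T]; rfl

theorem fPart_c : fPart c = 0 := affineLift_c _ _

theorem fPart_fPart (x : Affine) : fPart (fPart x) = fPart x := by
  refine LinearMap.congr_fun (f := fPart ∘ₗ fPart) (g := fPart) (affine_ext ?_ ?_) x
  · intro i a
    rw [LinearMap.comp_apply, fPart_T, fPart_T, lowerPart_lowerPart]
  · rw [LinearMap.comp_apply, fPart_c, map_zero]

theorem fPart_lie_fPart (x y : Affine) : ⁅fPart x, fPart y⁆ = 0 := by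
  refine lie_identity_of_span LinearMap.id 0 fPart ?_ (fun x => ?_) x y
  · intro i a j b
    rw [fPart_T, fPart_T, lowerPart_apply, lowerPart_apply, map_smul, map_smul, smul_lie, lie_smul,
      T_f_lie_T_f]
    simp
  · rw [fPart_c, zero_lie]

/-- The subalgebra spanned by the `a Tⁱ`, `i < 0`, and `f`. -/
def nMinus : LieSubalgebra ℂ Affine := idempotentRange negPart negPart_lie

/-- The abelian subalgebra spanned by the `f Tⁱ`. -/
def fLoop : LieSubalgebra ℂ Affine :=
  idempotentRange fPart fun x y => by rw [fPart_lie_fPart, map_zero]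

theorem mem_nMinus {x : Affine} : x ∈ nMinus ↔ negPart x = x := Iff.rfl

theorem mem_fLoop {x : Affine} : x ∈ fLoop ↔ fPart x = x := Iff.rfl

/-- The character of the upper triangular subalgebra with `h ↦ M`, `c ↦ k`, extended by zero. -/
def charB (M k : ℂ) : Affine →ₗ[ℂ] ℂ :=
  affineLift (fun i => if i = 0 then M • diagCoeff else 0) k

theorem charB_T_zero (M k : ℂ) (a : Sl2) : charB M k (T 0 a) = M * diagCoeff a := by
  rw [charB, affineLift_T, if_pos rfl]; rfl

theorem charB_T_of_ne (M k : ℂ) {i : ℤ} (hi : i ≠ 0) (a : Sl2) : charB M k (T i a) = 0 := by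
  rw [charB, affineLift_T, if_neg hi]; rfl

/-- The affine module induced from the character `charB` is realized on `U(n₋)`. -/
theorem exists_rep_nMinus (M k : ℂ) :
    ∃ ρ : Affine →ₗ⁅ℂ⁆ Module.End ℂ (UniversalEnvelopingAlgebra ℂ nMinus),
      (∀ x, negPart x = 0 → ρ x 1 = charB M k x • 1) ∧
      (∀ (y : nMinus) u, ρ y u = UniversalEnvelopingAlgebra.ι ℂ y * u) := by
  have hB : ∀ x x', negPart x = 0 → negPart x' = 0 →
      negPart ⁅x, x'⁆ = 0 ∧ charB M k ⁅x, x'⁆ = 0 := by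
    let q : Affine →ₗ[ℂ] Affine := LinearMap.id - negPart
    have hq : ∀ x, negPart x = 0 → q x = x := fun x hx => by
      change x - negPart x = x; rw [hx, sub_zero]
    have hqc : ∀ x : Affine, ⁅q c, x⁆ = 0 := fun x => by rw [hq c negPart_c, c_lie]
    have hqT : ∀ i a, i < 0 → q (T i a) = 0 := fun i a hi => by
      change T i a - negPart (T i a) = 0; rw [negPart_T_neg hi, sub_self]
    have hqT0 : ∀ a, q (T 0 a) = T 0 (a - lowerPart a) := fun a => by
      change T 0 a - negPart (T 0 a) = _; rw [negPart_T_zero, map_sub]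
    have hup : ∀ a, lowerPart (a - lowerPart a) = 0 := fun a => by
      rw [map_sub, lowerPart_lowerPart, sub_self]
    have hTT : ∀ i a j b, negPart ⁅q (T i a), q (T j b)⁆ = 0 ∧
        charB M k ⁅q (T i a), q (T j b)⁆ = 0 := by
      have key : ∀ i j : ℤ, 0 < i + j → ∀ a b, negPart ⁅T i a, T j b⁆ = 0 ∧
          charB M k ⁅T i a, T j b⁆ = 0 := by
        intro i j hij a b
        rw [T_lie_T, if_neg (by omega), zero_smul, add_zero]
        exact ⟨negPart_T_pos hij _, charB_T_of_ne M k (by omega) _⟩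
      intro i a j b
      rcases lt_trichotomy i 0 with hi | rfl | hi
      · rw [hqT i a hi, zero_lie, map_zero, map_zero]; exact ⟨rfl, rfl⟩
      · rcases lt_trichotomy j 0 with hj | rfl | hj
        · rw [hqT j b hj, lie_zero, map_zero, map_zero]; exact ⟨rfl, rfl⟩
        · obtain ⟨h1, h2⟩ := upper_lie (hup a) (hup b)
          rw [hqT0, hqT0, T_lie_T, Int.cast_zero, zero_mul, ite_self, zero_smul, add_zero, add_zero,
            negPart_T_zero, charB_T_zero, h1, h2, map_zero, mul_zero]
          exact ⟨rfl, rfl⟩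
        · rw [hqT0, hq _ (negPart_T_pos hj b)]
          exact key _ _ (by omega) _ _
      · rcases lt_trichotomy j 0 with hj | rfl | hj
        · rw [hqT j b hj, lie_zero, map_zero, map_zero]; exact ⟨rfl, rfl⟩
        · rw [hqT0, hq _ (negPart_T_pos hi a)]
          exact key _ _ (by omega) _ _
        · rw [hq _ (negPart_T_pos hi a), hq _ (negPart_T_pos hj b)]
          exact key _ _ (by omega) _ _
    intro x x' hx hx'
    have h1 := lie_identity_of_span negPart 0 q (fun i a j b => (hTT i a j b).1) hqc x x'
    have h2 := lie_identity_of_span (charB M k) 0 q (fun i a j b => (hTT i a j b).2) hqc x x'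
    rw [hq x hx, hq x' hx'] at h1 h2
    exact ⟨h1, h2⟩
  have hχ : ∀ x, charB M k (negPart x) = 0 := by
    intro x
    refine LinearMap.congr_fun (f := charB M k ∘ₗ negPart) (g := 0) (affine_ext ?_ ?_) x
    · intro i a
      rw [LinearMap.comp_apply]
      rcases lt_trichotomy i 0 with hi | rfl | hi
      · rw [negPart_T_neg hi, charB_T_of_ne M k hi.ne]; rfl
      · rw [negPart_T_zero, charB_T_zero, lowerPart_apply, map_smul, diagCoeff_apply, f_val]
        simp
      · rw [negPart_T_pos hi, map_zero]; rfl
    · rw [LinearMap.comp_apply, negPart_c, map_zero]; rfl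
  have hpz : ∀ x, negPart.codRestrict nMinus.toSubmodule (fun x => negPart_negPart x) x = 0 ↔
      negPart x = 0 := fun x => Subtype.ext_iff
  obtain ⟨ρ, h1, h2⟩ := exists_induced (N := nMinus)
    (negPart.codRestrict nMinus.toSubmodule fun x => negPart_negPart x) (charB M k)
    (fun y => Subtype.ext y.2)
    (fun y => by have := hχ y; rwa [mem_nMinus.mp y.2] at this)
    (fun x x' hx hx' => by rw [hpz] at hx hx' ⊢; exact hB x x' hx hx')
  exact ⟨ρ, fun x hx => h1 x ((hpz x).mpr hx), h2⟩

/-- The level zero module induced from the trivial character of the span of the `e Tⁱ`, `h Tⁱ`, `c`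
is realized on the enveloping algebra of the span of the `f Tⁱ`. -/
theorem exists_rep_fLoop :
    ∃ ρ : Affine →ₗ⁅ℂ⁆ Module.End ℂ (UniversalEnvelopingAlgebra ℂ fLoop),
      (∀ x, fPart x = 0 → ρ x 1 = 0) ∧
      (∀ (y : fLoop) u, ρ y u = UniversalEnvelopingAlgebra.ι ℂ y * u) := by
  have hB : ∀ x x', fPart x = 0 → fPart x' = 0 → fPart ⁅x, x'⁆ = 0 := by
    let q : Affine →ₗ[ℂ] Affine := LinearMap.id - fPart
    have hq : ∀ x, fPart x = 0 → q x = x := fun x hx => by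
      change x - fPart x = x; rw [hx, sub_zero]
    have hqc : ∀ x : Affine, ⁅q c, x⁆ = 0 := fun x => by rw [hq c fPart_c, c_lie]
    have hqT : ∀ i a, q (T i a) = T i (a - lowerPart a) := fun i a => by
      change T i a - fPart (T i a) = _; rw [fPart_T, map_sub]
    have hup : ∀ a, lowerPart (a - lowerPart a) = 0 := fun a => by
      rw [map_sub, lowerPart_lowerPart, sub_self]
    intro x x' hx hx'
    have h1 := lie_identity_of_span fPart 0 q (fun i a j b => by
      rw [hqT, hqT, T_lie_T, map_add, map_smul, fPart_c, fPart_T, (upper_lie (hup a) (hup b)).1,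
        map_zero, smul_zero, add_zero]
      rfl) hqc x x'
    rw [hq x hx, hq x' hx'] at h1
    exact h1
  have hpz : ∀ x, fPart.codRestrict fLoop.toSubmodule (fun x => fPart_fPart x) x = 0 ↔
      fPart x = 0 := fun x => Subtype.ext_iff
  obtain ⟨ρ, h1, h2⟩ := exists_induced (N := fLoop)
    (fPart.codRestrict fLoop.toSubmodule fun x => fPart_fPart x) 0
    (fun y => Subtype.ext y.2) (fun y => rfl)
    (fun x x' hx hx' => by rw [hpz] at hx hx' ⊢; exact ⟨hB x x' hx hx', rfl⟩)
  refine ⟨ρ, fun x hx => ?_, h2⟩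
  rw [h1 x ((hpz x).mpr hx)]
  exact zero_smul _ _

end Projections

section Symbol

variable (M k : ℂ)

/-- The operator `f / Tⁱ` on the Verma module. -/
def fOp (i : ℕ) : Module.End ℂ (Verma M k) := vermaRep M k (T (-(i : ℤ)) f)

/-- The operator `h / T^{j+1}` on the Verma module. -/
def hOp (j : ℕ) : Module.End ℂ (Verma M k) := vermaRep M k (T (-((j : ℤ) + 1)) h)

/-- The operator `e / T^{l+1}` on the Verma module. -/
def eOp (l : ℕ) : Module.End ℂ (Verma M k) := vermaRep M k (T (-((l : ℤ) + 1)) e)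

/-- The Verma module is free of rank one over `U(n₋)`, where `n₋` is the span of the `f / Tⁱ`,
`h / T^{j+1}`, `e / T^{l+1}`, and its quotient by the vectors `u y v`, where `u ∈ U(n₋)` and
`y = h / T^{j+1}` or `e / T^{l+1}`, is the polynomial ring in the `f / Tⁱ`. The theorem provides the
quotient map `Φ`, and a subspace `K` that contains all vectors obtained from `v` by operators
`h / T^{j+1}` and `e / T^{l+1}`. -/
theorem exists_symbol : ∃ Φ : Verma M k →ₗ[ℂ] MvPolynomial ℕ ℂ, ∃ K : Submodule ℂ (Verma M k),
    Φ (vac M k) = 1 ∧ (∀ i w, Φ (fOp M k i w) = MvPolynomial.X i * Φ w) ∧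
    vac M k ∈ K ∧ (∀ j, ∀ w ∈ K, hOp M k j w ∈ K ∧ Φ (hOp M k j w) = 0) ∧
    (∀ l, ∀ w ∈ K, eOp M k l w ∈ K ∧ Φ (eOp M k l w) = 0) := by
  obtain ⟨ρ₁, hρ₁, hn⟩ := exists_rep_nMinus M k
  obtain ⟨ρ₂, hρ₂, hf⟩ := exists_rep_fLoop
  have hlow : ∀ a : Sl2, a.val 1 0 = 0 → lowerPart a = 0 := fun a ha => by
    rw [lowerPart_apply, ha, zero_smul]
  obtain ⟨F, hF1, hF⟩ := exists_vermaLift (M := M) (k := k) ρ₁ 1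
    (by
      intro i
      fin_cases i
      · change ρ₁ (T 0 e) 1 = 0
        rw [hρ₁ _ (by rw [negPart_T_zero, hlow e e_val_one_zero, map_zero]), charB_T_zero,
          diagCoeff_apply, e_val]
        simp
      · change ρ₁ (T 1 f) 1 = 0
        rw [hρ₁ _ (negPart_T_pos one_pos f), charB_T_of_ne M k one_ne_zero, zero_smul])
    (by
      rw [hρ₁ _ (by rw [negPart_T_zero, hlow h h_val_one_zero, map_zero]), charB_T_zero,
        diagCoeff_apply, h_val]
      simp)
    (by rw [hρ₁ _ negPart_c, charB, affineLift_c])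
  let Ψ : UniversalEnvelopingAlgebra ℂ nMinus →ₐ[ℂ]
      Module.End ℂ (UniversalEnvelopingAlgebra ℂ fLoop) :=
    UniversalEnvelopingAlgebra.lift ℂ (ρ₂.comp nMinus.incl)
  let G : Verma M k →ₗ[ℂ] UniversalEnvelopingAlgebra ℂ fLoop :=
    (LinearMap.applyₗ 1) ∘ₗ Ψ.toLinearMap ∘ₗ F
  have hGv : G (vac M k) = 1 := by
    change Ψ (F (vac M k)) 1 = 1
    rw [hF1, map_one Ψ]; rfl
  have hG : ∀ y ∈ nMinus, ∀ w, G (vermaRep M k y w) = ρ₂ y (G w) := by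
    intro y hy w
    change Ψ (F (vermaRep M k y w)) 1 = ρ₂ y (Ψ (F w) 1)
    rw [hF, show ρ₁ y (F w) = _ from hn ⟨y, hy⟩ (F w), map_mul,
      UniversalEnvelopingAlgebra.lift_ι_apply]
    rfl
  -- The enveloping algebra of the abelian algebra of the `f Tⁱ` is mapped to the polynomial ring by
  -- sending the `f Tⁱ` with `i > 0` to zero.
  let g : Affine →ₗ[ℂ] MvPolynomial ℕ ℂ := affineLift (fun i =>
    { toFun := fun a => a.val 1 0 • (if i ≤ 0 then MvPolynomial.X (-i).toNat else 0)
      map_add' := fun a b => add_smul (a.val 1 0) (b.val 1 0) _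
      map_smul' := fun r a => mul_smul r (a.val 1 0) _ }) 0
  have hg : ∀ i : ℕ, g (T (-(i : ℤ)) f) = MvPolynomial.X i := by
    intro i
    rw [affineLift_T]
    change f.val 1 0 • (if -(i : ℤ) ≤ 0 then MvPolynomial.X (- -(i : ℤ)).toNat else 0) = _
    rw [f_val_one_zero, one_smul, if_pos (by omega), neg_neg, Int.toNat_natCast]
  let θ : UniversalEnvelopingAlgebra ℂ fLoop →ₐ[ℂ] MvPolynomial ℕ ℂ :=
    UniversalEnvelopingAlgebra.lift ℂ
      { toLinearMap := g ∘ₗ fLoop.toSubmodule.subtype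
        map_lie' := fun {x y} => by
          have h1 : ⁅x, y⁆ = 0 := by
            apply Subtype.ext
            rw [LieSubalgebra.coe_bracket, ← mem_fLoop.mp x.2, ← mem_fLoop.mp y.2, fPart_lie_fPart]
            rfl
          rw [h1, LieRing.of_associative_ring_bracket, mul_comm, sub_self]
          exact map_zero _ }
  have hK : ∀ x ∈ nMinus, fPart x = 0 → ∀ w ∈ (Submodule.span ℂ {1}).comap G,
      G (vermaRep M k x w) = 0 := by
    intro x hx hx0 w hw
    obtain ⟨r, hr⟩ := Submodule.mem_span_singleton.mp (Submodule.mem_comap.mp hw)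
    rw [hG x hx, ← hr, map_smul, hρ₂ x hx0, smul_zero]
  have hK' : ∀ x ∈ nMinus, fPart x = 0 → ∀ w ∈ (Submodule.span ℂ {1}).comap G,
      vermaRep M k x w ∈ (Submodule.span ℂ {1}).comap G ∧
      (θ.toLinearMap ∘ₗ G) (vermaRep M k x w) = 0 := by
    intro x hx hx0 w hw
    have := hK x hx hx0 w hw
    refine ⟨?_, ?_⟩
    · rw [Submodule.mem_comap, this]; exact Submodule.zero_mem _
    · rw [LinearMap.comp_apply, this, map_zero]
  refine ⟨θ.toLinearMap ∘ₗ G, (Submodule.span ℂ {1}).comap G, ?_, ?_, ?_, ?_, ?_⟩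
  · change θ (G (vac M k)) = 1
    rw [hGv, map_one]
  · intro i w
    change θ (G (vermaRep M k (T (-(i : ℤ)) f) w)) = _
    have hmem : T (-(i : ℤ)) f ∈ nMinus := by
      rw [mem_nMinus]
      rcases i with _ | i
      · change negPart (T 0 f) = T 0 f
        rw [negPart_T_zero, lowerPart_apply, f_val_one_zero, one_smul]
      · exact negPart_T_neg (by omega) f
    have hmem' : T (-(i : ℤ)) f ∈ fLoop := by
      rw [mem_fLoop, fPart_T, lowerPart_apply, f_val_one_zero, one_smul]
    rw [hG _ hmem, show ρ₂ (T (-(i : ℤ)) f) (G w) = _ from hf ⟨_, hmem'⟩ (G w), map_mul,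
      UniversalEnvelopingAlgebra.lift_ι_apply, ← hg]
    rfl
  · rw [Submodule.mem_comap, hGv]
    exact Submodule.mem_span_singleton_self 1
  · intro j
    exact hK' _ (negPart_T_neg (by omega) h)
      (by rw [fPart_T, hlow h h_val_one_zero, map_zero])
  · intro l
    exact hK' _ (negPart_T_neg (by omega) e)
      (by rw [fPart_T, hlow e e_val_one_zero, map_zero])

end Symbol

/-! ### Ordered monomials span the Verma module -/

section Span

variable (M k : ℂ)

variable {M k} in
/-- Commutation of operators when no central term appears. -/
theorem vermaRep_T_T (i j : ℤ) (a b : Sl2) (hij : i + j ≠ 0) (w : Verma M k) :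
    vermaRep M k (T i a) (vermaRep M k (T j b) w) =
      vermaRep M k (T j b) (vermaRep M k (T i a) w) + vermaRep M k (T (i + j) ⁅a, b⁆) w := by
  have := rep_lie (vermaRep M k) (T i a) (T j b) w
  rw [T_lie_T, if_neg hij, zero_smul, add_zero] at this
  rw [this]
  abel

theorem fOp_fOp (i i' : ℕ) (w : Verma M k) :
    fOp M k i (fOp M k i' w) = fOp M k i' (fOp M k i w) := by
  have := rep_lie (vermaRep M k) (T (-(i : ℤ)) f) (T (-(i' : ℤ)) f) w
  rw [T_f_lie_T_f, map_zero, LinearMap.zero_apply] at this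
  exact (sub_eq_zero.mp this.symm)

theorem eOp_eOp (l l' : ℕ) (w : Verma M k) :
    eOp M k l (eOp M k l' w) = eOp M k l' (eOp M k l w) := by
  refine (vermaRep_T_T _ _ e e (by omega) w).trans ?_
  rw [lie_self, map_zero, map_zero, LinearMap.zero_apply, add_zero]
  rfl

theorem hOp_fOp (j i : ℕ) (w : Verma M k) :
    hOp M k j (fOp M k i w) = fOp M k i (hOp M k j w) - (2 : ℂ) • fOp M k (i + j + 1) w := by
  refine (vermaRep_T_T _ _ h f (by omega) w).trans ?_
  rw [lie_h_f, map_smul, map_smul, LinearMap.smul_apply, neg_smul, ← sub_eq_add_neg,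
    show -((j : ℤ) + 1) + -(i : ℤ) = -((i + j + 1 : ℕ) : ℤ) by push_cast; ring]
  rfl

theorem eOp_fOp (l i : ℕ) (w : Verma M k) :
    eOp M k l (fOp M k i w) = fOp M k i (eOp M k l w) + hOp M k (l + i) w := by
  refine (vermaRep_T_T _ _ e f (by omega) w).trans ?_
  rw [lie_e_f, show -((l : ℤ) + 1) + -(i : ℤ) = -(((l + i : ℕ) : ℤ) + 1) by push_cast; ring]
  rfl

theorem eOp_hOp (l j : ℕ) (w : Verma M k) :
    eOp M k l (hOp M k j w) = hOp M k j (eOp M k l w) - (2 : ℂ) • eOp M k (l + j + 1) w := by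
  refine (vermaRep_T_T _ _ e h (by omega) w).trans ?_
  rw [← lie_skew, lie_h_e, ← neg_smul, map_smul, map_smul, LinearMap.smul_apply, neg_smul,
    ← sub_eq_add_neg,
    show -((l : ℤ) + 1) + -((j : ℤ) + 1) = -(((l + j + 1 : ℕ) : ℤ) + 1) by push_cast; ring]
  rfl

/-- The degree of `f / Tⁱ`. -/
def degF (i : ℕ) : ℤ × ℤ := (i + 1, i)

/-- The degree of `h / T^{j+1}`. -/
def degH (j : ℕ) : ℤ × ℤ := (j + 1, j + 1)

/-- The degree of `e / T^{l+1}`. -/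
def degE (l : ℕ) : ℤ × ℤ := (l, l + 1)

/-- The degree of an ordered monomial. -/
def degMono (I J L : List ℕ) : ℤ × ℤ := (I.map degF).sum + (J.map degH).sum + (L.map degE).sum

/-- The monomial `∏ f / Tⁱ ∏ h / T^{j+1} ∏ e / T^{l+1} v`, where `i, j, l` run through three lists. -/
def monoF (I J L : List ℕ) : Verma M k :=
  I.foldr (fun i w => fOp M k i w)
    (J.foldr (fun j w => hOp M k j w) (L.foldr (fun l w => eOp M k l w) (vac M k)))

theorem monoF_cons (i : ℕ) (I J L : List ℕ) :
    monoF M k (i :: I) J L = fOp M k i (monoF M k I J L) := rfl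

theorem monoF_nil_cons (j : ℕ) (J L : List ℕ) :
    monoF M k [] (j :: J) L = hOp M k j (monoF M k [] J L) := rfl

theorem monoF_nil_nil_cons (l : ℕ) (L : List ℕ) :
    monoF M k [] [] (l :: L) = eOp M k l (monoF M k [] [] L) := rfl

/-- The span of the monomials of degree `γ` in the order `f, h, e`. -/
def monoSpan (γ : ℤ × ℤ) : Submodule ℂ (Verma M k) :=
  Submodule.span ℂ {x | ∃ I J L, degMono I J L = γ ∧ monoF M k I J L = x}

variable {M k}

theorem monoF_mem {I J L : List ℕ} {γ : ℤ × ℤ} (hγ : degMono I J L = γ) :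
    monoF M k I J L ∈ monoSpan M k γ := Submodule.subset_span ⟨I, J, L, hγ, rfl⟩

theorem map_monoSpan {A : Module.End ℂ (Verma M k)} {γ δ : ℤ × ℤ}
    (hA : ∀ I J L, degMono I J L = γ → A (monoF M k I J L) ∈ monoSpan M k δ) :
    ∀ w ∈ monoSpan M k γ, A w ∈ monoSpan M k δ := by
  intro w hw
  refine (Submodule.span_le (p := (monoSpan M k δ).comap A)).mpr ?_ hw
  rintro _ ⟨I, J, L, hd, rfl⟩
  exact hA I J L hd

theorem fOp_monoSpan (i : ℕ) (γ : ℤ × ℤ) :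
    ∀ w ∈ monoSpan M k γ, fOp M k i w ∈ monoSpan M k (degF i + γ) := by
  refine map_monoSpan fun I J L hd => ?_
  rw [← monoF_cons]
  apply monoF_mem
  rw [← hd, degMono, degMono, List.map_cons, List.sum_cons, add_assoc, add_assoc, add_assoc]

theorem hOp_monoSpan (j : ℕ) (γ : ℤ × ℤ) :
    ∀ w ∈ monoSpan M k γ, hOp M k j w ∈ monoSpan M k (degH j + γ) := by
  refine map_monoSpan fun I J L hd => ?_
  subst hd
  induction I with
  | nil =>
    rw [← monoF_nil_cons]
    apply monoF_mem
    simp [degMono, add_assoc]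
  | cons i I ih =>
    rw [monoF_cons, hOp_fOp, ← monoF_cons]
    refine Submodule.sub_mem _ ?_ (Submodule.smul_mem _ _ (monoF_mem ?_))
    · have := fOp_monoSpan i _ _ ih
      convert this using 1
      simp only [degMono, List.map_cons, List.sum_cons]
      abel_nf
    · have : degF (i + j + 1) = degH j + degF i := by
        simp only [degF, degH, Prod.mk_add_mk]
        push_cast
        exact Prod.ext (by ring) (by ring)
      simp only [degMono, List.map_cons, List.sum_cons, this]
      abel_nf

theorem eOp_monoSpan (l : ℕ) (γ : ℤ × ℤ) :
    ∀ w ∈ monoSpan M k γ, eOp M k l w ∈ monoSpan M k (degE l + γ) := by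
  refine map_monoSpan fun I J L hd => ?_
  subst hd
  induction I with
  | nil =>
    induction J generalizing l with
    | nil =>
      rw [← monoF_nil_nil_cons]
      apply monoF_mem
      simp [degMono]
    | cons j J ih =>
      rw [monoF_nil_cons, eOp_hOp]
      refine Submodule.sub_mem _ ?_ (Submodule.smul_mem _ _ ?_)
      · have := hOp_monoSpan j _ _ (ih l)
        convert this using 1
        simp only [degMono, List.map_cons, List.sum_cons]
        abel_nf
      · convert ih (l + j + 1) using 1
        have : degE (l + j + 1) = degE l + degH j := by
          simp only [degE, degH, Prod.mk_add_mk]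
          push_cast
          exact Prod.ext (by ring) (by ring)
        simp only [degMono, List.map_cons, List.sum_cons, this]
        abel_nf
  | cons i I ih =>
    rw [monoF_cons, eOp_fOp]
    refine Submodule.add_mem _ ?_ ?_
    · have := fOp_monoSpan i _ _ ih
      convert this using 1
      simp only [degMono, List.map_cons, List.sum_cons]
      abel_nf
    · have := hOp_monoSpan (l + i) _ _ (monoF_mem (M := M) (k := k) (I := I) (J := J) (L := L) rfl)
      convert this using 1
      have : degH (l + i) = degE l + degF i := by
        simp only [degE, degF, degH, Prod.mk_add_mk]
        push_cast
        exact Prod.ext (by ring) (by ring)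
      simp only [degMono, List.map_cons, List.sum_cons, this]
      abel_nf

theorem word_mem_monoSpan (l : List (Fin 2)) :
    word M k l ∈ monoSpan M k ((l.count 0 : ℤ), (l.count 1 : ℤ)) := by
  induction l with
  | nil => exact monoF_mem (I := []) (J := []) (L := []) rfl
  | cons i l ih =>
    rw [count_cons, add_comm]
    fin_cases i
    · exact fOp_monoSpan 0 _ _ ih
    · exact eOp_monoSpan 0 _ _ ih

/-- Every homogeneous component is spanned by ordered monomials of the same degree. -/
theorem component_le_monoSpan (γ : ℤ × ℤ) : component M k γ ≤ monoSpan M k γ := by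
  refine Submodule.span_le.mpr ?_
  rintro _ ⟨l, rfl, rfl⟩
  exact word_mem_monoSpan l

theorem monoF_ext {E : Type*} [AddCommGroup E] [Module ℂ E] {A B : Verma M k →ₗ[ℂ] E}
    (hAB : ∀ I J L, A (monoF M k I J L) = B (monoF M k I J L)) : A = B := by
  apply LinearMap.ext
  intro w
  have hw : w ∈ ⨆ γ, component M k γ := by rw [iSup_component]; trivial
  refine (iSup_le (a := LinearMap.eqLocus A B) fun γ => ?_) hw
  refine (component_le_monoSpan γ).trans (Submodule.span_le.mpr ?_)
  rintro _ ⟨I, J, L, -, rfl⟩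
  exact hAB I J L

theorem degMono_diff (I J L : List ℕ) :
    (degMono I J L).1 - (degMono I J L).2 = (I.length : ℤ) - L.length := by
  have hI : ∀ I : List ℕ, (I.map degF).sum.1 - (I.map degF).sum.2 = I.length := by
    intro I
    induction I with
    | nil => simp
    | cons i I ih =>
      simp only [List.map_cons, List.sum_cons, Prod.fst_add, Prod.snd_add, List.length_cons, degF]
      push_cast
      linarith
  have hJ : ∀ I : List ℕ, (I.map degH).sum.1 - (I.map degH).sum.2 = 0 := by
    intro I
    induction I with
    | nil => simp
    | cons i I ih =>
      simp only [List.map_cons, List.sum_cons, Prod.fst_add, Prod.snd_add, degH]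
      linarith
  have hL : ∀ I : List ℕ, (I.map degE).sum.1 - (I.map degE).sum.2 = -I.length := by
    intro I
    induction I with
    | nil => simp
    | cons i I ih =>
      simp only [List.map_cons, List.sum_cons, Prod.fst_add, Prod.snd_add, List.length_cons, degE]
      push_cast
      linarith
  simp only [degMono, Prod.fst_add, Prod.snd_add]
  linarith [hI I, hJ J, hL L]

end Span

/-! ### The functionals dual to products of the `f / Tⁱ` -/

section DualForm

open Finset

/-- The quotient map of `exists_symbol` from the Verma module to the polynomial ring. -/
def symbol (M k : ℂ) : Verma M k →ₗ[ℂ] MvPolynomial ℕ ℂ := (exists_symbol M k).choose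

variable {M k : ℂ}

theorem symbol_fOp (i : ℕ) (w : Verma M k) :
    symbol M k (fOp M k i w) = MvPolynomial.X i * symbol M k w := by
  obtain ⟨K, -, h2, -⟩ := (exists_symbol M k).choose_spec
  exact h2 i w

theorem symbol_hOp_eOp_monoF (J L : List ℕ) :
    (∀ j, symbol M k (hOp M k j (monoF M k [] J L)) = 0) ∧
    ∀ l, symbol M k (eOp M k l (monoF M k [] J L)) = 0 := by
  obtain ⟨K, -, -, h3, h4, h5⟩ := (exists_symbol M k).choose_spec
  have hL : ∀ L, monoF M k [] [] L ∈ K := by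
    intro L
    induction L with
    | nil => exact h3
    | cons l L ih => exact (h5 l _ ih).1
  have hJ : monoF M k [] J L ∈ K := by
    induction J with
    | nil => exact hL L
    | cons j J ih => exact (h4 j _ ih).1
  exact ⟨fun j => (h4 j _ hJ).2, fun l => (h5 l _ hJ).2⟩

theorem symbol_monoF (I J L : List ℕ) : symbol M k (monoF M k I J L) =
    if J = [] ∧ L = [] then (I.map fun i => (MvPolynomial.X i : MvPolynomial ℕ ℂ)).prod else 0 := by
  induction I with
  | nil =>
    rcases J with _ | ⟨j, J⟩
    · rcases L with _ | ⟨l, L⟩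
      · obtain ⟨K, h1, -⟩ := (exists_symbol M k).choose_spec
        exact h1.trans (by simp)
      · rw [monoF_nil_nil_cons, (symbol_hOp_eOp_monoF [] L).2]; simp
    · rw [monoF_nil_cons, (symbol_hOp_eOp_monoF J L).1]; simp
  | cons i I ih =>
    rw [monoF_cons, symbol_fOp, ih]
    split_ifs <;> simp

/-- The functional on the Verma module dual to the monomial `∏_{i ∈ S} f / Tⁱ v`, in the basis of
monomials in the order `f, h, e`: a coefficient of the symbol. -/
def dualForm (M k : ℂ) (S : Multiset ℕ) : Verma M k →ₗ[ℂ] ℂ :=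
  MvPolynomial.lcoeff ℂ (Multiset.toFinsupp S) ∘ₗ symbol M k

theorem dualForm_apply (S : Multiset ℕ) (w : Verma M k) :
    dualForm M k S w = (symbol M k w).coeff (Multiset.toFinsupp S) := rfl

theorem prod_X_eq (I : List ℕ) : (I.map fun i => (MvPolynomial.X i : MvPolynomial ℕ ℂ)).prod =
    MvPolynomial.monomial (Multiset.toFinsupp (I : Multiset ℕ)) 1 := by
  induction I with
  | nil => simp
  | cons i I ih =>
    rw [List.map_cons, List.prod_cons, ih, ← Multiset.cons_coe, ← Multiset.singleton_add, map_add,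
      Multiset.toFinsupp_singleton, MvPolynomial.X, MvPolynomial.monomial_mul, one_mul]

theorem dualForm_monoF (S : Multiset ℕ) (I J L : List ℕ) : dualForm M k S (monoF M k I J L) =
    if J = [] ∧ L = [] ∧ (I : Multiset ℕ) = S then 1 else 0 := by
  rw [dualForm_apply, symbol_monoF, prod_X_eq]
  by_cases hJ : J = []
  · by_cases hL : L = []
    · simp [hJ, hL, MvPolynomial.coeff_monomial]
    · simp [hL]
  · simp [hJ]

theorem dualForm_fOp (S : Multiset ℕ) (i : ℕ) (w : Verma M k) : dualForm M k S (fOp M k i w) =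
    if i ∈ S then dualForm M k (S.erase i) w else 0 := by
  have hs : i ∈ (Multiset.toFinsupp S).support ↔ i ∈ S := by simp
  rw [dualForm_apply, symbol_fOp, MvPolynomial.coeff_X_mul']
  simp only [hs]
  split_ifs with hi
  · rw [dualForm_apply]
    congr 1
    conv_lhs => rw [← Multiset.cons_erase hi]
    rw [← Multiset.singleton_add, map_add, Multiset.toFinsupp_singleton, add_tsub_cancel_left]
  · rfl

/-- The degree of the monomial `∏_{i ∈ S} f / Tⁱ v`. -/
def degS (S : Multiset ℕ) : ℤ × ℤ := (S.map degF).sum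

theorem dualForm_component (S : Multiset ℕ) {γ : ℤ × ℤ} (hγ : γ ≠ degS S) {w : Verma M k}
    (hw : w ∈ component M k γ) : dualForm M k S w = 0 := by
  refine (Submodule.span_le (p := LinearMap.ker (dualForm M k S))).mpr ?_
    (component_le_monoSpan γ hw)
  rintro _ ⟨I, J, L, rfl, rfl⟩
  rw [SetLike.mem_coe, LinearMap.mem_ker, dualForm_monoF, if_neg]
  rintro ⟨rfl, rfl, rfl⟩
  exact hγ (by simp [degMono, degS])

theorem degS_diff (S : Multiset ℕ) : (degS S).1 - (degS S).2 = S.card := by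
  induction S using Quotient.inductionOn with
  | h I =>
    have := degMono_diff I [] []
    simpa [degMono, degS] using this

theorem dualForm_mem_contra (S : Multiset ℕ) : dualForm M k S ∈ contra M k := by
  refine (Set.finite_singleton (degS S)).subset fun γ hγ => ?_
  by_contra hne
  exact hγ fun w hw => dualForm_component S hne hw

theorem dualForm_zero_fOp (i : ℕ) (w : Verma M k) : dualForm M k 0 (fOp M k i w) = 0 := by
  rw [dualForm_fOp, if_neg (Multiset.notMem_zero i)]

theorem dualForm_zero_hOp (j : ℕ) (w : Verma M k) : dualForm M k 0 (hOp M k j w) = 0 := by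
  refine LinearMap.congr_fun (f := dualForm M k 0 ∘ₗ hOp M k j) (g := 0) (monoF_ext ?_) w
  intro I J L
  rw [LinearMap.comp_apply, LinearMap.zero_apply]
  rcases I with _ | ⟨i, I⟩
  · rw [dualForm_apply, (symbol_hOp_eOp_monoF J L).1, MvPolynomial.coeff_zero]
  · rw [monoF_cons, hOp_fOp, map_sub, map_smul, dualForm_zero_fOp, dualForm_zero_fOp]
    simp

theorem dualForm_zero_eOp (l : ℕ) (w : Verma M k) : dualForm M k 0 (eOp M k l w) = 0 := by
  refine LinearMap.congr_fun (f := dualForm M k 0 ∘ₗ eOp M k l) (g := 0) (monoF_ext ?_) w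
  intro I J L
  rw [LinearMap.comp_apply, LinearMap.zero_apply]
  rcases I with _ | ⟨i, I⟩
  · rw [dualForm_apply, (symbol_hOp_eOp_monoF J L).2, MvPolynomial.coeff_zero]
  · rw [monoF_cons, eOp_fOp, map_add, dualForm_zero_fOp, dualForm_zero_hOp, add_zero]

theorem dualForm_singleton_fOp (a i : ℕ) (w : Verma M k) :
    dualForm M k {a} (fOp M k i w) = if i = a then dualForm M k 0 w else 0 := by
  rw [dualForm_fOp]
  simp only [Multiset.mem_singleton]
  split_ifs with hi
  · rw [hi, Multiset.erase_singleton]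
  · rfl

theorem dualForm_monoF_nil {S : Multiset ℕ} (hS : S ≠ 0) (J L : List ℕ) :
    dualForm M k S (monoF M k [] J L) = 0 := by
  rw [dualForm_monoF, if_neg]
  rintro ⟨-, -, rfl⟩
  exact hS rfl

/-- The transpose of `h / T^{j+1}` on linear coefficients: `h / T^{j+1}` acts on the symbol as the
derivation `xᵢ ↦ -2 x_{i+j+1}`. -/
theorem dualForm_singleton_hOp (a j : ℕ) (w : Verma M k) : dualForm M k {a} (hOp M k j w) =
    if j + 1 ≤ a then -2 * dualForm M k {a - (j + 1)} w else 0 := by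
  have key : dualForm M k {a} ∘ₗ hOp M k j =
      if j + 1 ≤ a then (-2 : ℂ) • dualForm M k {a - (j + 1)} else 0 := by
    apply monoF_ext
    intro I J L
    rw [LinearMap.comp_apply]
    rcases I with _ | ⟨i, I⟩
    · rw [dualForm_apply, (symbol_hOp_eOp_monoF J L).1, MvPolynomial.coeff_zero]
      split_ifs
      · rw [LinearMap.smul_apply, dualForm_monoF_nil (Multiset.singleton_ne_zero _), smul_zero]
      · rfl
    · rw [monoF_cons, hOp_fOp, map_sub, map_smul, dualForm_singleton_fOp, dualForm_singleton_fOp,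
        dualForm_zero_hOp, ite_self, zero_sub]
      split_ifs with h1 h2 h2
      · rw [LinearMap.smul_apply, dualForm_singleton_fOp, if_pos (by omega)]
        simp
      · omega
      · rw [LinearMap.smul_apply, dualForm_singleton_fOp, if_neg (by omega)]
        simp
      · simp
  have := LinearMap.congr_fun key w
  rw [LinearMap.comp_apply] at this
  rw [this]
  split_ifs <;> simp

theorem mem_pairs {s : ℕ} {q : ℕ × ℕ} : q ∈ pairs s ↔ q.1 + q.2 = s ∧ q.2 ≤ q.1 := by
  rw [pairs, mem_filter, Finset.HasAntidiagonal.mem_antidiagonal]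

theorem sum_pairs_dualForm_fOp (s i : ℕ) (w : Verma M k) :
    ∑ q ∈ pairs s, dualForm M k {q.1, q.2} (fOp M k i w) =
      if i ≤ s then dualForm M k {s - i} w else 0 := by
  have hval : ∀ q : ℕ × ℕ, dualForm M k {q.1, q.2} (fOp M k i w) =
      if q.1 = i then dualForm M k {q.2} w else if q.2 = i then dualForm M k {q.1} w else 0 := by
    rintro ⟨a, b⟩
    rw [dualForm_fOp]
    simp only [Multiset.insert_eq_cons, Multiset.mem_cons, Multiset.mem_singleton]
    by_cases h1 : a = i
    · subst h1; simp
    · by_cases h2 : b = i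
      · subst h2
        simp only [or_true, if_true, if_neg h1]
        rw [Multiset.erase_cons_tail _ (by simpa using h1), Multiset.erase_singleton]
        rfl
      · rw [if_neg h1, if_neg h2, if_neg (by rintro (rfl | rfl) <;> simp_all)]
  simp only [hval]
  by_cases hi : i ≤ s
  · rw [if_pos hi]
    by_cases hle : s - i ≤ i
    · rw [Finset.sum_eq_single (i, s - i)]
      · simp
      · rintro ⟨a, b⟩ hab hne
        rw [mem_pairs] at hab
        have h1 : a ≠ i := by
          rintro rfl
          exact hne (Prod.ext rfl (by simp only; omega))
        have h2 : b ≠ i := by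
          rintro rfl
          exact hne (Prod.ext (by simp only; omega) (by simp only; omega))
        simp [h1, h2]
      · intro hmem
        exact absurd (by rw [mem_pairs]; omega) hmem
    · rw [Finset.sum_eq_single (s - i, i)]
      · simp only
        rw [if_neg (by omega)]
        simp
      · rintro ⟨a, b⟩ hab hne
        rw [mem_pairs] at hab
        have h1 : a ≠ i := by
          rintro rfl
          omega
        have h2 : b ≠ i := by
          rintro rfl
          exact hne (Prod.ext (by simp only; omega) rfl)
        simp [h1, h2]
      · intro hmem
        exact absurd (by rw [mem_pairs]; omega) hmem
  · rw [if_neg hi]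
    refine Finset.sum_eq_zero ?_
    rintro ⟨a, b⟩ hab
    rw [mem_pairs] at hab
    simp only
    rw [if_neg (by omega), if_neg (by omega)]

/-- The transpose of `e / T^{l+1}` on linear coefficients: `e / T^{l+1}` acts on the symbol as a second
order operator, and maps both `xᵢ xⱼ` with `i ≠ j` and `xᵢ²` to `-2 x_{i+j+l+1}`. -/
theorem dualForm_singleton_eOp (a l : ℕ) (w : Verma M k) : dualForm M k {a} (eOp M k l w) =
    if l + 1 ≤ a then -2 * ∑ q ∈ pairs (a - (l + 1)), dualForm M k {q.1, q.2} w else 0 := by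
  have key : dualForm M k {a} ∘ₗ eOp M k l =
      if l + 1 ≤ a then (-2 : ℂ) • ∑ q ∈ pairs (a - (l + 1)), dualForm M k {q.1, q.2} else 0 := by
    apply monoF_ext
    intro I J L
    rw [LinearMap.comp_apply]
    rcases I with _ | ⟨i, I⟩
    · rw [dualForm_apply, (symbol_hOp_eOp_monoF J L).2, MvPolynomial.coeff_zero]
      split_ifs
      · rw [LinearMap.smul_apply, LinearMap.sum_apply, Finset.sum_eq_zero, smul_zero]
        intro q _
        exact dualForm_monoF_nil (Multiset.cons_ne_zero) J L
      · rfl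
    · rw [monoF_cons, eOp_fOp, map_add, dualForm_singleton_fOp, dualForm_zero_eOp, ite_self,
        zero_add, dualForm_singleton_hOp]
      by_cases h1 : l + 1 ≤ a
      · rw [if_pos h1, LinearMap.smul_apply, LinearMap.sum_apply, sum_pairs_dualForm_fOp]
        by_cases h2 : l + i + 1 ≤ a
        · rw [if_pos h2, if_pos (by omega), show a - (l + i + 1) = a - (l + 1) - i by omega]
          simp
        · rw [if_neg h2, if_neg (by omega), smul_zero]
      · rw [if_neg h1, if_neg (by omega)]
        simp
  have := LinearMap.congr_fun key w
  rw [LinearMap.comp_apply] at this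
  rw [this]
  split_ifs <;> simp

end DualForm

/-! ### The Sugawara operator -/

section Sugawara

open Finset

variable {M k : ℂ}

/-- Components of negative degree vanish, so `a Tʲ` kills components of degree `p₂ < j`. -/
theorem vermaRep_T_eq_zero {γ : ℤ × ℤ} {w : Verma M k} (hw : w ∈ component M k γ) {j : ℤ}
    (hj : γ.2 < j) (a : Sl2) : vermaRep M k (T j a) w = 0 := by
  have key : ∀ (b : Sl2) (p : ℤ), Shifts M k (T j b) (p, -j) → vermaRep M k (T j b) w = 0 := by
    intro b p hb
    have h1 := hb _ _ hw
    have h2 : component M k (γ + (p, -j)) = ⊥ := by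
      rw [component, Submodule.span_eq_bot]
      rintro x ⟨l, hl, -⟩
      have h3 := congrArg Prod.snd hl
      simp only [Prod.snd_add] at h3
      omega
    rwa [h2, Submodule.mem_bot] at h1
  rw [sl2_eq a]
  simp only [map_add, map_smul, LinearMap.add_apply, LinearMap.smul_apply]
  rw [key e _ (shifts_e j), key h _ (shifts_T_h j), key f _ (shifts_f j)]
  simp

theorem h_word_eq (l : List (Fin 2)) : vermaRep M k (T 0 h) (word M k l) =
    (M - 2 * (l.count 0 - l.count 1)) • word M k l := by
  induction l with
  | nil => simpa [word] using h_vac M k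
  | cons i l ih =>
    have := rep_lie (vermaRep M k) (T 0 h) (chevF i) (word M k l)
    rw [ih, lie_h_chevF, map_smul, map_smul, LinearMap.smul_apply, eq_sub_iff_add_eq,
      ← add_smul] at this
    refine this.symm.trans ?_
    change _ • word M k (i :: l) = _
    congr 1
    fin_cases i <;> simp <;> ring

variable (M k) in
/-- The `l`-th term of the positive part of the Sugawara operator. -/
def sugTerm (l : ℕ) : Module.End ℂ (Verma M k) :=
  fOp M k (l + 1) * vermaRep M k (T (l + 1) e) + eOp M k l * vermaRep M k (T (l + 1) f) +
    (1 / 2 : ℂ) • (hOp M k l * vermaRep M k (T (l + 1) h))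

variable (M k) in
/-- The Casimir operator of `sl₂`, in the form `f e + h / 2 + h² / 4`. -/
def sugZero : Module.End ℂ (Verma M k) :=
  fOp M k 0 * vermaRep M k (T 0 e) + (1 / 2 : ℂ) • vermaRep M k (T 0 h) +
    (1 / 4 : ℂ) • (vermaRep M k (T 0 h) * vermaRep M k (T 0 h))

variable (M k) in
/-- The truncation to `N` terms of the Sugawara operator
`(f e + h / 2 + h² / 4) + ∑_{l ≥ 1} (f/Tˡ eTˡ + e/Tˡ fTˡ + (1/2) h/Tˡ hTˡ)`. -/
def sug (N : ℕ) : Module.End ℂ (Verma M k) := ∑ l ∈ range N, sugTerm M k l + sugZero M k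

theorem sugTerm_apply (l : ℕ) (w : Verma M k) : sugTerm M k l w =
    fOp M k (l + 1) (vermaRep M k (T (l + 1) e) w) + eOp M k l (vermaRep M k (T (l + 1) f) w) +
    (1 / 2 : ℂ) • hOp M k l (vermaRep M k (T (l + 1) h) w) := rfl

theorem sugZero_apply (w : Verma M k) : sugZero M k w =
    fOp M k 0 (vermaRep M k (T 0 e) w) + (1 / 2 : ℂ) • vermaRep M k (T 0 h) w +
    (1 / 4 : ℂ) • vermaRep M k (T 0 h) (vermaRep M k (T 0 h) w) := rfl

theorem sug_apply (N : ℕ) (w : Verma M k) :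
    sug M k N w = ∑ l ∈ range N, sugTerm M k l w + sugZero M k w := by
  rw [sug, LinearMap.add_apply, LinearMap.sum_apply]

theorem lie_f_e : ⁅f, e⁆ = -h := by rw [← lie_skew, lie_e_f]

theorem form_f_e : form f e = 1 := by
  rw [form_apply, f_val, e_val, Matrix.trace_fin_two]; simp

theorem form_h_e : form h e = 0 := by
  rw [form_apply, h_val, e_val, Matrix.trace_fin_two]; simp

theorem form_h_f : form h f = 0 := by
  rw [form_apply, h_val, f_val, Matrix.trace_fin_two]; simp

theorem pos_e_fOp (i : ℤ) (hi : i ≠ 0) (w : Verma M k) :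
    vermaRep M k (T i e) (fOp M k 0 w) =
      fOp M k 0 (vermaRep M k (T i e) w) + vermaRep M k (T i h) w := by
  refine (vermaRep_T_T _ _ e f (by simpa using hi) w).trans ?_
  rw [lie_e_f, Nat.cast_zero, neg_zero, add_zero]
  rfl

theorem pos_f_fOp (i : ℤ) (w : Verma M k) :
    vermaRep M k (T i f) (fOp M k 0 w) = fOp M k 0 (vermaRep M k (T i f) w) := by
  have := rep_lie (vermaRep M k) (T i f) (T (-((0 : ℕ) : ℤ)) f) w
  rw [T_f_lie_T_f, map_zero, LinearMap.zero_apply] at this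
  exact (sub_eq_zero.mp this.symm)

theorem h_fOp (i : ℤ) (w : Verma M k) :
    vermaRep M k (T i h) (fOp M k 0 w) =
      fOp M k 0 (vermaRep M k (T i h) w) - (2 : ℂ) • vermaRep M k (T i f) w := by
  have := rep_lie (vermaRep M k) (T i h) (T (-((0 : ℕ) : ℤ)) f) w
  rw [T_lie_T, form_h_f, lie_h_f, mul_zero, ite_self, zero_smul, add_zero, map_smul, map_smul,
    LinearMap.smul_apply, Nat.cast_zero, neg_zero, add_zero, eq_sub_iff_add_eq] at this
  change vermaRep M k (T i h) (vermaRep M k (T 0 f) w) = _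
  rw [← this, neg_smul]
  change _ = vermaRep M k (T 0 f) _ - _
  abel

theorem e_eOp (i : ℤ) (w : Verma M k) :
    vermaRep M k (T i e) (eOp M k 0 w) = eOp M k 0 (vermaRep M k (T i e) w) := by
  have hee : form e e = 0 := by
    rw [form_apply, e_val, Matrix.trace_fin_two]; simp
  have := rep_lie (vermaRep M k) (T i e) (T (-(((0 : ℕ) : ℤ) + 1)) e) w
  rw [T_lie_T, hee, lie_self, map_zero, mul_zero, ite_self, zero_smul, add_zero, map_zero,
    LinearMap.zero_apply] at this
  exact (sub_eq_zero.mp this.symm)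

theorem h_eOp (i : ℤ) (w : Verma M k) :
    vermaRep M k (T (i + 1) h) (eOp M k 0 w) =
      eOp M k 0 (vermaRep M k (T (i + 1) h) w) + (2 : ℂ) • vermaRep M k (T i e) w := by
  have := rep_lie (vermaRep M k) (T (i + 1) h) (T (-(((0 : ℕ) : ℤ) + 1)) e) w
  rw [T_lie_T, form_h_e, lie_h_e, mul_zero, ite_self, zero_smul, add_zero, map_smul, map_smul,
    LinearMap.smul_apply, Nat.cast_zero, zero_add, add_neg_cancel_right, eq_sub_iff_add_eq] at this
  change vermaRep M k (T (i + 1) h) (vermaRep M k (T (-(((0 : ℕ) : ℤ) + 1)) e) w) = _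
  rw [Nat.cast_zero, zero_add, ← this, add_comm]
  rfl

theorem f_eOp (i : ℕ) (w : Verma M k) :
    vermaRep M k (T (i + 1) f) (eOp M k 0 w) =
      eOp M k 0 (vermaRep M k (T (i + 1) f) w) - vermaRep M k (T i h) w +
        (if i = 0 then k else 0) • w := by
  have := rep_lie (vermaRep M k) (T (i + 1) f) (T (-(((0 : ℕ) : ℤ) + 1)) e) w
  rw [T_lie_T, form_f_e, lie_f_e, map_add, map_smul, LinearMap.add_apply, LinearMap.smul_apply,
    vermaRep_c, Nat.cast_zero, zero_add, add_neg_cancel_right, eq_sub_iff_add_eq, map_neg, map_neg,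
    LinearMap.neg_apply, smul_smul] at this
  change vermaRep M k (T (i + 1) f) (vermaRep M k (T (-(((0 : ℕ) : ℤ) + 1)) e) w) = _
  rw [Nat.cast_zero, zero_add, ← this]
  have hk : (if (i : ℤ) = 0 then (((i : ℤ) + 1 : ℤ) : ℂ) * 1 else 0) * k =
      if i = 0 then k else 0 := by
    rcases i with _ | i
    · simp
    · rw [if_neg (by omega), if_neg (by omega), zero_mul]
  rw [hk]
  change _ = vermaRep M k (T (-(((0 : ℕ) : ℤ) + 1)) e) _ - _ + _
  rw [Nat.cast_zero, zero_add]
  abel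

theorem sug_fOp (N : ℕ) (w : Verma M k) : sug M k N (fOp M k 0 w) = fOp M k 0 (sug M k N w) := by
  have hterm : ∀ l, sugTerm M k l (fOp M k 0 w) = fOp M k 0 (sugTerm M k l w) := by
    intro l
    rw [sugTerm_apply, sugTerm_apply, pos_e_fOp _ (by omega), pos_f_fOp, h_fOp]
    simp only [map_add, map_sub, map_smul]
    rw [fOp_fOp _ _ (l + 1) 0, eOp_fOp _ _ l 0, hOp_fOp _ _ l 0, add_zero, zero_add]
    module
  have hzero : sugZero M k (fOp M k 0 w) = fOp M k 0 (sugZero M k w) := by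
    have h1 : vermaRep M k (T 0 e) (fOp M k 0 w) =
        fOp M k 0 (vermaRep M k (T 0 e) w) + vermaRep M k (T 0 h) w := by
      have := rep_lie (vermaRep M k) (T 0 e) (T (-((0 : ℕ) : ℤ)) f) w
      rw [T_lie_T, lie_e_f, Int.cast_zero, zero_mul, ite_self, zero_smul, add_zero,
        eq_sub_iff_add_eq, Nat.cast_zero, neg_zero, add_zero] at this
      change vermaRep M k (T 0 e) (vermaRep M k (T 0 f) w) = _
      rw [← this, add_comm]
      rfl
    have h2 : ∀ u, vermaRep M k (T 0 f) u = fOp M k 0 u := fun u => rfl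
    rw [sugZero_apply, sugZero_apply, h1]
    simp only [h_fOp, map_add, map_sub, map_smul, h2]
    module
  rw [sug_apply, sug_apply, map_add, map_sum, hzero]
  simp only [hterm]

/-- The commutator of the truncated Sugawara operator with `e / T` is `k + 2` times `e / T`, up to the
end terms of a telescoping sum. -/
theorem sug_eOp (N : ℕ) (w : Verma M k) : sug M k (N + 1) (eOp M k 0 w) =
    eOp M k 0 (sug M k (N + 1) w) + (k + 2) • eOp M k 0 w +
      (eOp M k (N + 1) (vermaRep M k (T (N + 1) h) w) -
        hOp M k (N + 1) (vermaRep M k (T (N + 1) e) w)) := by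
  -- The telescoping terms.
  let G : ℕ → Verma M k := fun l =>
    eOp M k l (vermaRep M k (T l h) w) - hOp M k l (vermaRep M k (T l e) w)
  have hterm : ∀ l : ℕ, sugTerm M k l (eOp M k 0 w) = eOp M k 0 (sugTerm M k l w) +
      ((G (l + 1) - G l) + (if l = 0 then k else 0) • eOp M k l w) := by
    intro l
    have h1 : ∀ u, fOp M k (l + 1) (eOp M k 0 u) =
        eOp M k 0 (fOp M k (l + 1) u) - hOp M k (l + 1) u := by
      intro u
      rw [eOp_fOp, zero_add, add_sub_cancel_right]
    have h2 : ∀ u, hOp M k l (eOp M k 0 u) =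
        eOp M k 0 (hOp M k l u) + (2 : ℂ) • eOp M k (l + 1) u := by
      intro u
      rw [eOp_hOp, zero_add, sub_add_cancel]
    simp only [G]
    rw [sugTerm_apply, sugTerm_apply, e_eOp, f_eOp, h_eOp]
    simp only [map_add, map_sub, map_smul, h1, h2, eOp_eOp _ _ l 0]
    push_cast
    module
  have hzero : sugZero M k (eOp M k 0 w) =
      eOp M k 0 (sugZero M k w) + (2 : ℂ) • eOp M k 0 w + G 0 := by
    have h1 : ∀ u, fOp M k 0 (eOp M k 0 u) = eOp M k 0 (fOp M k 0 u) - hOp M k 0 u := by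
      intro u
      rw [eOp_fOp, zero_add, add_sub_cancel_right]
    have h2 : ∀ u, vermaRep M k (T 0 h) (eOp M k 0 u) =
        eOp M k 0 (vermaRep M k (T 0 h) u) + (2 : ℂ) • eOp M k 0 u := by
      intro u
      have := h_eOp (-1) u
      rwa [neg_add_cancel] at this
    simp only [G]
    rw [sugZero_apply, sugZero_apply, e_eOp]
    simp only [map_add, map_smul, h1, h2, Nat.cast_zero]
    module
  rw [sug_apply, sug_apply, hzero]
  simp only [hterm, sum_add_distrib, sum_range_sub, map_add, map_sum]
  have hk : ∑ l ∈ range (N + 1), (if l = 0 then k else 0) • eOp M k l w = k • eOp M k 0 w := by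
    rw [Finset.sum_eq_single 0]
    · rw [if_pos rfl]
    · intro l _ hl
      rw [if_neg hl, zero_smul]
    · intro h0
      exact absurd (mem_range.mpr (Nat.succ_pos N)) h0
  rw [hk]
  simp only [G]
  push_cast
  module

/-- The Sugawara operator acts on a vector of degree `(p₁, p₂)` as the scalar
`M / 2 + M² / 4 + (k + 2) p₂`. -/
theorem sug_word (l : List (Fin 2)) : ∀ N : ℕ, l.count 1 ≤ N → sug M k N (word M k l) =
    (M / 2 + M ^ 2 / 4 + (k + 2) * l.count 1) • word M k l := by
  induction l with
  | nil =>
    intro N _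
    have h1 : ∀ (j : ℤ) (a : Sl2), 0 < j → vermaRep M k (T j a) (word M k []) = 0 := fun j a hj =>
      vermaRep_T_eq_zero (word_mem []) (by simpa using hj) a
    have h2 : vermaRep M k (T 0 e) (word M k []) = 0 := chevE_vac M k 0
    rw [sug_apply, Finset.sum_eq_zero, zero_add, sugZero_apply, h2, h_word_eq]
    · simp only [map_smul, map_zero, h_word_eq, List.count_nil, Nat.cast_zero]
      module
    · intro l _
      rw [sugTerm_apply, h1 _ _ (by omega), h1 _ _ (by omega), h1 _ _ (by omega)]
      simp
  | cons i l ih =>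
    intro N hN
    fin_cases i
    · change sug M k N (fOp M k 0 (word M k l)) = _
      rw [sug_fOp, ih N (by simpa using hN), map_smul]
      simp
      rfl
    · change sug M k N (eOp M k 0 (word M k l)) = _
      simp only [List.count_cons] at hN
      simp at hN
      obtain ⟨N, rfl⟩ : ∃ N', N = N' + 1 := ⟨N - 1, by omega⟩
      rw [sug_eOp, ih (N + 1) (by omega), vermaRep_T_eq_zero (word_mem l) (by simp only; omega),
        vermaRep_T_eq_zero (word_mem l) (by simp only; omega), map_zero, map_zero, sub_zero,
        add_zero, map_smul, ← add_smul]
      change _ • word M k (1 :: l) = _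
      congr 1
      simp
      ring

theorem word_ext {E : Type*} [AddCommGroup E] [Module ℂ E] {A B : Verma M k →ₗ[ℂ] E}
    (hAB : ∀ l, A (word M k l) = B (word M k l)) : A = B := by
  apply LinearMap.ext
  intro w
  have hw : w ∈ ⨆ γ, component M k γ := by rw [iSup_component]; trivial
  refine (iSup_le (a := LinearMap.eqLocus A B) fun γ => ?_) hw
  refine Submodule.span_le.mpr ?_
  rintro _ ⟨l, -, rfl⟩
  exact hAB l

theorem sum_range_ite_le {N b : ℕ} (hb : b ≤ N) (g : ℕ → ℂ) :
    ∑ l ∈ range N, (if l + 1 ≤ b then g l else 0) = ∑ l ∈ range b, g l := by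
  rw [← Finset.sum_filter]
  refine Finset.sum_congr ?_ fun _ _ => rfl
  ext l
  simp only [mem_filter, mem_range]
  omega

/-- The functional dual to `(f / Tᵇ) v` applied to the Sugawara operator: the terms `f / Tˡ eTˡ` only
contribute for `l = b`, and the other terms are rewritten by the transposes of `h / Tˡ` and
`e / Tˡ`. -/
theorem dualForm_sugawara (b : ℕ) (w : Verma M k) :
    dualForm M k 0 (vermaRep M k (T b e) w) -
      ∑ l ∈ range b, (2 * ∑ q ∈ pairs (b - (l + 1)),
          dualForm M k {q.1, q.2} (vermaRep M k (T (l + 1) f) w) +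
        dualForm M k {b - (l + 1)} (vermaRep M k (T (l + 1) h) w)) =
      (M + b * (k + 2)) * dualForm M k {b} w := by
  have key : dualForm M k 0 ∘ₗ vermaRep M k (T b e) -
      ∑ l ∈ range b, ((2 : ℂ) • ∑ q ∈ pairs (b - (l + 1)),
          dualForm M k {q.1, q.2} ∘ₗ vermaRep M k (T (l + 1) f) +
        dualForm M k {b - (l + 1)} ∘ₗ vermaRep M k (T (l + 1) h)) =
      (M + b * (k + 2)) • dualForm M k {b} := by
    apply word_ext
    intro l
    set w := word M k l with hw
    set N := max b (l.count 1) with hN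
    have h1 := congrArg (dualForm M k {b}) (sug_word (M := M) (k := k) l N (le_max_right _ _))
    rw [← hw, sug_apply, map_add, map_sum, map_smul, smul_eq_mul, sugZero_apply] at h1
    simp only [sugTerm_apply, map_add, map_smul, dualForm_singleton_fOp, dualForm_singleton_eOp,
      dualForm_singleton_hOp, sum_add_distrib, smul_eq_mul, hw, h_word_eq] at h1
    rw [← hw, sum_range_ite_le (le_max_left _ _), ← Finset.mul_sum, ← Finset.mul_sum,
      sum_range_ite_le (le_max_left _ _), ← Finset.mul_sum] at h1
    -- Among the terms `f / Tˡ eTˡ`, `l ≥ 0`, only the one with `l = b` survives.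
    have h2 : (∑ l ∈ range N, if l + 1 = b then
        dualForm M k 0 (vermaRep M k (T ((l : ℤ) + 1) e) w) else 0) +
        (if 0 = b then dualForm M k 0 (vermaRep M k (T 0 e) w) else 0) =
        dualForm M k 0 (vermaRep M k (T b e) w) := by
      rcases b with _ | b
      · rw [if_pos rfl, Finset.sum_eq_zero, zero_add]
        · rfl
        · intro l _
          rw [if_neg (by omega)]
      · rw [if_neg (by omega), add_zero, Finset.sum_eq_single b]
        · rw [if_pos rfl]; norm_cast
        · intro l _ hl
          rw [if_neg (by omega)]
        · intro hb
          exact absurd (mem_range.mpr (lt_of_lt_of_le (Nat.lt_succ_self b) (le_max_left _ _))) hb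
    -- The scalar of `sug_word` minus that of `h / 2 + h² / 4`: both sides vanish unless the degree of
    -- the word is `(b + 1, b)`.
    have h3 : (M / 2 + M ^ 2 / 4 + (k + 2) * (l.count 1)
        - 1 / 2 * (M - 2 * (l.count 0 - l.count 1))
        - 1 / 4 * ((M - 2 * (l.count 0 - l.count 1)) * (M - 2 * (l.count 0 - l.count 1)))) *
        dualForm M k {b} w = (M + b * (k + 2)) * dualForm M k {b} w := by
      by_cases hγ : ((l.count 0 : ℤ), (l.count 1 : ℤ)) = degS {b}
      · simp only [degS, degF, Multiset.map_singleton, Multiset.sum_singleton, Prod.mk.injEq] at hγ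
        have e0 : (l.count 0 : ℂ) = b + 1 := by exact_mod_cast hγ.1
        have e1 : (l.count 1 : ℂ) = b := by exact_mod_cast hγ.2
        rw [e0, e1]
        ring
      · rw [dualForm_component {b} hγ (word_mem l), mul_zero, mul_zero]
    simp only [LinearMap.sub_apply, LinearMap.sum_apply, LinearMap.add_apply, LinearMap.smul_apply,
      LinearMap.comp_apply, smul_eq_mul, sum_add_distrib, ← Finset.mul_sum] at h1 ⊢
    linear_combination h1 + h3 - h2
  have := LinearMap.congr_fun key w
  simpa only [LinearMap.sub_apply, LinearMap.sum_apply, LinearMap.add_apply, LinearMap.smul_apply,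
      LinearMap.comp_apply, smul_eq_mul] using this

end Sugawara

/-! ### The diagram automorphism -/

section Diagram

/-- The linear map underlying the diagram automorphism. -/
def diagramLin : Affine →ₗ[ℂ] Affine :=
  affineLift (fun i =>
    { toFun := fun a => a.val 0 1 • T (i + 1) f + a.val 1 0 • T (i - 1) e +
        a.val 0 0 • ((if i = 0 then c else 0) - T i h)
      map_add' := fun a b => by
        rw [show (a + b).val = a.val + b.val from rfl]
        simp only [Matrix.add_apply]
        module
      map_smul' := fun r a => by
        rw [show (r • a).val = r • a.val from rfl]
        simp only [Matrix.smul_apply, smul_eq_mul, RingHom.id_apply]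
        module }) c

theorem diagramLin_T (i : ℤ) (a : Sl2) : diagramLin (T i a) =
    a.val 0 1 • T (i + 1) f + a.val 1 0 • T (i - 1) e +
      a.val 0 0 • ((if i = 0 then c else 0) - T i h) :=
  affineLift_T _ _ _ _

theorem diagramLin_e (i : ℤ) : diagramLin (T i e) = T (i + 1) f := by
  rw [diagramLin_T, e_val]; simp

theorem diagramLin_f (i : ℤ) : diagramLin (T i f) = T (i - 1) e := by
  rw [diagramLin_T, f_val]; simp

theorem diagramLin_h (i : ℤ) : diagramLin (T i h) = (if i = 0 then c else 0) - T i h := by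
  rw [diagramLin_T, h_val]; simp

theorem diagramLin_c : diagramLin c = c := affineLift_c _ _

theorem form_e_e : form e e = 0 := by
  rw [form_apply, e_val, Matrix.trace_fin_two]; simp

/-- The linear combination of `e`, `h`, `f` that a traceless matrix is. -/
theorem sl2_induction {P : Sl2 → Prop} (he : P e) (hh : P h) (hf : P f)
    (hadd : ∀ a b, P a → P b → P (a + b)) (hsmul : ∀ (r : ℂ) a, P a → P (r • a)) (a : Sl2) :
    P a := by
  rw [sl2_eq a]
  exact hadd _ _ (hadd _ _ (hsmul _ _ he) (hsmul _ _ hh)) (hsmul _ _ hf)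

theorem diagramLin_lie_skew {x y : Affine}
    (hxy : diagramLin ⁅x, y⁆ = ⁅diagramLin x, diagramLin y⁆) :
    diagramLin ⁅y, x⁆ = ⁅diagramLin y, diagramLin x⁆ := by
  rw [← lie_skew, map_neg, hxy, lie_skew]

/-- The diagram automorphism of the affine Lie algebra that exchanges the two nodes:
`f Tⁱ ↦ e Tⁱ⁻¹`, `e Tⁱ ↦ f Tⁱ⁺¹`, `h Tⁱ ↦ δ_{i,0} c - h Tⁱ`, `c ↦ c`. -/
def diagram : Affine →ₗ⁅ℂ⁆ Affine where
  toLinearMap := diagramLin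
  map_lie' {x y} := by
    change diagramLin ⁅x, y⁆ = ⁅diagramLin x, diagramLin y⁆
    have hc : ∀ x, diagramLin ⁅c, x⁆ = ⁅diagramLin c, diagramLin x⁆ := by
      intro x; rw [diagramLin_c, c_lie, c_lie, map_zero]
    have hite : ∀ (i : ℤ) (x : Affine), ⁅(if i = 0 then c else 0), x⁆ = 0 := by
      intro i x; split_ifs <;> simp [c_lie]
    have hite' : ∀ (i : ℤ) (x : Affine), ⁅x, (if i = 0 then c else 0)⁆ = 0 := by
      intro i x; split_ifs <;> simp [lie_c]
    have hee : ∀ i j, diagramLin ⁅T i e, T j e⁆ = ⁅diagramLin (T i e), diagramLin (T j e)⁆ := by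
      intro i j
      rw [diagramLin_e, diagramLin_e, T_f_lie_T_f, T_lie_T, form_e_e]
      simp
    have hff : ∀ i j, diagramLin ⁅T i f, T j f⁆ = ⁅diagramLin (T i f), diagramLin (T j f)⁆ := by
      intro i j
      rw [diagramLin_f, diagramLin_f, T_f_lie_T_f, T_lie_T, form_e_e]
      simp
    have hhh : ∀ i j, diagramLin ⁅T i h, T j h⁆ = ⁅diagramLin (T i h), diagramLin (T j h)⁆ := by
      intro i j
      rw [diagramLin_h, diagramLin_h, sub_lie, lie_sub, lie_sub, hite, hite, hite', T_lie_T, lie_self,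
        map_zero, zero_add, map_smul, diagramLin_c]
      simp
    have hhe : ∀ i j, diagramLin ⁅T i h, T j e⁆ = ⁅diagramLin (T i h), diagramLin (T j e)⁆ := by
      intro i j
      rw [diagramLin_h, diagramLin_e, sub_lie, hite, T_lie_T, T_lie_T, form_h_e, form_h_f, lie_h_e,
        lie_h_f]
      simp [diagramLin_e, add_assoc]
    have hhf : ∀ i j, diagramLin ⁅T i h, T j f⁆ = ⁅diagramLin (T i h), diagramLin (T j f)⁆ := by
      intro i j
      rw [diagramLin_h, diagramLin_f, sub_lie, hite, T_lie_T, T_lie_T, form_h_e, form_h_f, lie_h_e,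
        lie_h_f]
      simp [diagramLin_f, add_sub_assoc]
    have hef : ∀ i j, diagramLin ⁅T i e, T j f⁆ = ⁅diagramLin (T i e), diagramLin (T j f)⁆ := by
      intro i j
      have h1 : form e f = 1 := by rw [form_symm, form_f_e]
      rw [diagramLin_e, diagramLin_f, T_lie_T, T_lie_T, form_f_e, h1, lie_e_f, lie_f_e, map_add,
        map_smul, diagramLin_c, diagramLin_h, show i + 1 + (j - 1) = i + j by ring, map_neg]
      split_ifs
      · push_cast
        module
      · module
    induction x using affine_induction with
    | h0 => simp
    | hadd x x' hx hx' => simp only [map_add, add_lie, hx, hx']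
    | hsmul r x hx => simp only [map_smul, smul_lie, hx]
    | hc => exact hc y
    | hT i a =>
      induction y using affine_induction with
      | h0 => simp
      | hadd y y' hy hy' => simp only [map_add, lie_add, hy, hy']
      | hsmul r y hy => simp only [map_smul, lie_smul, hy]
      | hc => exact diagramLin_lie_skew (hc _)
      | hT j b =>
        induction a using sl2_induction with
        | hadd a a' ha ha' => simp only [map_add, add_lie, ha, ha']
        | hsmul r a ha => simp only [map_smul, smul_lie, ha]
        | he =>
          induction b using sl2_induction with
          | hadd b b' hb hb' => simp only [map_add, lie_add, hb, hb']
          | hsmul r b hb => simp only [map_smul, lie_smul, hb]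
          | he => exact hee i j
          | hh => exact diagramLin_lie_skew (hhe j i)
          | hf => exact hef i j
        | hh =>
          induction b using sl2_induction with
          | hadd b b' hb hb' => simp only [map_add, lie_add, hb, hb']
          | hsmul r b hb => simp only [map_smul, lie_smul, hb]
          | he => exact hhe i j
          | hh => exact hhh i j
          | hf => exact hhf i j
        | hf =>
          induction b using sl2_induction with
          | hadd b b' hb hb' => simp only [map_add, lie_add, hb, hb']
          | hsmul r b hb => simp only [map_smul, lie_smul, hb]
          | he => exact diagramLin_lie_skew (hef j i)
          | hh => exact diagramLin_lie_skew (hhf j i)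
          | hf => exact hff i j

theorem diagram_e (i : ℤ) : diagram (T i e) = T (i + 1) f := diagramLin_e i

theorem diagram_f (i : ℤ) : diagram (T i f) = T (i - 1) e := diagramLin_f i

theorem diagram_h {i : ℤ} (hi : i ≠ 0) : diagram (T i h) = -T i h := by
  refine (diagramLin_h i).trans ?_
  rw [if_neg hi, zero_sub]

/-- `τ` is the isomorphism of Verma modules `V(M, M') → V(M', M)` over the diagram automorphism that
maps the generating vector to the generating vector. -/
def IsSwap {M M' k : ℂ} (τ : Verma M k →ₗ[ℂ] Verma M' k) : Prop :=
  τ (vac M k) = vac M' k ∧ ∀ x w, τ (vermaRep M k x w) = vermaRep M' k (diagram x) (τ w)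

theorem exists_isSwap {M M' k : ℂ} (hM : M + M' = k) :
    ∃ τ : Verma M k →ₗ[ℂ] Verma M' k, IsSwap τ := by
  refine exists_vermaLift ((vermaRep M' k).comp diagram) (vac M' k) ?_ ?_ ?_
  · intro i
    fin_cases i
    · change vermaRep M' k (diagramLin (T 0 e)) _ = 0
      rw [diagramLin_e]
      exact chevE_vac M' k 1
    · change vermaRep M' k (diagramLin (T 1 f)) _ = 0
      rw [diagramLin_f]
      exact chevE_vac M' k 0
  · change vermaRep M' k (diagramLin (T 0 h)) _ = _
    rw [diagramLin_h, if_pos rfl, h2_vac]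
    congr 1
    linear_combination -hM
  · change vermaRep M' k (diagramLin c) _ = _
    rw [diagramLin_c, c_vac]

variable {M M' k : ℂ} {τ : Verma M k →ₗ[ℂ] Verma M' k}

theorem IsSwap.map_fOp (hτ : IsSwap τ) (i : ℕ) (w : Verma M k) :
    τ (fOp M k i w) = eOp M' k i (τ w) := by
  refine (hτ.2 _ w).trans ?_
  rw [diagram_f, show -(i : ℤ) - 1 = -((i : ℤ) + 1) by ring]
  rfl

theorem IsSwap.map_eOp (hτ : IsSwap τ) (l : ℕ) (w : Verma M k) :
    τ (eOp M k l w) = fOp M' k l (τ w) := by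
  refine (hτ.2 _ w).trans ?_
  rw [diagram_e, show -((l : ℤ) + 1) + 1 = -(l : ℤ) by ring]
  rfl

theorem IsSwap.map_hOp (hτ : IsSwap τ) (j : ℕ) (w : Verma M k) :
    τ (hOp M k j w) = -hOp M' k j (τ w) := by
  refine (hτ.2 _ w).trans ?_
  rw [diagram_h (by omega), map_neg]
  rfl

theorem IsSwap.map_component (hτ : IsSwap τ) {γ : ℤ × ℤ} {w : Verma M k}
    (hw : w ∈ component M k γ) : τ w ∈ component M' k γ.swap := by
  have hword : ∀ l : List (Fin 2), ∃ l' : List (Fin 2),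
      l'.count 0 = l.count 1 ∧ l'.count 1 = l.count 0 ∧ τ (word M k l) = word M' k l' := by
    intro l
    induction l with
    | nil => exact ⟨[], rfl, rfl, hτ.1⟩
    | cons i l ih =>
      obtain ⟨l', h0, h1, hl⟩ := ih
      fin_cases i
      · refine ⟨1 :: l', ?_, ?_, (hτ.map_fOp 0 _).trans ?_⟩
        · simpa using h0
        · simpa using h1
        · exact congrArg (eOp M' k 0) hl
      · refine ⟨0 :: l', ?_, ?_, (hτ.map_eOp 0 _).trans ?_⟩
        · simpa using h0
        · simpa using h1
        · exact congrArg (fOp M' k 0) hl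
  refine (Submodule.span_le (p := (component M' k γ.swap).comap τ)).mpr ?_ hw
  rintro _ ⟨l, rfl, rfl⟩
  obtain ⟨l', h0, h1, hl⟩ := hword l
  rw [SetLike.mem_coe, Submodule.mem_comap, hl]
  exact Submodule.subset_span ⟨l', by rw [h0, h1]; rfl, rfl⟩

theorem IsSwap.comp (hτ : IsSwap τ) {σ : Verma M' k →ₗ[ℂ] Verma M k} (hσ : IsSwap σ)
    (w : Verma M k) : σ (τ w) = w := by
  refine LinearMap.congr_fun (f := σ ∘ₗ τ) (g := LinearMap.id) (word_ext fun l => ?_) w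
  rw [LinearMap.comp_apply, LinearMap.id_apply]
  induction l with
  | nil => exact (congrArg σ hτ.1).trans hσ.1
  | cons i l ih =>
    fin_cases i
    · change σ (τ (fOp M k 0 (word M k l))) = fOp M k 0 (word M k l)
      rw [hτ.map_fOp, hσ.map_eOp, ih]
    · change σ (τ (eOp M k 0 (word M k l))) = eOp M k 0 (word M k l)
      rw [hτ.map_eOp, hσ.map_fOp, ih]

end Diagram

/-! ### The dual basis -/

section DualBasis

variable (M k : ℂ)

/-- The monomial `∏ e / T^{l+1} ∏ h / T^{j+1} ∏ f / Tⁱ v`, where `i, j, l` run through three lists. -/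
def monoE (I J L : List ℕ) : Verma M k :=
  L.foldr (fun l w => eOp M k l w)
    (J.foldr (fun j w => hOp M k j w) (I.foldr (fun i w => fOp M k i w) (vac M k)))

variable {M k}

theorem IsSwap.map_monoF {M' : ℂ} {τ : Verma M k →ₗ[ℂ] Verma M' k} (hτ : IsSwap τ) (I J L : List ℕ) :
    τ (monoF M k I J L) = (-1 : ℂ) ^ J.length • monoE M' k L J I := by
  induction I with
  | nil =>
    induction J with
    | nil =>
      rw [List.length_nil, pow_zero, one_smul]
      induction L with
      | nil => exact hτ.1
      | cons l L ih => exact (hτ.map_eOp l _).trans (congrArg (fOp M' k l) ih)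
    | cons j J ih =>
      refine (hτ.map_hOp j _).trans ?_
      rw [show List.foldr _ _ J = monoF M k [] J L from rfl, ih, map_smul,
        List.length_cons, pow_succ', mul_smul, neg_one_smul]
      rfl
  | cons i I ih =>
    refine (hτ.map_fOp i _).trans ?_
    rw [show List.foldr _ _ I = monoF M k I J L from rfl, ih, map_smul]
    rfl

theorem IsSwap.map_monoE {M' : ℂ} {τ : Verma M k →ₗ[ℂ] Verma M' k} (hτ : IsSwap τ) (I J L : List ℕ) :
    τ (monoE M k I J L) = (-1 : ℂ) ^ J.length • monoF M' k L J I := by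
  induction L with
  | nil =>
    induction J with
    | nil =>
      rw [List.length_nil, pow_zero, one_smul]
      induction I with
      | nil => exact hτ.1
      | cons i I ih => exact (hτ.map_fOp i _).trans (congrArg (eOp M' k i) ih)
    | cons j J ih =>
      refine (hτ.map_hOp j _).trans ?_
      rw [show List.foldr _ _ J = monoE M k I J [] from rfl, ih, map_smul,
        List.length_cons, pow_succ', mul_smul, neg_one_smul]
      rfl
  | cons l L ih =>
    refine (hτ.map_eOp l _).trans ?_
    rw [show List.foldr _ _ L = monoE M k I J L from rfl, ih, map_smul]
    rfl

theorem fOp_shifts {γ : ℤ × ℤ} {w : Verma M k} (i : ℕ) (hw : w ∈ component M k γ) :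
    fOp M k i w ∈ component M k (γ + degF i) := by
  have := shifts_f (M := M) (k := k) (-(i : ℤ)) _ _ hw
  rwa [neg_neg] at this

theorem hOp_shifts {γ : ℤ × ℤ} {w : Verma M k} (j : ℕ) (hw : w ∈ component M k γ) :
    hOp M k j w ∈ component M k (γ + degH j) := by
  have := shifts_T_h (M := M) (k := k) (-((j : ℤ) + 1)) _ _ hw
  rwa [neg_neg] at this

theorem eOp_shifts {γ : ℤ × ℤ} {w : Verma M k} (l : ℕ) (hw : w ∈ component M k γ) :
    eOp M k l w ∈ component M k (γ + degE l) := by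
  have := shifts_e (M := M) (k := k) (-((l : ℤ) + 1)) _ _ hw
  rwa [neg_neg, add_sub_cancel_right] at this

theorem exists_component_monoF (I J L : List ℕ) : ∃ γ : ℤ × ℤ,
    γ.1 - γ.2 = (I.length : ℤ) - L.length ∧ monoF M k I J L ∈ component M k γ := by
  induction I with
  | cons i I ih =>
    obtain ⟨γ, hγ, hw⟩ := ih
    refine ⟨_, ?_, fOp_shifts i hw⟩
    simp only [Prod.fst_add, Prod.snd_add, degF, List.length_cons]
    push_cast
    linarith
  | nil =>
    induction J with
    | cons j J ih =>
      obtain ⟨γ, hγ, hw⟩ := ih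
      refine ⟨_, ?_, hOp_shifts j hw⟩
      simp only [Prod.fst_add, Prod.snd_add, degH]
      linarith
    | nil =>
      induction L with
      | cons l L ih =>
        obtain ⟨γ, hγ, hw⟩ := ih
        refine ⟨_, ?_, eOp_shifts l hw⟩
        simp only [Prod.fst_add, Prod.snd_add, degE, List.length_cons, List.length_nil] at hγ ⊢
        push_cast at hγ ⊢
        linarith
      | nil => exact ⟨_, by simp, word_mem []⟩

theorem exists_component_monoE (I J L : List ℕ) : ∃ γ : ℤ × ℤ,
    γ.1 - γ.2 = (I.length : ℤ) - L.length ∧ monoE M k I J L ∈ component M k γ := by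
  obtain ⟨τ, hτ⟩ := exists_isSwap (M := k - M) (M' := M) (k := k) (by ring)
  obtain ⟨γ, hγ, hw⟩ := exists_component_monoF (M := k - M) (k := k) L J I
  have h1 := hτ.map_component hw
  rw [hτ.map_monoF, Submodule.smul_mem_iff _ (pow_ne_zero _ (by norm_num))] at h1
  refine ⟨γ.swap, ?_, h1⟩
  rw [Prod.fst_swap, Prod.snd_swap]
  linarith

/-- The powers of `T⁻¹` times a fixed element of `sl₂` act by commuting operators. -/
theorem creation_commute (a : Sl2) (i j : ℕ) :
    Commute (vermaRep M k (T (-(i : ℤ)) a)) (vermaRep M k (T (-(j : ℤ)) a)) := by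
  refine LinearMap.ext fun w => ?_
  have h1 := rep_lie (vermaRep M k) (T (-(i : ℤ)) a) (T (-(j : ℤ)) a) w
  have h2 : ⁅T (-(i : ℤ)) a, T (-(j : ℤ)) a⁆ = 0 := by
    rw [T_lie_T, lie_self, map_zero, zero_add]
    split_ifs with hij
    · have : i = 0 := by omega
      subst this
      simp
    · rw [zero_smul]
  rw [h2, map_zero, LinearMap.zero_apply] at h1
  exact sub_eq_zero.mp h1.symm

theorem creation_coe (a : Sl2) (l : List ℕ) (w : Verma M k) : creation M k a l w =
    l.foldr (fun (i : ℕ) x => vermaRep M k (T (-(i : ℤ)) a) x) w := by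
  have hperm : ((l : Multiset ℕ).sort (· ≥ ·)).Perm l :=
    Multiset.coe_eq_coe.mp (Multiset.sort_eq _ _)
  have h1 : creation M k a l = (l.map fun i : ℕ => vermaRep M k (T (-(i : ℤ)) a)).prod := by
    refine (hperm.map _).prod_eq' ?_
    rw [List.pairwise_map]
    exact List.pairwise_of_forall fun i j => creation_commute a i j
  rw [h1]
  clear h1 hperm
  induction l with
  | nil => rfl
  | cons i l ih =>
    rw [List.map_cons, List.prod_cons, Module.End.mul_apply, ih]
    rfl

/-- The index of the monomial with exponents given by three lists. -/
def idxMono (I J L : List ℕ) : MonoIndex :=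
  ⟨I, (J.map (· + 1) : List ℕ), (L.map (· + 1) : List ℕ), by
    intro j hj
    obtain ⟨i, -, rfl⟩ := List.mem_map.mp (Multiset.mem_coe.mp hj)
    exact Nat.succ_pos i, by
    intro j hj
    obtain ⟨i, -, rfl⟩ := List.mem_map.mp (Multiset.mem_coe.mp hj)
    exact Nat.succ_pos i⟩

theorem exists_idxMono (m : MonoIndex) : ∃ I J L, m = idxMono I J L := by
  have key : ∀ S : Multiset ℕ, (∀ j ∈ S, 1 ≤ j) → ∃ l : List ℕ, S = (l.map (· + 1) : List ℕ) := by
    intro S hS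
    refine ⟨(S.map (· - 1)).toList, ?_⟩
    rw [← Multiset.map_coe, Multiset.coe_toList, Multiset.map_map]
    conv_lhs => rw [← Multiset.map_id S]
    refine Multiset.map_congr rfl fun j hj => ?_
    have := hS j hj
    simp only [id, Function.comp_apply]
    omega
  obtain ⟨I, J, L, hJ, hL⟩ := m
  obtain ⟨J, rfl⟩ := key J hJ
  obtain ⟨L, rfl⟩ := key L hL
  induction I using Quotient.inductionOn with
  | h I => exact ⟨I, J, L, rfl⟩

theorem monomial_idxMono_of_le {I J L : List ℕ} (hIL : L.length ≤ I.length) :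
    monomial M k (idxMono I J L) = monoF M k I J L := by
  rw [monomial, if_pos (by simpa [idxMono] using hIL)]
  simp only [idxMono, creation_coe, List.foldr_map]
  rfl

theorem monomial_idxMono_of_lt {I J L : List ℕ} (hIL : I.length < L.length) :
    monomial M k (idxMono I J L) = monoE M k I J L := by
  rw [monomial, if_neg (by simpa [idxMono] using hIL)]
  simp only [idxMono, creation_coe, List.foldr_map]
  rfl

/-- The monomials span the Verma module: in the components with `p₁ ≥ p₂` this is the spanning
property of monomials in the order `f, h, e`, and the diagram automorphism yields the components with
`p₁ < p₂`. -/
theorem eq_zero_of_monomial {φ : Verma M k →ₗ[ℂ] ℂ} (hφ : ∀ m, φ (monomial M k m) = 0) :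
    φ = 0 := by
  have hφF : ∀ I J L : List ℕ, L.length ≤ I.length → φ (monoF M k I J L) = 0 := fun I J L hIL => by
    rw [← monomial_idxMono_of_le hIL]; exact hφ _
  have hφE : ∀ I J L : List ℕ, I.length < L.length → φ (monoE M k I J L) = 0 := fun I J L hIL => by
    rw [← monomial_idxMono_of_lt hIL]; exact hφ _
  obtain ⟨τ, hτ⟩ := exists_isSwap (M := M) (M' := k - M) (k := k) (by ring)
  obtain ⟨σ, hσ⟩ := exists_isSwap (M := k - M) (M' := M) (k := k) (by ring)
  have key : ∀ γ, component M k γ ≤ LinearMap.ker φ := by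
    intro γ w hw
    rw [LinearMap.mem_ker]
    rcases le_or_gt γ.2 γ.1 with hγ | hγ
    · refine (Submodule.span_le (p := LinearMap.ker φ)).mpr ?_ (component_le_monoSpan γ hw)
      rintro _ ⟨I, J, L, rfl, rfl⟩
      have := degMono_diff I J L
      exact hφF I J L (by omega)
    · rw [← hτ.comp hσ w]
      refine (Submodule.span_le (p := LinearMap.ker (φ ∘ₗ σ))).mpr ?_
        (component_le_monoSpan _ (hτ.map_component hw))
      rintro _ ⟨I, J, L, hd, rfl⟩
      have := degMono_diff I J L
      rw [hd, Prod.fst_swap, Prod.snd_swap] at this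
      rw [SetLike.mem_coe, LinearMap.mem_ker, LinearMap.comp_apply, hσ.map_monoF, map_smul,
        hφE L J I (by omega), smul_zero]
  have h1 : ⨆ γ, component M k γ ≤ LinearMap.ker φ := iSup_le key
  rw [iSup_component, top_le_iff] at h1
  exact LinearMap.ker_eq_top.mp h1

open Classical in
theorem dualVec_eq {m : MonoIndex} (φ : Contra M k)
    (hφ : ∀ I J L, φ.val (monomial M k (idxMono I J L)) = if idxMono I J L = m then 1 else 0) :
    dualVec M k m = φ := by
  have hφ' : ∀ m', φ.val (monomial M k m') = if m' = m then 1 else 0 := by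
    intro m'
    obtain ⟨I, J, L, rfl⟩ := exists_idxMono m'
    exact hφ I J L
  have huniq : ∀ ψ : Contra M k, (∀ m', ψ.val (monomial M k m') = if m' = m then 1 else 0) →
      ψ = φ := by
    intro ψ hψ
    apply Subtype.ext
    refine sub_eq_zero.mp (eq_zero_of_monomial fun m' => ?_)
    rw [LinearMap.sub_apply, hψ, hφ', sub_self]
  have hex : ∃! φ : Contra M k, ∀ m', φ.val (monomial M k m') = if m' = m then 1 else 0 :=
    ⟨φ, hφ', huniq⟩
  rw [dualVec, dif_pos]
  · exact huniq _ (by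
      have := hex.choose_spec.1
      convert this)

theorem dualForm_eq_zero_of_diff {S : Multiset ℕ} {γ : ℤ × ℤ} {w : Verma M k}
    (hw : w ∈ component M k γ) (hγ : γ.1 - γ.2 ≠ S.card) : dualForm M k S w = 0 := by
  refine dualForm_component S (fun h0 => hγ ?_) hw
  rw [h0, degS_diff]

/-- The functionals `dualForm` belong to the dual basis. -/
theorem dualVec_f (S : Multiset ℕ) (m : MonoIndex) (hI : m.I = S) (hJ : m.J = 0) (hL : m.L = 0) :
    dualVec M k m = ⟨dualForm M k S, dualForm_mem_contra S⟩ := by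
  obtain ⟨I, J, L, hJ', hL'⟩ := m
  simp only at hI hJ hL
  subst hI hJ hL
  apply dualVec_eq
  intro I' J L
  simp only [idxMono, MonoIndex.mk.injEq, Multiset.coe_eq_zero, List.map_eq_nil_iff]
  rcases le_or_gt L.length I'.length with hIL | hIL
  · change dualForm M k I (monomial M k (idxMono I' J L)) = _
    rw [monomial_idxMono_of_le hIL, dualForm_monoF]
    congr 1
    exact propext ⟨fun ⟨a, b, c⟩ => ⟨c, a, b⟩, fun ⟨a, b, c⟩ => ⟨b, c, a⟩⟩
  · change dualForm M k I (monomial M k (idxMono I' J L)) = _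
    obtain ⟨γ, hγ, hw⟩ := exists_component_monoE (M := M) (k := k) I' J L
    rw [monomial_idxMono_of_lt hIL, dualForm_eq_zero_of_diff hw (by omega), if_neg]
    rintro ⟨-, -, rfl⟩
    simp at hIL

theorem dualForm_comp_mem_contra {M' : ℂ} {τ : Verma M k →ₗ[ℂ] Verma M' k} (hτ : IsSwap τ)
    (S : Multiset ℕ) : dualForm M' k S ∘ₗ τ ∈ contra M k := by
  refine (Set.finite_singleton (degS S).swap).subset fun γ hγ => ?_
  by_contra hne
  refine hγ fun w hw => dualForm_component S (fun h0 => hne ?_) (hτ.map_component hw)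
  rw [Set.mem_singleton_iff, ← h0, Prod.swap_swap]

/-- The elements of the dual basis attached to products of the `e / T^{l+1}` are transported from
products of the `f / Tˡ` by the diagram automorphism. -/
theorem dualVec_e {M' : ℂ} {τ : Verma M k →ₗ[ℂ] Verma M' k} (hτ : IsSwap τ)
    {S : Multiset ℕ} (hS : S ≠ 0) (m : MonoIndex) (hI : m.I = 0) (hJ : m.J = 0)
    (hL : m.L = S.map (· + 1)) :
    dualVec M k m = ⟨dualForm M' k S ∘ₗ τ, dualForm_comp_mem_contra hτ S⟩ := by
  obtain ⟨I, J, L, hJ', hL'⟩ := m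
  simp only at hI hJ hL
  subst hI hJ hL
  have hcard : 0 < S.card := Multiset.card_pos.mpr hS
  apply dualVec_eq
  intro I J L
  have hinj : Function.Injective fun S : Multiset ℕ => S.map (· + 1) :=
    Multiset.map_injective (add_left_injective 1)
  have hiff : ((L.map (· + 1) : List ℕ) : Multiset ℕ) = S.map (· + 1) ↔ (L : Multiset ℕ) = S := by
    rw [← Multiset.map_coe]
    exact hinj.eq_iff
  simp only [idxMono, MonoIndex.mk.injEq, Multiset.coe_eq_zero, List.map_eq_nil_iff, hiff]
  rcases le_or_gt L.length I.length with hIL | hIL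
  · change dualForm M' k S (τ (monomial M k (idxMono I J L))) = _
    obtain ⟨γ, hγ, hw⟩ := exists_component_monoF (M := M) (k := k) I J L
    rw [monomial_idxMono_of_le hIL, dualForm_eq_zero_of_diff (hτ.map_component hw), if_neg]
    · rintro ⟨rfl, -, rfl⟩
      simp at hIL
      exact hS (by simpa using hIL)
    · rw [Prod.fst_swap, Prod.snd_swap]
      omega
  · change dualForm M' k S (τ (monomial M k (idxMono I J L))) = _
    rw [monomial_idxMono_of_lt hIL, hτ.map_monoE, map_smul, dualForm_monoF]
    by_cases hJ : J = []
    · subst hJ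
      simp
    · simp [hJ]

end DualBasis

/-! ### The action on the dual vectors -/

section DualVectors

open Finset

variable {M k : ℂ}

theorem dualVec_idxV : dualVec M k idxV = ⟨dualForm M k 0, dualForm_mem_contra 0⟩ :=
  dualVec_f 0 idxV rfl rfl rfl

theorem dualVec_idxF (i : ℕ) : dualVec M k (idxF i) = ⟨dualForm M k {i}, dualForm_mem_contra _⟩ :=
  dualVec_f {i} (idxF i) rfl rfl rfl

theorem dualVec_idxFF (i j : ℕ) :
    dualVec M k (idxFF i j) = ⟨dualForm M k {i, j}, dualForm_mem_contra _⟩ :=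
  dualVec_f {i, j} (idxFF i j) rfl rfl rfl

theorem dualVec_idxE {M' : ℂ} {τ : Verma M k →ₗ[ℂ] Verma M' k} (hτ : IsSwap τ) (i : ℕ) :
    dualVec M k (idxE i) = ⟨dualForm M' k {i} ∘ₗ τ, dualForm_comp_mem_contra hτ _⟩ :=
  dualVec_e hτ (Multiset.singleton_ne_zero i) (idxE i) rfl rfl (Multiset.map_singleton _ _).symm

theorem dualVec_idxEE {M' : ℂ} {τ : Verma M k →ₗ[ℂ] Verma M' k} (hτ : IsSwap τ) (i j : ℕ) :
    dualVec M k (idxEE i j) = ⟨dualForm M' k {i, j} ∘ₗ τ, dualForm_comp_mem_contra hτ _⟩ :=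
  dualVec_e hτ (Multiset.cons_ne_zero) (idxEE i j) rfl rfl
    (by rw [Multiset.map_cons, Multiset.map_singleton]; rfl)

theorem contraRep_T (j : ℤ) (a : Sl2) (φ : Contra M k) (w : Verma M k) :
    (contraRep M k (T j a) φ).val w = φ.val (vermaRep M k (T (-j) (transpose a)) w) := by
  rw [contraRep_apply, anti_T]

theorem contraRep_T_e (j : ℤ) (φ : Contra M k) (w : Verma M k) :
    (contraRep M k (T j e) φ).val w = φ.val (vermaRep M k (T (-j) f) w) := by
  rw [contraRep_T, transpose_e]

theorem contraRep_T_f (j : ℤ) (φ : Contra M k) (w : Verma M k) :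
    (contraRep M k (T j f) φ).val w = φ.val (vermaRep M k (T (-j) e) w) := by
  rw [contraRep_T, transpose_f]

theorem contraRep_T_h (j : ℤ) (φ : Contra M k) (w : Verma M k) :
    (contraRep M k (T j h) φ).val w = φ.val (vermaRep M k (T (-j) h) w) := by
  rw [contraRep_T, transpose_h]

theorem contraRep_e_vac {j : ℤ} (hj : 0 ≤ j) : contraRep M k (T j e) (dualVec M k idxV) = 0 := by
  lift j to ℕ using hj
  apply Subtype.ext
  ext w
  rw [contraRep_T_e, dualVec_idxV]
  exact dualForm_zero_fOp j w

theorem contraRep_h_vac {j : ℤ} (hj : 0 < j) : contraRep M k (T j h) (dualVec M k idxV) = 0 := by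
  obtain ⟨i, rfl⟩ : ∃ i : ℕ, j = (i : ℤ) + 1 := ⟨(j - 1).toNat, by omega⟩
  apply Subtype.ext
  ext w
  rw [contraRep_T_h, dualVec_idxV]
  exact dualForm_zero_hOp i w

theorem contraRep_f_vac {j : ℤ} (hj : 0 < j) : contraRep M k (T j f) (dualVec M k idxV) = 0 := by
  obtain ⟨i, rfl⟩ : ∃ i : ℕ, j = (i : ℤ) + 1 := ⟨(j - 1).toNat, by omega⟩
  apply Subtype.ext
  ext w
  rw [contraRep_T_f, dualVec_idxV]
  exact dualForm_zero_eOp i w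

/-- The vector `v^*` is a vacuum vector: it is killed by the positive part of the loop algebra. -/
theorem contraRep_vac_pos {j : ℤ} (hj : 0 < j) (a : Sl2) :
    contraRep M k (T j a) (dualVec M k idxV) = 0 := by
  induction a using sl2_induction with
  | he => exact contraRep_e_vac hj.le
  | hh => exact contraRep_h_vac hj
  | hf => exact contraRep_f_vac hj
  | hadd a b ha hb => rw [map_add, map_add, LinearMap.add_apply, ha, hb, add_zero]
  | hsmul r a ha => rw [map_smul, map_smul, LinearMap.smul_apply, ha, smul_zero]

theorem dualForm_zero_h (w : Verma M k) :
    dualForm M k 0 (vermaRep M k (T 0 h) w) = M * dualForm M k 0 w := by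
  refine LinearMap.congr_fun (f := dualForm M k 0 ∘ₗ vermaRep M k (T 0 h))
    (g := M • dualForm M k 0) (word_ext fun l => ?_) w
  rw [LinearMap.comp_apply, LinearMap.smul_apply, h_word_eq, map_smul]
  rcases l with _ | ⟨i, l⟩
  · simp
  · have h0 : dualForm M k 0 (word M k (i :: l)) = 0 := by
      fin_cases i
      · exact dualForm_zero_fOp 0 _
      · exact dualForm_zero_eOp 0 _
    rw [h0, smul_zero, smul_zero]

theorem contraRep_h_zero_vac :
    contraRep M k (T 0 h) (dualVec M k idxV) = M • dualVec M k idxV := by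
  apply Subtype.ext
  ext w
  rw [contraRep_T_h, dualVec_idxV, neg_zero]
  exact dualForm_zero_h w

/-- The identity behind the formulas at the finite points. -/
theorem contraRep_sugawara (b : ℕ) :
    contraRep M k (T (-(b : ℤ)) f) (dualVec M k idxV) -
      ∑ l ∈ range b, (contraRep M k (T (-((l : ℤ) + 1)) e)
          ((2 : ℂ) • ∑ q ∈ pairs (b - (l + 1)), dualVec M k (idxFF q.1 q.2)) +
        contraRep M k (T (-((l : ℤ) + 1)) h) (dualVec M k (idxF (b - (l + 1))))) =
      (M + b * (k + 2)) • dualVec M k (idxF b) := by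
  apply Subtype.ext
  ext w
  have := dualForm_sugawara (M := M) (k := k) b w
  simp only [map_smul, map_sum, Submodule.coe_sub, Submodule.coe_add, Submodule.coe_smul,
    Submodule.coe_sum, LinearMap.sub_apply, LinearMap.add_apply, LinearMap.smul_apply,
    LinearMap.sum_apply, contraRep_T_e, contraRep_T_f, contraRep_T_h, neg_neg, dualVec_idxV,
    dualVec_idxF, dualVec_idxFF, smul_eq_mul]
  exact this

theorem contraRep_f_zero_vac :
    contraRep M k (T 0 f) (dualVec M k idxV) = M • dualVec M k (idxF 0) := by
  simpa using contraRep_sugawara (M := M) (k := k) 0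

theorem dualForm_zero_comp {M' : ℂ} {τ : Verma M k →ₗ[ℂ] Verma M' k} (hτ : IsSwap τ)
    (w : Verma M k) : dualForm M' k 0 (τ w) = dualForm M k 0 w := by
  refine LinearMap.congr_fun (f := dualForm M' k 0 ∘ₗ τ) (g := dualForm M k 0)
    (word_ext fun l => ?_) w
  rw [LinearMap.comp_apply]
  rcases l with _ | ⟨i, l⟩
  · change dualForm M' k 0 (τ (vac M k)) = dualForm M k 0 (vac M k)
    rw [hτ.1]
    exact (dualForm_monoF 0 [] [] []).trans (dualForm_monoF 0 [] [] []).symm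
  · fin_cases i
    · change dualForm M' k 0 (τ (fOp M k 0 _)) = dualForm M k 0 (fOp M k 0 _)
      rw [hτ.map_fOp, dualForm_zero_fOp, dualForm_zero_eOp]
    · change dualForm M' k 0 (τ (eOp M k 0 _)) = dualForm M k 0 (eOp M k 0 _)
      rw [hτ.map_eOp, dualForm_zero_fOp, dualForm_zero_eOp]

/-- The identity behind the formulas at infinity: it is the one at the finite points, transported by
the diagram automorphism. -/
theorem contraRep_sugawara_swap (b : ℕ) :
    contraRep M k (T (-((b : ℤ) + 1)) e) (dualVec M k idxV) -
      ∑ l ∈ range b, (contraRep M k (T (-(l : ℤ)) f)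
          ((2 : ℂ) • ∑ q ∈ pairs (b - (l + 1)), dualVec M k (idxEE q.1 q.2)) -
        contraRep M k (T (-((l : ℤ) + 1)) h) (dualVec M k (idxE (b - (l + 1))))) =
      (k - M + b * (k + 2)) • dualVec M k (idxE b) := by
  obtain ⟨τ, hτ⟩ := exists_isSwap (M := M) (M' := k - M) (k := k) (by ring)
  have hf : ∀ (j : ℤ) w, τ (vermaRep M k (T (j + 1) f) w) = vermaRep (k - M) k (T j e) (τ w) :=
    fun j w => by rw [hτ.2, diagram_f, add_sub_cancel_right]
  have he : ∀ (j : ℤ) w, τ (vermaRep M k (T j e) w) = vermaRep (k - M) k (T (j + 1) f) (τ w) :=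
    fun j w => by rw [hτ.2, diagram_e]
  have hh : ∀ (j : ℕ) w, τ (vermaRep M k (T ((j : ℤ) + 1) h) w) =
      -vermaRep (k - M) k (T ((j : ℤ) + 1) h) (τ w) :=
    fun j w => by rw [hτ.2, diagram_h (by omega), map_neg, LinearMap.neg_apply]
  apply Subtype.ext
  ext w
  have := dualForm_sugawara (M := k - M) (k := k) b (τ w)
  simp only [map_smul, map_sum, Submodule.coe_sub, Submodule.coe_smul,
    Submodule.coe_sum, LinearMap.sub_apply, LinearMap.smul_apply,
    LinearMap.sum_apply, contraRep_T_e, contraRep_T_f, contraRep_T_h, neg_neg, dualVec_idxV,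
    dualVec_idxE hτ, dualVec_idxEE hτ, smul_eq_mul, LinearMap.comp_apply, hf, he, hh, map_neg,
    sub_neg_eq_add, ← dualForm_zero_comp hτ]
  exact this

end DualVectors

/-! ### Tensors with one excited factor -/

section Insertion

open Finset

variable {n : ℕ} (M : Fin n → ℂ) (k : ℂ)

/-- The vector `(x)^*` of the `p`-th tensor factor, where `x` is the basis vector with index `m`. -/
def factorVec (p : Fin (n + 1)) (m : MonoIndex) : Factor M k p :=
  (dualVec (weight M p) k m : Contra (weight M p) k)

/-- The tensor `v₁^* ⊗ … ⊗ φ ⊗ … ⊗ v_{n+1}^*` with `φ` in the `p`-th place. -/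
def insertAt (p : Fin (n + 1)) : Factor M k p →ₗ[ℂ] Coeff M k :=
  (PiTensorProduct.tprod ℂ).toLinearMap (fun q => factorVec M k q idxV) p

theorem tensorAt_eq (p : Fin (n + 1)) (m : MonoIndex) :
    tensorAt M k p m = insertAt M k p (factorVec M k p m) := rfl

theorem insertAt_idxV (p : Fin (n + 1)) :
    insertAt M k p (factorVec M k p idxV) = vacTensor M k := by
  change PiTensorProduct.tprod ℂ (Function.update _ p _) = _
  rw [Function.update_eq_self]
  rfl

variable {M k}

theorem onFactor_insertAt_self (p : Fin (n + 1)) (A : Module.End ℂ (Factor M k p))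
    (φ : Factor M k p) : onFactor p A (insertAt M k p φ) = insertAt M k p (A φ) := by
  refine (onFactor_tprod p A _).trans ?_
  rw [Function.update_idem, Function.update_self]
  rfl

theorem onFactor_insertAt_of_ne {p q : Fin (n + 1)} (hq : q ≠ p) {A : Module.End ℂ (Factor M k q)}
    {r : ℂ} (hA : A (factorVec M k q idxV) = r • factorVec M k q idxV) (φ : Factor M k p) :
    onFactor q A (insertAt M k p φ) = r • insertAt M k p φ := by
  refine (onFactor_tprod q A _).trans ?_
  rw [Function.update_of_ne hq, hA, MultilinearMap.map_update_smul]
  refine congrArg (fun x => r • PiTensorProduct.tprod ℂ x) ?_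
  rw [Function.update_eq_iff]
  exact ⟨(Function.update_of_ne hq φ fun q => factorVec M k q idxV).symm, fun _ _ => rfl⟩

variable (z : Fin n ↪ ℂ)

theorem act_elt (g : Reg z) (a : Sl2) (w : Coeff M k) :
    act z M k (elt a g) w = ∑ q, onFactor q (localAct z M k q g a) w :=
  (LinearMap.congr_fun (actLin_elt z M k g a) w).trans (LinearMap.sum_apply _ _ _)

theorem act_vacTensor (g : Reg z) (a : Sl2) : act z M k (elt a g) (vacTensor M k) =
    ∑ q, insertAt M k q (localAct z M k q g a (factorVec M k q idxV)) := by
  rw [act_elt]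
  refine Finset.sum_congr rfl fun q _ => ?_
  rw [← insertAt_idxV M k q, onFactor_insertAt_self]

theorem act_insertAt (g : Reg z) (a : Sl2) (p : Fin (n + 1)) (φ : Factor M k p)
    (r : Fin (n + 1) → ℂ) (hp : r p = 0) (hr : ∀ q ≠ p,
      localAct z M k q g a (factorVec M k q idxV) = r q • factorVec M k q idxV) :
    act z M k (elt a g) (insertAt M k p φ) = insertAt M k p (localAct z M k p g a φ) +
      (∑ q, r q) • insertAt M k p φ := by
  rw [act_elt, ← Finset.add_sum_erase _ _ (mem_univ p), onFactor_insertAt_self,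
    ← Finset.add_sum_erase _ r (mem_univ p), hp, zero_add, Finset.sum_smul]
  congr 1
  refine Finset.sum_congr rfl fun q hq => ?_
  exact onFactor_insertAt_of_ne (ne_of_mem_erase hq) (hr q (ne_of_mem_erase hq)) φ

end Insertion

/-! ### Laurent expansions of the elementary functions and their action -/

section Expansions

open Finset

section Loop

variable {W : Type*} [AddCommGroup W] [Module ℂ W] {ρ : Affine →ₗ⁅ℂ⁆ Module.End ℂ W}

theorem loopAct_single (hρ : FinProp ρ) (j : ℤ) (a : Sl2) (w : W) :
    loopAct hρ (HahnSeries.single j 1) a w = ρ (T j a) w := by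
  rw [loopAct_apply, finsum_eq_single _ j, HahnSeries.coeff_single_same, one_smul]
  intro i hi
  rw [HahnSeries.coeff_single_of_ne hi, zero_smul]

theorem loopAct_ofPowerSeries (hρ : FinProp ρ) (q : PowerSeries ℂ) (a : Sl2) (w : W)
    (hw : ∀ j, 0 < j → ρ (T j a) w = 0) :
    loopAct hρ (HahnSeries.ofPowerSeries ℤ ℂ q) a w =
      PowerSeries.constantCoeff q • ρ (T 0 a) w := by
  rw [loopAct_apply, finsum_eq_single _ 0, coeff_ofPowerSeries_zero]
  intro j hj
  rcases lt_or_gt_of_ne hj with hj | hj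
  · rw [coeff_ofPowerSeries_neg q hj, zero_smul]
  · rw [hw j hj, smul_zero]

end Loop

variable {n : ℕ} (z : Fin n ↪ ℂ)

/-- The function `g` is regular at the `p`-th point and takes the value `r` there. -/
def HasValue (p : Fin (n + 1)) (g : Reg z) (r : ℂ) : Prop :=
  ∃ q : PowerSeries ℂ, expand z p g = HahnSeries.ofPowerSeries ℤ ℂ q ∧
    PowerSeries.constantCoeff q = r

variable {z}

theorem HasValue.pow {p : Fin (n + 1)} {g : Reg z} {r : ℂ} (hg : HasValue z p g r) (b : ℕ) :
    HasValue z p (g ^ b) (r ^ b) := by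
  obtain ⟨q, hq, rfl⟩ := hg
  exact ⟨q ^ b, by rw [map_pow, map_pow, hq], map_pow _ _ _⟩

theorem HasValue.coeff_of_neg {p : Fin (n + 1)} {g : Reg z} {r : ℂ} (hg : HasValue z p g r) {j : ℤ}
    (hj : j < 0) : (expand z p g).coeff j = 0 := by
  obtain ⟨q, hq, -⟩ := hg
  rw [hq, coeff_ofPowerSeries_neg q hj]

theorem HasValue.coeff_zero {p : Fin (n + 1)} {g : Reg z} {r : ℂ} (hg : HasValue z p g r) :
    (expand z p g).coeff 0 = r := by
  obtain ⟨q, hq, rfl⟩ := hg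
  rw [hq, coeff_ofPowerSeries_zero]

variable (z)

theorem hasValue_coord (i : Fin n) : HasValue z i.castSucc (coord z) (z i) := by
  refine ⟨PowerSeries.X + PowerSeries.C (z i), ?_, by simp⟩
  rw [expand_coord, localCoord_castSucc, map_add, HahnSeries.ofPowerSeries_X,
    HahnSeries.ofPowerSeries_C]

theorem hasValue_pole {i m : Fin n} (hi : i ≠ m) :
    HasValue z i.castSucc (pole z m) (z i - z m)⁻¹ := by
  obtain ⟨q, hq⟩ := expand_pole_of_ne z hi
  refine ⟨q, hq, ?_⟩
  have h1 := localCoord_sub_mul_expand_pole z i.castSucc m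
  rw [hq, localCoord_castSucc, ← HahnSeries.ofPowerSeries_X, ← HahnSeries.ofPowerSeries_C,
    ← HahnSeries.ofPowerSeries_C, ← map_add, ← map_sub, ← map_mul] at h1
  have h2 := congrArg (fun u => HahnSeries.coeff u 0) h1
  rw [← map_one (HahnSeries.ofPowerSeries ℤ ℂ)] at h2
  simp only [coeff_ofPowerSeries_zero] at h2
  simp only [map_mul, map_sub, map_add, PowerSeries.constantCoeff_X, PowerSeries.constantCoeff_C,
    zero_add, map_one] at h2
  exact eq_inv_of_mul_eq_one_right h2

theorem hasValue_pole_last (m : Fin n) : HasValue z (Fin.last n) (pole z m) 0 := by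
  obtain ⟨q, -, hq⟩ := expand_pole_last z m
  refine ⟨PowerSeries.X * q, ?_, by simp⟩
  rw [hq, map_mul, HahnSeries.ofPowerSeries_X]

theorem expand_pole_pow (m : Fin n) (b : ℕ) :
    expand z m.castSucc (pole z m ^ b) = HahnSeries.single (-(b : ℤ)) 1 := by
  rw [map_pow, expand_pole_self, HahnSeries.single_pow, one_pow, nsmul_eq_mul, mul_neg_one]

theorem expand_coord_pow (b : ℕ) :
    expand z (Fin.last n) (coord z ^ b) = HahnSeries.single (-(b : ℤ)) 1 := by
  rw [map_pow, expand_coord, localCoord_last, HahnSeries.single_pow, one_pow, nsmul_eq_mul,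
    mul_neg_one]

variable (M : Fin n → ℂ) (k : ℂ)

/-- The action of the affine Lie algebra on the `p`-th tensor factor. -/
def factorRep (p : Fin (n + 1)) : Affine →ₗ⁅ℂ⁆ Module.End ℂ (Factor M k p) :=
  contraRep (weight M p) k

variable {M k}

theorem weight_castSucc (i : Fin n) : weight M i.castSucc = M i := by simp [weight]

theorem weight_last : weight M (Fin.last n) = (∑ i, M i) - 2 := by simp [weight]

theorem twist_castSucc (i : Fin n) (a : Sl2) : twist i.castSucc a = a := by
  rw [twist, if_neg (Fin.castSucc_lt_last i).ne]
  rfl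

theorem twist_last (a : Sl2) : twist (Fin.last n) a = flip a := by
  rw [twist, if_pos rfl]

theorem localAct_single {p : Fin (n + 1)} {g : Reg z} {j : ℤ}
    (hg : expand z p g = HahnSeries.single j 1) (a : Sl2) (φ : Factor M k p) :
    localAct z M k p g a φ = factorRep M k p (T j (twist p a)) φ := by
  refine Eq.trans ?_ (loopAct_single (contraRep_fin (M := weight M p) (k := k)) j (twist p a) φ)
  rw [localAct, hg]
  rfl

theorem localAct_vac {p : Fin (n + 1)} {g : Reg z} {r : ℂ} (hg : HasValue z p g r) (a : Sl2) :
    localAct z M k p g a (factorVec M k p idxV) =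
      r • factorRep M k p (T 0 (twist p a)) (factorVec M k p idxV) := by
  obtain ⟨q, hq, rfl⟩ := hg
  refine Eq.trans ?_ (loopAct_ofPowerSeries (contraRep_fin (M := weight M p) (k := k)) q (twist p a)
    (dualVec (weight M p) k idxV) fun j hj => contraRep_vac_pos hj _)
  rw [localAct, hq]
  rfl

theorem localAct_e_vac {i : Fin n} {g : Reg z} {r : ℂ} (hg : HasValue z i.castSucc g r) :
    localAct z M k i.castSucc g e (factorVec M k i.castSucc idxV) = 0 := by
  rw [localAct_vac z hg, twist_castSucc]
  exact (congrArg (r • ·) (contraRep_e_vac le_rfl)).trans (smul_zero r)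

theorem localAct_h_vac {i : Fin n} {g : Reg z} {r : ℂ} (hg : HasValue z i.castSucc g r) :
    localAct z M k i.castSucc g h (factorVec M k i.castSucc idxV) =
      (r * M i) • factorVec M k i.castSucc idxV := by
  rw [localAct_vac z hg, twist_castSucc, mul_smul, ← weight_castSucc (M := M) i]
  exact congrArg (r • ·) contraRep_h_zero_vac

theorem localAct_f_vac {i : Fin n} {g : Reg z} {r : ℂ} (hg : HasValue z i.castSucc g r) :
    localAct z M k i.castSucc g f (factorVec M k i.castSucc idxV) =
      (r * M i) • factorVec M k i.castSucc (idxF 0) := by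
  rw [localAct_vac z hg, twist_castSucc, mul_smul, ← weight_castSucc (M := M) i]
  exact congrArg (r • ·) contraRep_f_zero_vac

theorem localAct_last_vac {g : Reg z} (hg : HasValue z (Fin.last n) g 0) (a : Sl2) :
    localAct z M k (Fin.last n) g a (factorVec M k (Fin.last n) idxV) = 0 := by
  rw [localAct_vac z hg, zero_smul]

end Expansions

/-! ### The differential of the values of `η⁰` -/

section Differential

open Finset

variable {n : ℕ} (z : Fin n ↪ ℂ) {M : Fin n → ℂ} {k : ℂ}

/-- The value at `zᵢ` of the function `1 / (t - z_m)` for `i ≠ m`, and the junk value `0` for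
`i = m`, which makes the corresponding terms of sums over all points disappear. -/
def poleValue (m i : Fin n) : ℂ := (z i - z m)⁻¹

theorem poleValue_self (m : Fin n) : poleValue z m m = 0 := by
  rw [poleValue, sub_self, inv_zero]

theorem hasValue_pole_pow_last (m : Fin n) (b : ℕ) :
    HasValue z (Fin.last n) (pole z m ^ (b + 1)) 0 := by
  have := (hasValue_pole_last z m).pow (b + 1)
  rwa [zero_pow (Nat.succ_ne_zero b)] at this

theorem act_f_pole (m : Fin n) (b : ℕ) : act z M k (elt f (pole z m ^ (b + 1))) (vacTensor M k) =
    insertAt M k m.castSucc (factorRep M k m.castSucc (T (-((b + 1 : ℕ) : ℤ)) f)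
      (factorVec M k m.castSucc idxV)) +
    ∑ i, (M i * poleValue z m i ^ (b + 1)) • tensorAt M k i.castSucc (idxF 0) := by
  rw [act_vacTensor, Fin.sum_univ_castSucc, localAct_last_vac z (hasValue_pole_pow_last z m b),
    map_zero, add_zero, ← Finset.add_sum_erase _ _ (mem_univ m),
    localAct_single z (expand_pole_pow z m (b + 1)), twist_castSucc,
    ← Finset.add_sum_erase _ (fun i => (M i * poleValue z m i ^ (b + 1)) • _) (mem_univ m),
    poleValue_self, zero_pow (Nat.succ_ne_zero b), mul_zero, zero_smul, zero_add]
  congr 1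
  refine Finset.sum_congr rfl fun i hi => ?_
  rw [localAct_f_vac z ((hasValue_pole z (ne_of_mem_erase hi)).pow (b + 1)), map_smul, tensorAt_eq,
    mul_comm]
  rfl

theorem act_e_pole (m : Fin n) (l : ℕ) (φ : Factor M k m.castSucc) :
    act z M k (elt e (pole z m ^ (l + 1))) (insertAt M k m.castSucc φ) =
      insertAt M k m.castSucc (factorRep M k m.castSucc (T (-((l : ℤ) + 1)) e) φ) := by
  rw [act_insertAt z _ _ _ _ (fun _ => 0) rfl, Finset.sum_const_zero, zero_smul, add_zero,
    localAct_single z (expand_pole_pow z m (l + 1)), twist_castSucc, Nat.cast_succ]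
  intro q hq
  rw [zero_smul]
  induction q using Fin.lastCases with
  | last => exact localAct_last_vac z (hasValue_pole_pow_last z m l) e
  | cast i =>
    exact localAct_e_vac z ((hasValue_pole z fun him => hq (congrArg _ him)).pow (l + 1))

theorem act_h_pole (m : Fin n) (l : ℕ) (φ : Factor M k m.castSucc) :
    act z M k (elt h (pole z m ^ (l + 1))) (insertAt M k m.castSucc φ) =
      insertAt M k m.castSucc (factorRep M k m.castSucc (T (-((l : ℤ) + 1)) h) φ) +
        (∑ i, M i * poleValue z m i ^ (l + 1)) • insertAt M k m.castSucc φ := by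
  rw [act_insertAt z _ _ _ _ (Fin.lastCases (motive := fun _ => ℂ) 0
    fun i => M i * poleValue z m i ^ (l + 1)), Fin.sum_univ_castSucc, Fin.lastCases_last, add_zero,
    localAct_single z (expand_pole_pow z m (l + 1)), twist_castSucc, Nat.cast_succ]
  · simp only [Fin.lastCases_castSucc]
  · rw [Fin.lastCases_castSucc, poleValue_self, zero_pow (Nat.succ_ne_zero l), mul_zero]
  intro q hq
  induction q using Fin.lastCases with
  | last =>
    rw [Fin.lastCases_last, zero_smul]
    exact localAct_last_vac z (hasValue_pole_pow_last z m l) h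
  | cast i =>
    rw [Fin.lastCases_castSucc, mul_comm]
    exact localAct_h_vac z ((hasValue_pole z fun him => hq (congrArg _ him)).pow (l + 1))

theorem factorRep_sugawara (i : Fin n) (b : ℕ) :
    factorRep M k i.castSucc (T (-(b : ℤ)) f) (factorVec M k i.castSucc idxV) -
      ∑ l ∈ range b, (factorRep M k i.castSucc (T (-((l : ℤ) + 1)) e)
          ((2 : ℂ) • ∑ q ∈ pairs (b - (l + 1)), factorVec M k i.castSucc (idxFF q.1 q.2)) +
        factorRep M k i.castSucc (T (-((l : ℤ) + 1)) h)
          (factorVec M k i.castSucc (idxF (b - (l + 1))))) =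
      (M i + b * (k + 2)) • factorVec M k i.castSucc (idxF b) := by
  rw [← weight_castSucc (M := M) i]
  exact contraRep_sugawara b

theorem factorRep_sugawara_last (b : ℕ) :
    factorRep M k (Fin.last n) (T (-((b : ℤ) + 1)) e) (factorVec M k (Fin.last n) idxV) -
      ∑ l ∈ range b, (factorRep M k (Fin.last n) (T (-(l : ℤ)) f)
          ((2 : ℂ) • ∑ q ∈ pairs (b - (l + 1)), factorVec M k (Fin.last n) (idxEE q.1 q.2)) -
        factorRep M k (Fin.last n) (T (-((l : ℤ) + 1)) h)
          (factorVec M k (Fin.last n) (idxE (b - (l + 1))))) =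
      ((b + 1) * (k + 2) - ∑ i, M i) • factorVec M k (Fin.last n) (idxE b) := by
  have h1 : (b + 1) * (k + 2) - ∑ i, M i = k - weight M (Fin.last n) + b * (k + 2) := by
    rw [weight_last]
    ring
  rw [h1]
  exact contraRep_sugawara_swap b

theorem sum_tensorAt (p : Fin (n + 1)) (s : Finset (ℕ × ℕ)) (μ : ℕ × ℕ → MonoIndex) :
    (2 : ℂ) • ∑ q ∈ s, tensorAt M k p (μ q) =
      insertAt M k p ((2 : ℂ) • ∑ q ∈ s, factorVec M k p (μ q)) := by
  simp only [map_smul, map_sum, tensorAt_eq]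

/-- The image under the Chevalley–Eilenberg differential of the value of `η⁰` at
`1 / (t - z_m)^{b+1}`. -/
theorem act_etaZero_pole (m : Fin n) (b : ℕ) :
    act z M k (elt f (pole z m ^ (b + 1))) (vacTensor M k) -
      ∑ l ∈ range (b + 1),
        (act z M k (elt e (pole z m ^ (l + 1)))
            ((2 : ℂ) • ∑ q ∈ pairs (b - l), tensorAt M k m.castSucc (idxFF q.1 q.2)) +
          act z M k (elt h (pole z m ^ (l + 1))) (tensorAt M k m.castSucc (idxF (b - l)))) =
    (M m + (b + 1 : ℕ) * (k + 2)) • tensorAt M k m.castSucc (idxF (b + 1)) +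
      ∑ i, M i • (poleValue z m i ^ (b + 1) • tensorAt M k i.castSucc (idxF 0) -
        ∑ l ∈ range (b + 1), poleValue z m i ^ (l + 1) •
          tensorAt M k m.castSucc (idxF (b - l))) := by
  have h1 := congrArg (insertAt M k m.castSucc) (factorRep_sugawara (M := M) (k := k) m (b + 1))
  simp only [Nat.add_sub_add_right] at h1
  rw [map_sub, map_sum, map_smul] at h1
  simp only [sum_tensorAt]
  simp only [tensorAt_eq, act_f_pole, act_e_pole, act_h_pole]
  rw [← h1]
  simp only [smul_sub, Finset.sum_sub_distrib, Finset.smul_sum, Finset.sum_add_distrib, map_add,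
    smul_smul, Finset.sum_smul]
  rw [Finset.sum_comm (s := univ)]
  abel

theorem act_f_coord (b : ℕ) : act z M k (elt f (coord z ^ b)) (vacTensor M k) =
    insertAt M k (Fin.last n) (factorRep M k (Fin.last n) (T (-(b : ℤ)) e)
      (factorVec M k (Fin.last n) idxV)) +
    ∑ i, (M i * z i ^ b) • tensorAt M k i.castSucc (idxF 0) := by
  rw [act_vacTensor, Fin.sum_univ_castSucc, localAct_single z (expand_coord_pow z b), twist_last,
    flip_f, add_comm]
  congr 1
  refine Finset.sum_congr rfl fun i _ => ?_
  rw [localAct_f_vac z ((hasValue_coord z i).pow b), map_smul, tensorAt_eq, mul_comm]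

theorem act_e_coord (l : ℕ) (φ : Factor M k (Fin.last n)) :
    act z M k (elt e (coord z ^ l)) (insertAt M k (Fin.last n) φ) =
      insertAt M k (Fin.last n) (factorRep M k (Fin.last n) (T (-(l : ℤ)) f) φ) := by
  rw [act_insertAt z _ _ _ _ (fun _ => 0) rfl, Finset.sum_const_zero, zero_smul, add_zero,
    localAct_single z (expand_coord_pow z l), twist_last, flip_e]
  intro q hq
  rw [zero_smul]
  induction q using Fin.lastCases with
  | last => exact absurd rfl hq
  | cast i => exact localAct_e_vac z ((hasValue_coord z i).pow l)

theorem act_h_coord (l : ℕ) (φ : Factor M k (Fin.last n)) :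
    act z M k (elt h (coord z ^ (l + 1))) (insertAt M k (Fin.last n) φ) =
      -insertAt M k (Fin.last n) (factorRep M k (Fin.last n) (T (-((l : ℤ) + 1)) h) φ) +
        (∑ i, M i * z i ^ (l + 1)) • insertAt M k (Fin.last n) φ := by
  rw [act_insertAt z _ _ _ _ (Fin.lastCases (motive := fun _ => ℂ) 0
    fun i => M i * z i ^ (l + 1)), Fin.sum_univ_castSucc, Fin.lastCases_last, add_zero,
    localAct_single z (expand_coord_pow z (l + 1)), twist_last, flip_h, Nat.cast_succ, map_neg,
    map_neg, LinearMap.neg_apply, map_neg]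
  · simp only [Fin.lastCases_castSucc]
  · rw [Fin.lastCases_last]
  intro q hq
  induction q using Fin.lastCases with
  | last => exact absurd rfl hq
  | cast i =>
    rw [Fin.lastCases_castSucc, mul_comm]
    exact localAct_h_vac z ((hasValue_coord z i).pow (l + 1))

/-- The image under the Chevalley–Eilenberg differential of the value of `η⁰` at `t^{b+1}`. -/
theorem act_etaZero_coord (b : ℕ) :
    act z M k (elt f (coord z ^ (b + 1))) (vacTensor M k) -
      ∑ l ∈ range b,
        (act z M k (elt e (coord z ^ l))
            ((2 : ℂ) • ∑ q ∈ pairs (b - (l + 1)), tensorAt M k (Fin.last n) (idxEE q.1 q.2)) +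
          act z M k (elt h (coord z ^ (l + 1)))
            (tensorAt M k (Fin.last n) (idxE (b - (l + 1))))) =
    ((b + 1) * (k + 2) - ∑ i, M i) • tensorAt M k (Fin.last n) (idxE b) +
      ∑ i, M i • (z i ^ (b + 1) • tensorAt M k i.castSucc (idxF 0) -
        ∑ l ∈ range b, z i ^ (l + 1) • tensorAt M k (Fin.last n) (idxE (b - (l + 1)))) := by
  have h1 := congrArg (insertAt M k (Fin.last n)) (factorRep_sugawara_last (M := M) (k := k) b)
  rw [map_sub, map_sum, map_smul] at h1
  simp only [sum_tensorAt]
  simp only [tensorAt_eq, act_f_coord, act_e_coord, act_h_coord, Nat.cast_succ]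
  rw [← h1]
  simp only [smul_sub, Finset.sum_sub_distrib, Finset.smul_sum, Finset.sum_add_distrib, map_sub,
    smul_smul, Finset.sum_smul, Finset.sum_neg_distrib]
  rw [Finset.sum_comm (s := univ)]
  abel

theorem act_etaZero_one : act z M k (elt f 1) (vacTensor M k) =
    ∑ i, M i • tensorAt M k i.castSucc (idxF 0) := by
  have h1 := act_f_coord z (M := M) (k := k) 0
  have h2 : factorRep M k (Fin.last n) (T 0 e) (factorVec M k (Fin.last n) idxV) = 0 :=
    contraRep_e_vac le_rfl
  rw [Nat.cast_zero, neg_zero, h2, map_zero, zero_add] at h1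
  simpa only [pow_zero, mul_one] using h1

end Differential

/-! ### Functions and differential forms on the punctured line -/

section Forms

open Finset

variable {n : ℕ} (z : Fin n ↪ ℂ)

/-- The elementary functions: `t^b` and `1 / (t - z_m)^{b+1}`. -/
def elem : ℕ ⊕ Fin n × ℕ → Reg z :=
  Sum.elim (fun b => coord z ^ b) fun q => pole z q.1 ^ (q.2 + 1)

/-- The coefficients of the principal parts of the Laurent expansions of a function. -/
def principalParts : Reg z →ₗ[ℂ] (ℕ ⊕ Fin n × ℕ → ℂ) where
  toFun g := Sum.elim (fun b => (expand z (Fin.last n) g).coeff (-(b : ℤ)))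
    fun q => (expand z q.1.castSucc g).coeff (-((q.2 + 1 : ℕ) : ℤ))
  map_add' g g' := by
    ext (b | q) <;> simp only [Sum.elim_inl, Sum.elim_inr, Pi.add_apply, map_add,
      HahnSeries.coeff_add]
  map_smul' r g := by
    ext (b | q) <;> simp only [Sum.elim_inl, Sum.elim_inr, Pi.smul_apply, expand_smul,
      HahnSeries.coeff_smul, RingHom.id_apply]

theorem principalParts_elem (x : ℕ ⊕ Fin n × ℕ) :
    principalParts z (elem z x) = Pi.single x 1 := by
  rcases x with b | ⟨m, b⟩
  · ext (b' | ⟨i, b'⟩)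
    · change (expand z (Fin.last n) (coord z ^ b)).coeff (-(b' : ℤ)) = _
      rw [expand_coord_pow, HahnSeries.coeff_single, Pi.single_apply]
      simp
    · change (expand z i.castSucc (coord z ^ b)).coeff (-((b' + 1 : ℕ) : ℤ)) = _
      rw [((hasValue_coord z i).pow b).coeff_of_neg (by push_cast; omega)]
      simp
  · ext (b' | ⟨i, b'⟩)
    · change (expand z (Fin.last n) (pole z m ^ (b + 1))).coeff (-(b' : ℤ)) = _
      have h1 := hasValue_pole_pow_last z m b
      rcases b' with _ | b'
      · rw [Nat.cast_zero, neg_zero, h1.coeff_zero]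
        simp
      · rw [h1.coeff_of_neg (by push_cast; omega)]
        simp
    · change (expand z i.castSucc (pole z m ^ (b + 1))).coeff (-((b' + 1 : ℕ) : ℤ)) = _
      by_cases hi : i = m
      · subst hi
        rw [expand_pole_pow, HahnSeries.coeff_single, Pi.single_apply]
        simp
      · rw [((hasValue_pole z hi).pow (b + 1)).coeff_of_neg (by push_cast; omega)]
        simp [hi]

theorem linearIndependent_elem : LinearIndependent ℂ (elem z) := by
  refine LinearIndependent.of_comp (principalParts z) ?_
  rw [show principalParts z ∘ elem z = fun x => Pi.single x 1 from
    funext (principalParts_elem z)]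
  exact Pi.linearIndependent_single_one _ ℂ

theorem range_elem : Set.range (elem z) = elementary z := by
  ext g
  constructor
  · rintro ⟨b | q, rfl⟩
    · exact Or.inl ⟨b, rfl⟩
    · exact Or.inr ⟨q.1, q.2, rfl⟩
  · rintro (⟨b, rfl⟩ | ⟨m, b, rfl⟩)
    · exact ⟨Sum.inl b, rfl⟩
    · exact ⟨Sum.inr (m, b), rfl⟩

/-- Partial fractions: the basis of elementary functions. -/
def regBasis : Module.Basis (ℕ ⊕ Fin n × ℕ) ℂ (Reg z) :=
  Module.Basis.mk (linearIndependent_elem z) (by rw [range_elem, span_elementary])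

theorem regBasis_apply (x : ℕ ⊕ Fin n × ℕ) : regBasis z x = elem z x :=
  Module.Basis.mk_apply _ _ x

/-- The form `dt`. -/
def dt : Forms z := dRham z (coord z)

theorem dRham_pole (m : Fin n) : dRham z (pole z m) = -(pole z m ^ 2 • dt z) := by
  have h1 := congrArg (dRham z) (coord_mul_pole z m)
  rw [Derivation.leibniz, map_add, Derivation.map_one_eq_zero, zero_add, Derivation.map_smul] at h1
  have h2 := congrArg (pole z m • ·) h1
  have h3 : pole z m * coord z = 1 + z m • pole z m := by rw [mul_comm, coord_mul_pole]
  simp only [smul_add, smul_smul, h3, add_smul, one_smul] at h2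
  rw [← smul_comm (z m) (pole z m), smul_assoc] at h2
  rw [eq_neg_iff_add_eq_zero, pow_two]
  have h4 := sub_eq_zero.mpr h2
  rw [← h4, dt]
  abel

theorem dRham_pole_pow (m : Fin n) (b : ℕ) :
    dRham z (pole z m ^ (b + 1)) = -((b + 1 : ℕ) : ℂ) • (pole z m ^ (b + 2) • dt z) := by
  rw [Derivation.leibniz_pow, dRham_pole, Nat.add_sub_cancel, smul_neg, smul_smul, ← pow_add,
    smul_neg, neg_smul, Nat.cast_smul_eq_nsmul]

theorem dRham_coord_pow (b : ℕ) :
    dRham z (coord z ^ (b + 1)) = ((b + 1 : ℕ) : ℂ) • (coord z ^ b • dt z) := by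
  rw [Derivation.leibniz_pow, Nat.add_sub_cancel, Nat.cast_smul_eq_nsmul]
  rfl

/-- Every form is a function times `dt`. -/
theorem smul_dt_surjective (ω : Forms z) : ∃ g : Reg z, g • dt z = ω := by
  have hD : ∀ g : Reg z, dRham z g ∈ Submodule.span (Reg z) {dt z} := by
    have h1 : ∀ (g : Reg z), g • dt z ∈ (Submodule.span (Reg z) {dt z}).restrictScalars ℂ :=
      fun g => Submodule.smul_mem _ g (Submodule.mem_span_singleton_self _)
    suffices hle : Submodule.span ℂ (elementary z) ≤
        ((Submodule.span (Reg z) {dt z}).restrictScalars ℂ).comap (dRham z : Reg z →ₗ[ℂ] Forms z) by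
      intro g
      exact hle (by rw [span_elementary]; trivial)
    refine Submodule.span_le.mpr ?_
    rintro _ (⟨b, rfl⟩ | ⟨m, b, rfl⟩)
    · rcases b with _ | b
      · change dRham z (coord z ^ 0) ∈ Submodule.span (Reg z) {dt z}
        rw [pow_zero, Derivation.map_one_eq_zero]
        exact Submodule.zero_mem _
      · change dRham z (coord z ^ (b + 1)) ∈
          (Submodule.span (Reg z) {dt z}).restrictScalars ℂ
        rw [dRham_coord_pow]
        exact Submodule.smul_mem _ _ (h1 _)
    · change dRham z (pole z m ^ (b + 1)) ∈
        (Submodule.span (Reg z) {dt z}).restrictScalars ℂ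
      rw [dRham_pole_pow]
      exact Submodule.smul_mem _ _ (h1 _)
  have h2 : (⊤ : Submodule (Reg z) (Forms z)) ≤ Submodule.span (Reg z) {dt z} := by
    rw [← show Submodule.span (Reg z) (Set.range (dRham z)) = ⊤ from
      KaehlerDifferential.span_range_derivation ℂ (Reg z)]
    refine Submodule.span_le.mpr ?_
    rintro _ ⟨g, rfl⟩
    exact hD g
  exact Submodule.mem_span_singleton.mp (h2 (Submodule.mem_top (x := ω)))

/-- A copy of the Laurent series, as a module over the regular functions through the expansion at
infinity. -/
def SeriesAtInfinity {n : ℕ} (_ : Fin n ↪ ℂ) : Type := LaurentSeries ℂ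

instance : AddCommGroup (SeriesAtInfinity z) := inferInstanceAs (AddCommGroup (LaurentSeries ℂ))

instance : Module ℂ (SeriesAtInfinity z) := inferInstanceAs (Module ℂ (LaurentSeries ℂ))

instance : Module (Reg z) (SeriesAtInfinity z) :=
  Module.compHom (LaurentSeries ℂ) (expand z (Fin.last n))

instance : IsScalarTower ℂ (Reg z) (SeriesAtInfinity z) where
  smul_assoc r g u := by
    have h1 : ∀ v w : LaurentSeries ℂ, r • v * w = r • (v * w) := fun v w => by
      rw [← HahnSeries.C_mul_eq_smul, mul_assoc, HahnSeries.C_mul_eq_smul]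
    exact (congrArg (· * (show LaurentSeries ℂ from u)) (expand_smul z (Fin.last n) r g)).trans
      (h1 _ _)

/-- The derivation `T d/dT` applied to the expansion at infinity. -/
def eulerDerivation : Derivation ℂ (Reg z) (SeriesAtInfinity z) :=
  Derivation.mk'
    { toFun := fun g => (euler (expand z (Fin.last n) g) : LaurentSeries ℂ)
      map_add' := fun g g' => by rw [map_add, euler_add]; rfl
      map_smul' := fun r g => by rw [expand_smul, euler_smul]; rfl }
    fun g g' => by
      change euler (expand z (Fin.last n) (g * g')) =
        expand z (Fin.last n) g * euler (expand z (Fin.last n) g') +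
          expand z (Fin.last n) g' * euler (expand z (Fin.last n) g)
      rw [map_mul, euler_mul]
      ring

/-- The linear map on forms that corresponds to the derivation `eulerDerivation`. -/
def eulerForms : Forms z →ₗ[Reg z] SeriesAtInfinity z :=
  (eulerDerivation z).liftKaehlerDifferential

theorem eulerForms_dt : eulerForms z (dt z) = eulerDerivation z (coord z) :=
  (eulerDerivation z).liftKaehlerDifferential_comp_D (coord z)

theorem smul_dt_injective {g : Reg z} (hg : g • dt z = 0) : g = 0 := by
  have h1 := congrArg (eulerForms z) hg
  rw [map_smul, map_zero, eulerForms_dt] at h1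
  have h3 : expand z (Fin.last n) g * euler (localCoord z (Fin.last n)) = 0 := by
    rw [← expand_coord]
    exact h1
  have h4 : euler (localCoord z (Fin.last n)) ≠ 0 := by
    intro h0
    have := congrArg (fun u => HahnSeries.coeff u (-1)) h0
    rw [localCoord_last] at this
    simp [euler_coeff] at this
  have h5 : expandRat z (Fin.last n) g.val = 0 := (mul_eq_zero.mp h3).resolve_right h4
  exact Subtype.ext ((map_eq_zero _).mp h5)

/-- The space of forms is identified with the space of functions through `g ↦ g dt`. -/
def formsEquiv : Reg z ≃ₗ[ℂ] Forms z :=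
  LinearEquiv.ofBijective
    ((LinearMap.toSpanSingleton (Reg z) (Forms z) (dt z)).restrictScalars ℂ)
    ⟨(injective_iff_map_eq_zero _).mpr fun _ hg => smul_dt_injective z hg, smul_dt_surjective z⟩

theorem formsEquiv_apply (g : Reg z) : formsEquiv z g = g • dt z := rfl

theorem pole_pow_mul_pole {m i : Fin n} (hi : i ≠ m) (b : ℕ) : pole z m ^ b * pole z i =
    poleValue z m i ^ b • pole z i -
      ∑ l ∈ range b, poleValue z m i ^ (l + 1) • pole z m ^ (b - l) := by
  induction b with
  | zero => simp
  | succ b ih =>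
    have h1 : pole z m * pole z i = poleValue z m i • pole z i - poleValue z m i • pole z m := by
      rw [mul_comm, pole_mul_pole z hi, smul_sub]
      rfl
    have h2 : ∑ l ∈ range b, pole z m * poleValue z m i ^ (l + 1) • pole z m ^ (b - l) =
        ∑ l ∈ range b, poleValue z m i ^ (l + 1) • pole z m ^ (b + 1 - l) := by
      refine Finset.sum_congr rfl fun l hl => ?_
      rw [mul_smul_comm, ← pow_succ', Nat.succ_sub (mem_range.mp hl).le]
    rw [pow_succ', mul_assoc, ih, mul_sub, mul_smul_comm, h1, Finset.mul_sum, h2,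
      Finset.sum_range_succ, Nat.add_sub_cancel_left, pow_one, smul_sub, smul_smul, smul_smul,
      ← pow_succ]
    abel

theorem coord_pow_mul_pole (i : Fin n) (b : ℕ) : coord z ^ (b + 1) * pole z i =
    z i ^ (b + 1) • pole z i + coord z ^ b +
      ∑ l ∈ range b, z i ^ (l + 1) • coord z ^ (b - (l + 1)) := by
  induction b with
  | zero => simp [coord_mul_pole, add_comm]
  | succ b ih =>
    rw [pow_succ', mul_assoc, ih, mul_add, mul_add, mul_smul_comm, coord_mul_pole, Finset.mul_sum,
      Finset.sum_range_succ, Nat.sub_self, pow_zero, smul_add, smul_smul, ← pow_succ, ← pow_succ']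
    have h1 : ∑ l ∈ range b, coord z * z i ^ (l + 1) • coord z ^ (b - (l + 1)) =
        ∑ l ∈ range b, z i ^ (l + 1) • coord z ^ (b + 1 - (l + 1)) := by
      refine Finset.sum_congr rfl fun l hl => ?_
      have := mem_range.mp hl
      rw [mul_smul_comm, ← pow_succ', show b - (l + 1) + 1 = b + 1 - (l + 1) by omega]
    rw [h1]
    abel

end Forms

/-! ### Functionals on the tensor product -/

section Functionals

open Finset

variable {n : ℕ} {M : Fin n → ℂ} {k : ℂ}

/-- The evaluation of the functional `φ` at the vector `w` of the `p`-th Verma module. -/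
def evalFactor (p : Fin (n + 1)) (w : Verma (weight M p) k) : Factor M k p →ₗ[ℂ] ℂ :=
  (LinearMap.applyₗ w : Module.Dual ℂ (Verma (weight M p) k) →ₗ[ℂ] ℂ) ∘ₗ
    (contra (weight M p) k).subtype

theorem evalFactor_apply (p : Fin (n + 1)) (w : Verma (weight M p) k)
    (φ : Contra (weight M p) k) : evalFactor p w (φ : Factor M k p) = φ.val w := rfl

/-- The evaluation of `φ₁ ⊗ … ⊗ φ_{n+1}` at `y₁ ⊗ … ⊗ y_{n+1}`. -/
def evalTensor (y : ∀ p : Fin (n + 1), Verma (weight M p) k) : Coeff M k →ₗ[ℂ] ℂ :=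
  PiTensorProduct.lift ((MultilinearMap.mkPiAlgebra ℂ (Fin (n + 1)) ℂ).compLinearMap
    fun p => evalFactor p (y p))

theorem evalTensor_insertAt (y : ∀ p : Fin (n + 1), Verma (weight M p) k) (p : Fin (n + 1))
    (φ : Factor M k p) : evalTensor y (insertAt M k p φ) =
      evalFactor p (y p) φ * ∏ q ∈ univ.erase p, evalFactor q (y q) (factorVec M k q idxV) := by
  refine (PiTensorProduct.lift.tprod _).trans ?_
  rw [MultilinearMap.compLinearMap_apply, MultilinearMap.mkPiAlgebra_apply,
    ← Finset.mul_prod_erase _ _ (mem_univ p), Function.update_self]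
  congr 1
  refine Finset.prod_congr rfl fun q hq => ?_
  rw [Function.update_of_ne (ne_of_mem_erase hq)]

theorem dualForm_zero_vac {M k : ℂ} : dualForm M k 0 (vac M k) = 1 :=
  dualForm_monoF 0 [] [] []

theorem evalFactor_idxV_vac (p : Fin (n + 1)) :
    evalFactor p (vac (weight M p) k) (factorVec M k p idxV) = 1 := by
  rw [factorVec, evalFactor_apply, dualVec_idxV]
  exact dualForm_zero_vac

theorem evalFactor_idxV_fOp (p : Fin (n + 1)) (b : ℕ) (w : Verma (weight M p) k) :
    evalFactor p (fOp (weight M p) k b w) (factorVec M k p idxV) = 0 := by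
  rw [factorVec, evalFactor_apply, dualVec_idxV]
  exact dualForm_zero_fOp b w

theorem evalFactor_idxV_eOp (p : Fin (n + 1)) (b : ℕ) (w : Verma (weight M p) k) :
    evalFactor p (eOp (weight M p) k b w) (factorVec M k p idxV) = 0 := by
  rw [factorVec, evalFactor_apply, dualVec_idxV]
  exact dualForm_zero_eOp b w

theorem evalFactor_idxF (p : Fin (n + 1)) (a b : ℕ) :
    evalFactor p (fOp (weight M p) k b (vac (weight M p) k)) (factorVec M k p (idxF a)) =
      if b = a then 1 else 0 := by
  rw [factorVec, evalFactor_apply, dualVec_idxF]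
  exact (dualForm_singleton_fOp a b _).trans (by rw [dualForm_zero_vac])

theorem evalFactor_idxE (p : Fin (n + 1)) (a b : ℕ) :
    evalFactor p (eOp (weight M p) k b (vac (weight M p) k)) (factorVec M k p (idxE a)) =
      if b = a then 1 else 0 := by
  obtain ⟨τ, hτ⟩ := exists_isSwap (M := weight M p) (M' := k - weight M p) (k := k) (by ring)
  rw [factorVec, evalFactor_apply, dualVec_idxE hτ]
  change dualForm _ k {a} (τ (eOp (weight M p) k b (vac (weight M p) k))) = _
  rw [hτ.map_eOp, hτ.1, dualForm_singleton_fOp, dualForm_zero_vac]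

variable (M k) in
/-- The tensors with one excited factor in which `η¹` takes its values. -/
def excited : ℕ ⊕ Fin n × ℕ → Coeff M k :=
  Sum.elim (fun b => tensorAt M k (Fin.last n) (idxE b))
    fun q => tensorAt M k q.1.castSucc (idxF q.2)

/-- The vectors dual to `excited`. -/
def excitedDual : ℕ ⊕ Fin n × ℕ → ∀ p : Fin (n + 1), Verma (weight M p) k :=
  Sum.elim
    (fun b => Function.update (fun p => vac (weight M p) k) (Fin.last n)
      (eOp (weight M (Fin.last n)) k b (vac _ k)))
    fun q => Function.update (fun p => vac (weight M p) k) q.1.castSucc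
      (fOp (weight M q.1.castSucc) k q.2 (vac _ k))

theorem evalTensor_update_self (p : Fin (n + 1)) (w : Verma (weight M p) k) (φ : Factor M k p) :
    evalTensor (Function.update (fun p => vac (weight M p) k) p w) (insertAt M k p φ) =
      evalFactor p w φ := by
  rw [evalTensor_insertAt, Function.update_self, Finset.prod_eq_one, mul_one]
  intro q hq
  rw [Function.update_of_ne (ne_of_mem_erase hq), evalFactor_idxV_vac]

theorem evalTensor_update_of_ne {p q : Fin (n + 1)} (hq : q ≠ p) {w : Verma (weight M q) k}
    (hw : evalFactor q w (factorVec M k q idxV) = 0) (φ : Factor M k p) :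
    evalTensor (Function.update (fun p => vac (weight M p) k) q w) (insertAt M k p φ) = 0 := by
  rw [evalTensor_insertAt, Finset.prod_eq_zero (mem_erase.mpr ⟨hq, mem_univ q⟩), mul_zero]
  rw [Function.update_self, hw]

theorem evalTensor_excited (x y : ℕ ⊕ Fin n × ℕ) :
    evalTensor (excitedDual x) (excited M k y) = if x = y then 1 else 0 := by
  rcases x with b | ⟨m, b⟩
  · rcases y with a | ⟨i, a⟩
    · refine (evalTensor_update_self _ _ _).trans ((evalFactor_idxE _ a b).trans ?_)
      simp
    · refine (evalTensor_update_of_ne (Fin.castSucc_lt_last i).ne' (evalFactor_idxV_eOp _ _ _)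
        _).trans ?_
      simp
  · rcases y with a | ⟨i, a⟩
    · refine (evalTensor_update_of_ne (Fin.castSucc_lt_last m).ne (evalFactor_idxV_fOp _ _ _)
        _).trans ?_
      simp
    · by_cases hm : m = i
      · subst hm
        refine (evalTensor_update_self _ _ _).trans ((evalFactor_idxF _ a b).trans ?_)
        simp
      · refine (evalTensor_update_of_ne (fun hh => hm (Fin.castSucc_injective n hh))
          (evalFactor_idxV_fOp _ _ _) _).trans ?_
        simp [hm]

theorem evalTensor_vac : evalTensor (fun p => vac (weight M p) k) (vacTensor M k) = 1 := by
  rw [← insertAt_idxV M k 0, evalTensor_insertAt, evalFactor_idxV_vac, one_mul]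
  exact Finset.prod_eq_one fun q _ => evalFactor_idxV_vac q

end Functionals

/-! ### The maps `η⁰` and `η¹` -/

section Maps

open Finset

variable {n : ℕ} (z : Fin n ↪ ℂ) (M : Fin n → ℂ) (k : ℂ)

theorem existsUnique_of_basis {ι V W : Type*} [AddCommGroup V] [Module ℂ V] [AddCommGroup W]
    [Module ℂ W] (B : Module.Basis ι ℂ V) (v : ι → W) : ∃! η : V →ₗ[ℂ] W, ∀ x, η (B x) = v x :=
  ⟨B.constr ℂ v, fun x => B.constr_basis ℂ v x,
    fun _ hη => B.ext fun x => (hη x).trans (B.constr_basis ℂ v x).symm⟩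

/-- The scalars in the formulas for `η¹`. -/
def etaSign : ℕ ⊕ Fin n × ℕ → ℂ := Sum.elim (fun _ => k + 2) fun _ => -(k + 2)

theorem isEtaOne_iff (η₁ : Forms z →ₗ[ℂ] Coeff M k) : IsEtaOne z M k η₁ ↔
    ∀ x, η₁ ((regBasis z).map (formsEquiv z) x) = etaSign k x • excited M k x := by
  have hB : ∀ x, (regBasis z).map (formsEquiv z) x = elem z x • dt z := fun x => by
    rw [Module.Basis.map_apply, regBasis_apply, formsEquiv_apply]
  simp only [hB]
  exact ⟨fun hη x => Sum.rec (fun b => hη.2 b) (fun q => hη.1 q.1 q.2) x,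
    fun hη => ⟨fun m b => hη (Sum.inr (m, b)), fun b => hη (Sum.inl b)⟩⟩

/-- The right-hand sides of the formulas for `η⁰`. -/
def etaZeroValue : ℕ ⊕ Fin n × ℕ → SlU z ⊗[ℂ] Coeff M k
  | Sum.inl 0 => elt f 1 ⊗ₜ[ℂ] vacTensor M k
  | Sum.inl (b + 1) => elt f (coord z ^ (b + 1)) ⊗ₜ[ℂ] vacTensor M k -
      ∑ l ∈ range b,
        (elt e (coord z ^ l) ⊗ₜ[ℂ]
            ((2 : ℂ) • ∑ q ∈ pairs (b - (l + 1)), tensorAt M k (Fin.last n) (idxEE q.1 q.2)) +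
          elt h (coord z ^ (l + 1)) ⊗ₜ[ℂ] tensorAt M k (Fin.last n) (idxE (b - (l + 1))))
  | Sum.inr (m, b) => elt f (pole z m ^ (b + 1)) ⊗ₜ[ℂ] vacTensor M k -
      ∑ l ∈ range (b + 1),
        (elt e (pole z m ^ (l + 1)) ⊗ₜ[ℂ]
            ((2 : ℂ) • ∑ q ∈ pairs (b - l), tensorAt M k m.castSucc (idxFF q.1 q.2)) +
          elt h (pole z m ^ (l + 1)) ⊗ₜ[ℂ] tensorAt M k m.castSucc (idxF (b - l)))

theorem isEtaZero_iff (η₀ : Reg z →ₗ[ℂ] SlU z ⊗[ℂ] Coeff M k) : IsEtaZero z M k η₀ ↔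
    ∀ x, η₀ (regBasis z x) = etaZeroValue z M k x := by
  simp only [regBasis_apply]
  constructor
  · rintro ⟨hpole, hone, hcoord, hpow⟩ x
    rcases x with b | ⟨m, b⟩
    · rcases b with _ | _ | b
      · rw [show elem z (Sum.inl 0) = 1 from pow_zero _, hone]
        rfl
      · rw [show elem z (Sum.inl (0 + 1)) = coord z from pow_one _, hcoord, etaZeroValue,
          range_zero, sum_empty, sub_zero, zero_add, pow_one]
      · refine (hpow b).trans ?_
        simp only [etaZeroValue, Nat.add_sub_add_right]
    · exact hpole m b
  · intro hη
    refine ⟨fun m b => hη (Sum.inr (m, b)), ?_, ?_, fun b => ?_⟩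
    · rw [← show elem z (Sum.inl 0) = 1 from pow_zero _, hη]
      rfl
    · have := hη (Sum.inl 1)
      rw [show elem z (Sum.inl 1) = coord z from pow_one _] at this
      rw [this, etaZeroValue, range_zero, sum_empty, sub_zero, zero_add, pow_one]
    · refine (hη (Sum.inl (b + 2))).trans ?_
      simp only [etaZeroValue, Nat.add_sub_add_right]

variable {z M k}

theorem injective_of_isEtaOne (hk : k + 2 ≠ 0) {η₁ : Forms z →ₗ[ℂ] Coeff M k}
    (hη : IsEtaOne z M k η₁) : Function.Injective η₁ := by
  rw [isEtaOne_iff] at hη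
  set B := (regBasis z).map (formsEquiv z)
  rw [injective_iff_map_eq_zero]
  intro ω hω
  refine B.ext_elem fun x => ?_
  have h1 : evalTensor (excitedDual x) ∘ₗ η₁ = etaSign k x • B.coord x := by
    refine B.ext fun y => ?_
    rw [LinearMap.comp_apply, hη, map_smul, evalTensor_excited, LinearMap.smul_apply,
      Module.Basis.coord_apply, Module.Basis.repr_self, Finsupp.single_apply]
    by_cases hxy : x = y
    · subst hxy; simp
    · rw [if_neg hxy, if_neg (Ne.symm hxy), smul_zero, smul_zero]
  have h2 := LinearMap.congr_fun h1 ω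
  rw [LinearMap.comp_apply, hω, map_zero, LinearMap.smul_apply, Module.Basis.coord_apply,
    smul_eq_mul] at h2
  have h3 : etaSign k x ≠ 0 := by
    rcases x with b | q
    · exact hk
    · exact neg_ne_zero.mpr hk
  rw [(mul_eq_zero.mp h2.symm).resolve_left h3, map_zero, Finsupp.zero_apply]

/-- The function that a `sl₂`-valued function has as its coefficient at `f`. -/
def fCoeff : SlU z →ₗ[ℂ] Reg z :=
  (TensorProduct.rid ℂ (Reg z)).toLinearMap ∘ₗ LinearMap.lTensor (Reg z)
    { toFun := fun a : Sl2 => a.val 1 0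
      map_add' := fun _ _ => rfl
      map_smul' := fun _ _ => rfl }

/-- A left inverse of `η⁰`: it reads off the component of `f ⊗ v₁^* ⊗ … ⊗ v_{n+1}^*`. -/
def retract : SlU z ⊗[ℂ] Coeff M k →ₗ[ℂ] Reg z :=
  (TensorProduct.rid ℂ (Reg z)).toLinearMap ∘ₗ
    TensorProduct.map fCoeff (evalTensor fun p => vac (weight M p) k)

theorem retract_tmul (a : Sl2) (g : Reg z) (w : Coeff M k) :
    retract (elt a g ⊗ₜ[ℂ] w) =
      evalTensor (fun p => vac (weight M p) k) w • a.val 1 0 • g := rfl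

theorem retract_f (g : Reg z) : retract (elt f g ⊗ₜ[ℂ] vacTensor M k) = g := by
  rw [retract_tmul, evalTensor_vac, one_smul, f_val]
  simp

theorem retract_e (g : Reg z) (w : Coeff M k) : retract (elt e g ⊗ₜ[ℂ] w) = 0 := by
  rw [retract_tmul, e_val]
  simp

theorem retract_h (g : Reg z) (w : Coeff M k) : retract (elt h g ⊗ₜ[ℂ] w) = 0 := by
  rw [retract_tmul, h_val]
  simp

theorem injective_of_isEtaZero {η₀ : Reg z →ₗ[ℂ] SlU z ⊗[ℂ] Coeff M k}
    (hη : IsEtaZero z M k η₀) : Function.Injective η₀ := by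
  rw [isEtaZero_iff] at hη
  have h1 : retract ∘ₗ η₀ = LinearMap.id := by
    refine (regBasis z).ext fun x => ?_
    rw [LinearMap.comp_apply, hη, LinearMap.id_apply, regBasis_apply]
    rcases x with (_ | b) | ⟨m, b⟩
    · rw [etaZeroValue, retract_f]
      exact (pow_zero _).symm
    · rw [etaZeroValue, map_sub, map_sum, retract_f, Finset.sum_eq_zero, sub_zero]
      · rfl
      · intro l _
        rw [map_add, retract_e, retract_h, add_zero]
    · rw [etaZeroValue, map_sub, map_sum, retract_f, Finset.sum_eq_zero, sub_zero]
      · rfl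
      · intro l _
        rw [map_add, retract_e, retract_h, add_zero]
  exact Function.LeftInverse.injective (g := retract) fun g => LinearMap.congr_fun h1 g

variable (z M k) in
/-- The right end `x ⊗ w ↦ x w` of the Chevalley–Eilenberg complex. -/
def actTensor : SlU z ⊗[ℂ] Coeff M k →ₗ[ℂ] Coeff M k :=
  TensorProduct.lift (act z M k : SlU z →ₗ[ℂ] Module.End ℂ (Coeff M k))

theorem actTensor_tmul (x : SlU z) (w : Coeff M k) :
    actTensor z M k (x ⊗ₜ[ℂ] w) = act z M k x w := rfl

theorem ceD_ceOne_eq (u : SlU z ⊗[ℂ] Coeff M k) :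
    ceD (act z M k) 0 (ceOne (SlU z) (Coeff M k) u) =
      ceZero (SlU z) (Coeff M k) (actTensor z M k u) := by
  induction u using TensorProduct.induction_on with
  | zero => simp only [map_zero]
  | add u v hu hv => simp only [map_add, hu, hv]
  | tmul x w => exact ceD_ceOne _ x w

theorem etaOne_twistedD (η₁ : Forms z →ₗ[ℂ] Coeff M k) (g : Reg z) :
    η₁ (twistedD z M k g) = η₁ (dRham z g) -
      (k + 2)⁻¹ • ∑ i, M i • η₁ ((g * pole z i) • dt z) := by
  have h1 : g • alpha z M k = -((k + 2)⁻¹ • ∑ i, M i • ((g * pole z i) • dt z)) := by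
    rw [alpha, neg_smul, smul_neg, smul_comm g, Finset.smul_sum]
    simp only [smul_comm g, mul_smul]
    rfl
  rw [twistedD_apply, h1, map_add, map_neg, ← sub_eq_add_neg, map_smul, map_sum]
  simp only [map_smul]

theorem etaOne_pole {η₁ : Forms z →ₗ[ℂ] Coeff M k} (hη : IsEtaOne z M k η₁) (m : Fin n) (b : ℕ) :
    η₁ (pole z m ^ (b + 1) • dt z) = -(k + 2) • tensorAt M k m.castSucc (idxF b) := hη.1 m b

theorem etaOne_coord {η₁ : Forms z →ₗ[ℂ] Coeff M k} (hη : IsEtaOne z M k η₁) (b : ℕ) :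
    η₁ (coord z ^ b • dt z) = (k + 2) • tensorAt M k (Fin.last n) (idxE b) := hη.2 b

theorem etaOne_twistedD_one (hk : k + 2 ≠ 0) {η₁ : Forms z →ₗ[ℂ] Coeff M k}
    (hη : IsEtaOne z M k η₁) : η₁ (twistedD z M k 1) =
      ∑ i, M i • tensorAt M k i.castSucc (idxF 0) := by
  have h1 : ∀ i, η₁ ((1 * pole z i) • dt z) = -(k + 2) • tensorAt M k i.castSucc (idxF 0) :=
    fun i => by rw [one_mul, ← etaOne_pole hη, zero_add, pow_one]
  rw [etaOne_twistedD, Derivation.map_one_eq_zero, map_zero, zero_sub, Finset.smul_sum,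
    ← Finset.sum_neg_distrib]
  refine Finset.sum_congr rfl fun i _ => ?_
  rw [h1, smul_comm (M i), neg_smul, smul_neg, neg_neg, inv_smul_smul₀ hk]

theorem etaOne_twistedD_coord (hk : k + 2 ≠ 0) {η₁ : Forms z →ₗ[ℂ] Coeff M k}
    (hη : IsEtaOne z M k η₁) (b : ℕ) : η₁ (twistedD z M k (coord z ^ (b + 1))) =
    ((b + 1) * (k + 2) - ∑ i, M i) • tensorAt M k (Fin.last n) (idxE b) +
      ∑ i, M i • (z i ^ (b + 1) • tensorAt M k i.castSucc (idxF 0) -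
        ∑ l ∈ range b, z i ^ (l + 1) • tensorAt M k (Fin.last n) (idxE (b - (l + 1)))) := by
  have h0 : ∀ i, η₁ (pole z i • dt z) = -(k + 2) • tensorAt M k i.castSucc (idxF 0) :=
    fun i => by rw [← etaOne_pole hη, zero_add, pow_one]
  have h1 : ∀ i, η₁ ((coord z ^ (b + 1) * pole z i) • dt z) =
      (k + 2) • (tensorAt M k (Fin.last n) (idxE b) -
        (z i ^ (b + 1) • tensorAt M k i.castSucc (idxF 0) -
        ∑ l ∈ range b, z i ^ (l + 1) • tensorAt M k (Fin.last n) (idxE (b - (l + 1))))) := by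
    intro i
    rw [coord_pow_mul_pole, add_smul, add_smul, Finset.sum_smul, map_add, map_add, map_sum,
      smul_assoc, map_smul, h0, etaOne_coord hη]
    simp only [smul_assoc, map_smul, etaOne_coord hη, smul_comm _ (k + 2), ← Finset.smul_sum]
    module
  rw [etaOne_twistedD, dRham_coord_pow, map_smul, etaOne_coord hη]
  simp only [h1, smul_comm _ (k + 2), ← Finset.smul_sum]
  rw [smul_inv_smul₀ hk]
  simp only [smul_sub (M _), Finset.sum_sub_distrib, ← Finset.sum_smul]
  push_cast
  module

theorem etaOne_twistedD_pole (hk : k + 2 ≠ 0) {η₁ : Forms z →ₗ[ℂ] Coeff M k}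
    (hη : IsEtaOne z M k η₁) (m : Fin n) (b : ℕ) :
    η₁ (twistedD z M k (pole z m ^ (b + 1))) =
    (M m + (b + 1 : ℕ) * (k + 2)) • tensorAt M k m.castSucc (idxF (b + 1)) +
      ∑ i, M i • (poleValue z m i ^ (b + 1) • tensorAt M k i.castSucc (idxF 0) -
        ∑ l ∈ range (b + 1), poleValue z m i ^ (l + 1) •
          tensorAt M k m.castSucc (idxF (b - l))) := by
  have h0 : ∀ i, η₁ (pole z i • dt z) = -(k + 2) • tensorAt M k i.castSucc (idxF 0) :=
    fun i => by rw [← etaOne_pole hη, zero_add, pow_one]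
  have h1 : ∀ i, η₁ ((pole z m ^ (b + 1) * pole z i) • dt z) =
      -(k + 2) • ((if m = i then tensorAt M k m.castSucc (idxF (b + 1)) else 0) +
        (poleValue z m i ^ (b + 1) • tensorAt M k i.castSucc (idxF 0) -
        ∑ l ∈ range (b + 1), poleValue z m i ^ (l + 1) •
          tensorAt M k m.castSucc (idxF (b - l)))) := by
    intro i
    by_cases hi : m = i
    · subst hi
      rw [if_pos rfl, ← pow_succ, etaOne_pole hη, poleValue_self]
      simp
    · have h2 : ∀ l ∈ range (b + 1), η₁ ((poleValue z m i ^ (l + 1) • pole z m ^ (b + 1 - l)) •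
          dt z) = -(k + 2) • poleValue z m i ^ (l + 1) • tensorAt M k m.castSucc (idxF (b - l)) := by
        intro l hl
        rw [Nat.succ_sub (Nat.lt_succ_iff.mp (mem_range.mp hl)), smul_assoc, map_smul,
          etaOne_pole hη, smul_comm]
      rw [if_neg hi, zero_add, pole_pow_mul_pole z (Ne.symm hi), sub_smul, Finset.sum_smul, map_sub,
        map_sum, smul_assoc, map_smul, h0, Finset.sum_congr rfl h2, ← Finset.smul_sum,
        smul_comm _ (-(k + 2)), ← smul_sub]
  rw [etaOne_twistedD, dRham_pole_pow, map_smul, etaOne_pole hη]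
  simp only [h1, smul_comm _ (-(k + 2)), ← Finset.smul_sum]
  simp only [neg_smul (k + 2), smul_inv_smul₀ hk]
  simp only [smul_add (M _), Finset.sum_add_distrib, smul_ite, smul_zero, Finset.sum_ite_eq,
    mem_univ, if_true]
  module

/-- The square formed by `η⁰` and `η¹` commutes. -/
theorem actTensor_etaZero (hk : k + 2 ≠ 0) {η₁ : Forms z →ₗ[ℂ] Coeff M k}
    {η₀ : Reg z →ₗ[ℂ] SlU z ⊗[ℂ] Coeff M k} (h₁ : IsEtaOne z M k η₁) (h₀ : IsEtaZero z M k η₀)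
    (g : Reg z) : actTensor z M k (η₀ g) = η₁ (twistedD z M k g) := by
  refine LinearMap.congr_fun (f := actTensor z M k ∘ₗ η₀) (g := η₁ ∘ₗ twistedD z M k)
    ((regBasis z).ext fun x => ?_) g
  rw [LinearMap.comp_apply, LinearMap.comp_apply, (isEtaZero_iff z M k η₀).mp h₀, regBasis_apply]
  rcases x with (_ | b) | ⟨m, b⟩
  · rw [show elem z (Sum.inl 0) = 1 from pow_zero _, etaOne_twistedD_one hk h₁, etaZeroValue,
      actTensor_tmul, act_etaZero_one]
  · rw [show elem z (Sum.inl (b + 1)) = coord z ^ (b + 1) from rfl, etaOne_twistedD_coord hk h₁,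
      ← act_etaZero_coord, etaZeroValue, map_sub, map_sum]
    rfl
  · rw [show elem z (Sum.inr (m, b)) = pole z m ^ (b + 1) from rfl, etaOne_twistedD_pole hk h₁,
      ← act_etaZero_pole, etaZeroValue, map_sub, map_sum]
    rfl

open CategoryTheory in
/-- The components of the morphism `η`. -/
def etaHom (η₁ : Forms z →ₗ[ℂ] Coeff M k) (η₀ : Reg z →ₗ[ℂ] SlU z ⊗[ℂ] Coeff M k) :
    ∀ p : ℕ, deRhamX z p ⟶ ModuleCat.of ℂ ((⋀[ℂ]^p (SlU z)) ⊗[ℂ] Coeff M k)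
  | 0 => ModuleCat.ofHom ((ceZero (SlU z) (Coeff M k)).toLinearMap ∘ₗ η₁)
  | 1 => ModuleCat.ofHom ((ceOne (SlU z) (Coeff M k)).toLinearMap ∘ₗ η₀)
  | _ + 2 => 0

open CategoryTheory in
theorem etaHom_comm (hk : k + 2 ≠ 0) {η₁ : Forms z →ₗ[ℂ] Coeff M k}
    {η₀ : Reg z →ₗ[ℂ] SlU z ⊗[ℂ] Coeff M k} (h₁ : IsEtaOne z M k η₁) (h₀ : IsEtaZero z M k η₀) :
    ∀ p : ℕ, etaHom η₁ η₀ (p + 1) ≫ ModuleCat.ofHom (ceD (act z M k) p) =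
      deRhamD z M k p ≫ etaHom η₁ η₀ p
  | 0 => by
    refine ModuleCat.hom_ext (LinearMap.ext fun g => ?_)
    change ceD (act z M k) 0 (ceOne (SlU z) (Coeff M k) (η₀ g)) =
      ceZero (SlU z) (Coeff M k) (η₁ (twistedD z M k g))
    exact (ceD_ceOne_eq _).trans (congrArg _ (actTensor_etaZero hk h₁ h₀ g))
  | _ + 1 => Limits.zero_comp.trans Limits.zero_comp.symm

variable (z M k) in
theorem chains_d (p : ℕ) : (chains z M k).d (p + 1) p = ModuleCat.ofHom (ceD (act z M k) p) :=
  ChainComplex.of_d (fun p => ModuleCat.of ℂ ((⋀[ℂ]^p (SlU z)) ⊗[ℂ] Coeff M k))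
    (fun p => ModuleCat.ofHom (ceD (act z M k) p)) p

variable (z M k) in
theorem deRham_d (p : ℕ) : (deRham z M k).d (p + 1) p = deRhamD z M k p :=
  ChainComplex.of_d (deRhamX z) (deRhamD z M k) p

open CategoryTheory in
/-- The morphism of complexes `η`. -/
def eta (hk : k + 2 ≠ 0) {η₁ : Forms z →ₗ[ℂ] Coeff M k}
    {η₀ : Reg z →ₗ[ℂ] SlU z ⊗[ℂ] Coeff M k} (h₁ : IsEtaOne z M k η₁) (h₀ : IsEtaZero z M k η₀) :
    deRham z M k ⟶ chains z M k :=
  ChainComplex.ofHom (etaHom η₁ η₀) fun p =>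
    (congrArg (fun d => etaHom η₁ η₀ (p + 1) ≫ d) (chains_d z M k p)).trans
      ((etaHom_comm hk h₁ h₀ p).trans
        (congrArg (fun d => d ≫ etaHom η₁ η₀ p) (deRham_d z M k p)).symm)

theorem etaHom_injective (hk : k + 2 ≠ 0) {η₁ : Forms z →ₗ[ℂ] Coeff M k}
    {η₀ : Reg z →ₗ[ℂ] SlU z ⊗[ℂ] Coeff M k} (h₁ : IsEtaOne z M k η₁) (h₀ : IsEtaZero z M k η₀) :
    ∀ p : ℕ, Function.Injective (etaHom η₁ η₀ p).hom
  | 0 => (ceZero (SlU z) (Coeff M k)).injective.comp (injective_of_isEtaOne hk h₁)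
  | 1 => (ceOne (SlU z) (Coeff M k)).injective.comp (injective_of_isEtaZero h₀)
  | _ + 2 => fun _ _ _ => PUnit.ext _ _

end Maps

end AffineSl2

end

theorem theorem5 (n : ℕ) (z : Fin n ↪ ℂ) (M : Fin n → ℂ) (k : ℂ) (hk : k ≠ -2) :
    (∃! η₁ : AffineSl2.Forms z →ₗ[ℂ] AffineSl2.Coeff M k, AffineSl2.IsEtaOne z M k η₁) ∧
    (∃! η₀ : AffineSl2.Reg z →ₗ[ℂ] AffineSl2.SlU z ⊗[ℂ] AffineSl2.Coeff M k,
      AffineSl2.IsEtaZero z M k η₀) ∧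
    ∀ (η₁ : AffineSl2.Forms z →ₗ[ℂ] AffineSl2.Coeff M k)
      (η₀ : AffineSl2.Reg z →ₗ[ℂ] AffineSl2.SlU z ⊗[ℂ] AffineSl2.Coeff M k),
      AffineSl2.IsEtaOne z M k η₁ → AffineSl2.IsEtaZero z M k η₀ →
      ∃ η : AffineSl2.deRham z M k ⟶ AffineSl2.chains z M k,
        η.f 0 = ModuleCat.ofHom
          ((AffineSl2.ceZero (AffineSl2.SlU z) (AffineSl2.Coeff M k)).toLinearMap ∘ₗ η₁) ∧
        η.f 1 = ModuleCat.ofHom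
          ((AffineSl2.ceOne (AffineSl2.SlU z) (AffineSl2.Coeff M k)).toLinearMap ∘ₗ η₀) ∧
        ∀ p : ℕ, Function.Injective (η.f p).hom := by
  have hκ : k + 2 ≠ 0 := fun h0 => hk (eq_neg_of_add_eq_zero_left h0)
  refine ⟨?_, ?_, fun η₁ η₀ h₁ h₀ => ⟨AffineSl2.eta hκ h₁ h₀, rfl, rfl,
    fun p => AffineSl2.etaHom_injective hκ h₁ h₀ p⟩⟩
  · simp only [AffineSl2.isEtaOne_iff]
    exact AffineSl2.existsUnique_of_basis _ _
  · simp only [AffineSl2.isEtaZero_iff]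
    exact AffineSl2.existsUnique_of_basis _ _
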